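/- **Setting.** Consider the Navier–Stokes equations $\partial_t u-\Delta u+u\cdot\nabla u+\nabla P=0$, $\nabla\cdot u=0$ on $\mathbb R^3\times(0,T)$, $0<T\le\infty$. For $h>0$ let $\{Q_j\}$ be the lattice of axis-parallel cubes of side length $h$, one of them centred at the origin, and let $J_hf=\sum_j\chi_{Q_j}\frac1{|Q_j|}\int_{Q_j}f\,dy$. A *mild solution* with data $u_0$ is a divergence-free field $u$ with $$u(t+\tau)=e^{\tau\Delta}u(t)-\int_0^\tau e^{(\tau-s)\Delta}\mathbb P\nabla\cdot(u\otimes u)(t+s)\,ds\qquad(t,\tau>0,\ t+\tau<T),$$ the integral being given by the absolutely convergent convolution with the derivative of the Oseen kernel, and with $u(t)\to u_0$ in the sense of distributions as $t\to0^+$. A *weak $L^{3,\infty}$-solution* with divergence-free data $u_0\in L^{3,\infty}$ is a field $u$ which, with some pressure $P\in L^{3/2}_{loc}$, solves the equations in the sense of distributions and satisfies the local energy inequality; for which $t\mapsto\int u(t)\cdot\psi\,dx$ is continuous on $[0,T)$ (with $u(0)=u_0$) for every compactly supported $\psi\in L^2$; and such that $\tilde u=u-e^{t\Delta}u_0$ satisfies,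 for all $t\in(0,T)$, $\sup_{0<s<t}\|\tilde u(s)\|_{L^2}^2+\int_0^t\|\nabla\tilde u\|_{L^2}^2ds<\infty$ and $$\|\tilde u(t)\|_{L^2}^2+2\int_0^t\!\!\int|\nabla\tilde u|^2\,dx\,ds\le2\int_0^t\!\!\int(e^{s\Delta}u_0\otimes\tilde u+e^{s\Delta}u_0\otimes e^{s\Delta}u_0):\nabla\tilde u\,dx\,ds .$$ Throughout, $u$ and $v$ are mild solutions with the same initial data, $w=u-v$, and $1/\infty=0$ in exponents (so $\frac{2p}{3-p}=-2$ and $\frac p{3-p}=-1$ for $p=\infty$). **Theorem.** 1. (Uniqueness criterion) Let $3<p\le\infty$, $c_1>0$ and $A\ge0$. There is $\epsilon_3=\epsilon_3(c_1,p,A)\in(0,c_1)$ such that the following holds for every $T\in(0,\infty]$. Suppose $u,v$ are in addition weak $L^{3,\infty}$-solutions on $(0,T)$ with the same data $u_0$, $\|u_0\|_{L^{3,\infty}}=A$, and $|u|(x,t)+|v|(x,t)\le\frac{c_1}{|x|+\sqrt t}$ on $\mathbb R^3\times(0,T)$. Let $$\bar h(t)=\max\Big\{2\,\frac{c_1-\epsilon_3}{\epsilon_3}\sqrt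 t,\ \Big(t^{3/4}\,\frac{t^{3/(2p)-1/2}}{\epsilon_3\|w(t)\|_{L^p}}\Big)^{2/3}\Big\}.$$ If for some $\delta\in(0,T]$ one has $\|w(t)-J_{\bar h(t)}w(t)\|_{L^p}\le\epsilon_3\|w(t)\|_{L^p}$ for all $t\in(0,\delta)$ (a condition that is void at times with $w(t)=0$), then $w=0$ on $\mathbb R^3\times(0,T)$. 2. (Large scales are active) Let $3<p\le\infty$, and let $\tilde c_p,C_B>0$ be any positive constants (in particular, the constant $\tilde c_p$ of the local existence time $\tilde c_p\|u_0\|_{L^p}^{2p/(3-p)}$ in $L^p$ and the universal constant $C_B$ of the bilinear estimate). There is $K>0$, depending only on $p,\tilde c_p,C_B$, such that the following holds. Let $T=\infty$, let $u,v\in L^\infty_{loc}((0,\infty);L^p)$ with common data a distribution, and suppose that for some $c_2>0$, $\|w(t)\|_{L^p}\,t^{1/2-3/(2p)}\ge c_2$ for all $t>0$. For $t>0$ put $M_0=2\max\{\|u(t)\|_{L^p},\|v(t)\|_{L^p}\}$, $$H=\big(4\tilde c_pM_0^{2p/(3-p)}+t\big)^{\frac12-\frac3{2p}},\qquad \gamma=\frac{c_2}{4M_0H},\qquad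 \frac1h=K\,\frac{4M_0H}{c_2}\Big(\frac{c_2}{4M_0^2C_BH}\Big)^{\frac p{3-p}} .$$ Then $\|J_hw(t)\|_{L^p}\ge\frac\gamma2\|w(t)\|_{L^p}$. -/

import Mathlib

open MeasureTheory Set Filter Topology
open scoped ENNReal NNReal Distributions

noncomputable section

/-- Three-dimensional Euclidean space. -/
abbrev E3 : Type := EuclideanSpace ℝ (Fin 3)

/-- The `k`-th partial derivative of a scalar function on `ℝ³`. -/
def pd (k : Fin 3) (f : E3 → ℝ) (x : E3) : ℝ :=
  lineDeriv ℝ f x (EuclideanSpace.single k 1)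

/-- The space-time region `(0,T) × ℝ³`, where `T ∈ [0,∞]`. -/
def slab (T : ℝ≥0∞) : TopologicalSpace.Opens (ℝ × E3) where
  carrier := {z | 0 < z.1 ∧ ENNReal.ofReal z.1 < T}
  is_open' := (isOpen_lt continuous_const continuous_fst).inter
    (isOpen_lt (ENNReal.continuous_ofReal.comp continuous_fst) continuous_const)

/-- Spatial partial derivative of a function of space-time. -/
def pdx (k : Fin 3) (φ : ℝ × E3 → ℝ) (z : ℝ × E3) : ℝ :=
  pd k (fun x => φ (z.1, x)) z.2

/-- Time derivative of a function of space-time. -/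
def pdt (φ : ℝ × E3 → ℝ) (z : ℝ × E3) : ℝ :=
  deriv (fun t => φ (t, z.2)) z.1

/-- Spatial Laplacian of a function of space-time. -/
def lapx (φ : ℝ × E3 → ℝ) (z : ℝ × E3) : ℝ :=
  ∑ j, pdx j (pdx j φ) z

/-! ### Heat semigroup and Oseen tensor -/

/-- The heat kernel on `ℝ³`. -/
def heatKernel (t : ℝ) (x : E3) : ℝ :=
  (4 * Real.pi * t) ^ (-(3 / 2) : ℝ) * Real.exp (-‖x‖ ^ 2 / (4 * t))

/-- The heat semigroup `e^{tΔ} f`. -/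
def heat (t : ℝ) (f : E3 → E3) (x : E3) : E3 :=
  ∫ y, heatKernel t (x - y) • f y

/-- The Oseen tensor: the convolution kernel of `e^{tΔ} ℙ`, where `ℙ = I + ∇(-Δ)⁻¹ div` is the Leray
projection. Since `(-Δ)⁻¹ = ∫₀^∞ e^{sΔ} ds`, the `(i,j)` entry of the kernel is
`δᵢⱼ G_t + ∫_t^∞ ∂ᵢ∂ⱼ G_s ds`, with `G` the heat kernel. -/
def oseen (t : ℝ) (i j : Fin 3) (x : E3) : ℝ :=
  (if i = j then heatKernel t x else 0) + ∫ s in Ioi t, pd i (pd j (heatKernel s)) x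

/-- The kernel of `e^{tΔ} ℙ ∇·` contracted with `a ⊗ a`: its `i`-th component is
`∑ⱼₖ ∂ₖ Kᵢⱼ(x,t) aⱼ aₖ`. -/
def oseenDiv (t : ℝ) (x a : E3) : E3 :=
  WithLp.toLp 2 fun i => ∑ j, ∑ k, pd k (oseen t i j) x * (a j * a k)

/-- The integrand of `∫₀^τ ∫ (e^{(τ-s)Δ} ℙ ∇·)(x - y) (u ⊗ u)(y, t+s) dy ds`. -/
def duhamelIntegrand (u : ℝ → E3 → E3) (t τ : ℝ) (x : E3) (z : ℝ × E3) : E3 :=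
  oseenDiv (τ - z.1) (x - z.2) (u (t + z.1) z.2)

/-- A vector field is divergence free in the sense of distributions. -/
def WeaklyDivFree (f : E3 → E3) : Prop :=
  ∀ φ : 𝓓((⊤ : TopologicalSpace.Opens E3), ℝ), ∫ x, ∑ i, f x i * pd i φ x = 0

/-- The distribution induced by a (locally integrable) vector field. -/
def regularDist (f : E3 → E3) (φ : 𝓓((⊤ : TopologicalSpace.Opens E3), ℝ)) : E3 :=
  ∫ x, φ x • f x

/-- `u` is a mild solution of the Navier–Stokes equations (unit viscosity) on `(0,T) × ℝ³`:
Duhamel's formula holds between any two positive times, and the initial data `U₀` (a distribution)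
is attained in the sense of distributions. -/
structure IsMildSolution (T : ℝ≥0∞) (U₀ : 𝓓((⊤ : TopologicalSpace.Opens E3), ℝ) → E3)
    (u : ℝ → E3 → E3) : Prop where
  measurable : AEStronglyMeasurable (fun z : ℝ × E3 => u z.1 z.2) (volume.restrict (slab T))
  locallyIntegrable : ∀ t, 0 < t → ENNReal.ofReal t < T → LocallyIntegrable (u t)
  divFree : ∀ t, 0 < t → ENNReal.ofReal t < T → WeaklyDivFree (u t)
  duhamel : ∀ t τ, 0 < t → 0 < τ → ENNReal.ofReal (t + τ) < T → ∀ᵐ x,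
    Integrable (fun y => heatKernel τ (x - y) • u t y) ∧
    IntegrableOn (duhamelIntegrand u t τ x) (Ioo 0 τ ×ˢ univ) ∧
    u (t + τ) x = heat τ (u t) x - ∫ z in Ioo 0 τ ×ˢ univ, duhamelIntegrand u t τ x z
  initial : ∀ φ : 𝓓((⊤ : TopologicalSpace.Opens E3), ℝ),
    Tendsto (fun t => ∫ x, φ x • u t x) (𝓝[>] 0) (𝓝 (U₀ φ))

/-! ### Weak `L^{3,∞}` solutions -/

/-- The weak-`L³` quasinorm `sup_λ λ |{|f| > λ}|^{1/3}`. -/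
def weakL3Norm (f : E3 → E3) : ℝ≥0∞ :=
  ⨆ r : ℝ≥0, (r : ℝ≥0∞) * volume {x | r < ‖f x‖₊} ^ (1 / 3 : ℝ)

/-- `g i j` is the weak spatial derivative `∂ⱼ uᵢ` on `(0,T) × ℝ³`, with `u` and `g` locally square
integrable there. -/
structure HasWeakGradient (T : ℝ≥0∞) (u : ℝ → E3 → E3)
    (g : Fin 3 → Fin 3 → ℝ × E3 → ℝ) : Prop where
  memLp : ∀ K : Set (ℝ × E3), IsCompact K → K ⊆ slab T →
    MemLp (fun z : ℝ × E3 => u z.1 z.2) 2 (volume.restrict K)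
  memLp_grad : ∀ K : Set (ℝ × E3), IsCompact K → K ⊆ slab T →
    ∀ i j, MemLp (g i j) 2 (volume.restrict K)
  parts : ∀ φ : 𝓓(slab T, ℝ), ∀ i j,
    ∫ z : ℝ × E3, u z.1 z.2 i * pdx j φ z = -∫ z : ℝ × E3, g i j z * φ z

/-- `(u, P)` solves the Navier–Stokes equations (unit viscosity) on `(0,T) × ℝ³` in the sense of
distributions. -/
structure IsDistributionalNS (T : ℝ≥0∞) (u : ℝ → E3 → E3) (P : ℝ × E3 → ℝ) : Prop where
  momentum : ∀ φ : 𝓓(slab T, ℝ), ∀ i,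
    ∫ z : ℝ × E3, (u z.1 z.2 i * (pdt φ z + lapx φ z)
      + (∑ j, u z.1 z.2 i * u z.1 z.2 j * pdx j φ z) + P z * pdx i φ z) = 0
  divFree : ∀ φ : 𝓓(slab T, ℝ), ∫ z : ℝ × E3, ∑ i, u z.1 z.2 i * pdx i φ z = 0

/-- The local energy inequality on `(0,T) × ℝ³`, where `g i j = ∂ⱼ uᵢ`. -/
def LocalEnergyInequality (T : ℝ≥0∞) (u : ℝ → E3 → E3) (P : ℝ × E3 → ℝ)
    (g : Fin 3 → Fin 3 → ℝ × E3 → ℝ) : Prop :=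
  ∀ φ : 𝓓(slab T, ℝ), (∀ z, 0 ≤ φ z) →
    2 * ∫ z : ℝ × E3, (∑ i, ∑ j, g i j z ^ 2) * φ z ≤
      (∫ z : ℝ × E3, ‖u z.1 z.2‖ ^ 2 * (pdt φ z + lapx φ z))
      + ∫ z : ℝ × E3, (‖u z.1 z.2‖ ^ 2 + 2 * P z) * ∑ i, u z.1 z.2 i * pdx i φ z

/-- `ũ(t) = u(t) - e^{tΔ} u₀`. -/
def nonlinearPart (u₀ : E3 → E3) (u : ℝ → E3 → E3) (t : ℝ) (x : E3) : E3 :=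
  u t x - heat t u₀ x

/-- `g i j = ∂ⱼ ũᵢ` is square integrable on `(0,t) × ℝ³`, `ũ` is bounded in `L²` on `(0,t)`, and the
global energy inequality for `ũ` holds at time `t`, for every `t ∈ (0,T)`. -/
structure EnergyClass (T : ℝ≥0∞) (u₀ : E3 → E3) (u : ℝ → E3 → E3)
    (g : Fin 3 → Fin 3 → ℝ × E3 → ℝ) : Prop where
  grad : HasWeakGradient T (nonlinearPart u₀ u) g
  memLp : ∀ t, 0 < t → ENNReal.ofReal t < T → MemLp (nonlinearPart u₀ u t) 2
  bounded : ∀ t, 0 < t → ENNReal.ofReal t < T →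
    ∃ C : ℝ≥0, ∀ s ∈ Ioo 0 t, eLpNorm (nonlinearPart u₀ u s) 2 volume ≤ C
  memLp_grad : ∀ t, 0 < t → ENNReal.ofReal t < T →
    ∀ i j, MemLp (g i j) 2 (volume.restrict (Ioo 0 t ×ˢ univ))
  energy : ∀ t, 0 < t → ENNReal.ofReal t < T →
    (∫ x, ‖nonlinearPart u₀ u t x‖ ^ 2)
      + 2 * ∫ z in Ioo 0 t ×ˢ univ, ∑ i, ∑ j, g i j z ^ 2 ≤
    2 * ∫ z in Ioo 0 t ×ˢ univ, ∑ i, ∑ j,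
      (heat z.1 u₀ z.2 i * nonlinearPart u₀ u z.1 z.2 j
        + heat z.1 u₀ z.2 i * heat z.1 u₀ z.2 j) * g i j z

/-- `u` (with some associated pressure) is a weak `L^{3,∞}`-solution on `(0,T) × ℝ³` with divergence
free initial data `u₀ ∈ L^{3,∞}`. -/
structure IsWeakL3Solution (T : ℝ≥0∞) (u₀ : E3 → E3) (u : ℝ → E3 → E3) : Prop where
  data_measurable : AEStronglyMeasurable u₀
  data_weakL3 : weakL3Norm u₀ < ∞
  data_divFree : WeaklyDivFree u₀
  equation : ∃ (P : ℝ × E3 → ℝ) (g : Fin 3 → Fin 3 → ℝ × E3 → ℝ),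
    (∀ K : Set (ℝ × E3), IsCompact K → K ⊆ slab T →
      MemLp (fun z : ℝ × E3 => u z.1 z.2) 3 (volume.restrict K) ∧
      MemLp P (3 / 2) (volume.restrict K)) ∧
    HasWeakGradient T u g ∧ IsDistributionalNS T u P ∧ LocalEnergyInequality T u P g
  weakly_continuous : ∀ ψ : E3 → E3, HasCompactSupport ψ → MemLp ψ 2 →
    ContinuousOn (fun t => ∫ x, inner ℝ (u t x) (ψ x)) {t | 0 < t ∧ ENNReal.ofReal t < T} ∧
    Tendsto (fun t => ∫ x, inner ℝ (u t x) (ψ x)) (𝓝[>] 0) (𝓝 (∫ x, inner ℝ (u₀ x) (ψ x)))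
  energyClass : ∃ g : Fin 3 → Fin 3 → ℝ × E3 → ℝ, EnergyClass T u₀ u g

/-! ### Cube averages -/

/-- The cube containing `x` in the lattice of half-open axis-parallel cubes of side length `h`, one
of which is centred at the origin. -/
def latticeCube (h : ℝ) (x : E3) : Set E3 :=
  {y | ∀ i, ⌊y i / h + 1 / 2⌋ = ⌊x i / h + 1 / 2⌋}

/-- The interpolant `J_h f`, equal on each cube of the lattice to the mean of `f` over it. -/
def cubeAverage (h : ℝ) (f : E3 → E3) (x : E3) : E3 :=
  ⨍ y in latticeCube h x, f y

/-! ### Assumptions on the pair of flows, and the scales -/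

/-- `|u|(x,t) + |v|(x,t) ≤ c₁ / (|x| + √t)` on `(0,T) × ℝ³`. -/
def CenteredTypeI (T : ℝ≥0∞) (c₁ : ℝ) (u v : ℝ → E3 → E3) : Prop :=
  ∀ t, 0 < t → ENNReal.ofReal t < T → ∀ᵐ x, ‖u t x‖ + ‖v t x‖ ≤ c₁ / (‖x‖ + √t)

/-- The exponent `1/2 - 3/(2p)`, for `p ∈ (3,∞]`. -/
def critExp (p : ℝ≥0∞) : ℝ := 1 / 2 - 3 / 2 * (p⁻¹).toReal

/-- `‖w(t)‖_{L^p} t^{1/2 - 3/(2p)} ≥ c₂` for all `t > 0`. -/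
def CriticalLowerBound (p : ℝ≥0∞) (c₂ : ℝ) (w : ℝ → E3 → E3) : Prop :=
  ∀ t, 0 < t → ENNReal.ofReal c₂ ≤ eLpNorm (w t) p volume * ENNReal.ofReal (t ^ critExp p)

/-- `u ∈ L^∞_loc((0,∞); L^p)`. -/
def LocallyBoundedLp (p : ℝ≥0∞) (u : ℝ → E3 → E3) : Prop :=
  ∀ a b, 0 < a → ∃ C : ℝ≥0, ∀ t ∈ Icc a b, eLpNorm (u t) p volume ≤ C

/-- The scale
`h̄(t) = max {2 (c₁-ε)/ε √t, (t^{3/4} t^{3/(2p)-1/2} / (ε ‖w(t)‖_p))^{2/3}}`. -/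
def hBar (c₁ ε : ℝ) (p : ℝ≥0∞) (w : ℝ → E3 → E3) (t : ℝ) : ℝ :=
  max (2 * ((c₁ - ε) / ε) * √t)
    ((t ^ (3 / 4 : ℝ) * (t ^ (3 / 2 * (p⁻¹).toReal - 1 / 2)
      / (ε * (eLpNorm (w t) p volume).toReal))) ^ (2 / 3 : ℝ))

/-- `M₀(t) = 2 max {‖u(t)‖_p, ‖v(t)‖_p}`. -/
def M0 (p : ℝ≥0∞) (u v : ℝ → E3 → E3) (t : ℝ) : ℝ :=
  2 * max (eLpNorm (u t) p volume).toReal (eLpNorm (v t) p volume).toReal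

/-- `(4 c̃ M^{2p/(3-p)} + t)^{1/2-3/(2p)}`; the inner exponent is written `2/(3/p - 1)`, so that it is
`-2` for `p = ∞`. -/
def horizon (p : ℝ≥0∞) (ct M t : ℝ) : ℝ :=
  (4 * ct * M ^ (2 / (3 * (p⁻¹).toReal - 1)) + t) ^ critExp p

/-- The fraction `γ = c₂ / (4 M (4 c̃ M^{2p/(3-p)} + t)^{1/2-3/(2p)})`. -/
def gammaFrac (p : ℝ≥0∞) (ct c₂ M t : ℝ) : ℝ :=
  c₂ / (4 * M * horizon p ct M t)

/-- The inverse length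
`(4 M H / c₂) (c₂ / (4 M² C_B H))^{p/(3-p)}`, `H = (4 c̃ M^{2p/(3-p)} + t)^{1/2-3/(2p)}`. -/
def invScale (p : ℝ≥0∞) (ct CB c₂ M t : ℝ) : ℝ :=
  4 * M * horizon p ct M t / c₂
    * (c₂ / (4 * M ^ 2 * CB * horizon p ct M t)) ^ (1 / (3 * (p⁻¹).toReal - 1))

end

noncomputable section


/-! Write `w = u - v` and `c = critExp p > 0`. Both halves rest on Duhamel's formula for `w`, in
which the Oseen kernel enters only through the bound `|∇K(x,σ)| ≤ C (σ + |x|²)⁻²`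
(`abs_pd_oseen_le`). Young's and Minkowski's inequalities then reduce the spatial estimates to power
integrals in time.

Uniqueness. The data agree and `|w| ≤ c₁/|x|`, so the initial time may be sent to zero in Duhamel's
formula (`enorm_sub_le_duhamelPotential`): `|w(t)|` is at most a constant times the potential of
`(|u| + |v|)|w|` over `(0,t)`. Split each slice at the ball of radius `((c₁-ε)/ε)√s`. Outside it the
Type I weight is at most `ε/√s`, so its `L⁶` norm gains `ε^{1/6}`
(`exists_eLpNorm_outer_weight_le`). Inside it, `w` is the sum of `w - J_h̄ w`, small by assumption,
and `J_h̄ w`, which Cauchy–Schwarz bounds pointwise by `h̄^{-3/2}‖w‖₂`. Duhamel's formula also gives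
`‖w(t)‖₂ ≤ C t^{1/4}` (`exists_eLpNorm_two_le`), and `h̄` is chosen so that the `L^p` norm of `J_h̄
w` on the ball is at most `C ε^{1-3/p}‖w‖_p` (`exists_eLpNorm_ball_le`). All powers of time balance:
a bound `‖w(s)‖_p ≤ D s^{-c}` on `(0,δ)` improves to `D/2` once `ε` is small (`exists_threshold`).
The Type I bound starts the iteration, so `w = 0` on `(0,δ)`. From a positive time on, both flows
are bounded, and uniqueness of bounded flows gives the rest (`IsDuhamelFlow.eq_of_eq_at`).

Large scales. Take one Duhamel step of length `τ` from time `t`. The assumed lower bound keeps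
`‖w(t+τ)‖_p` above `c₂/H`. The nonlinear term is at most `c₂/(4H)`, because both `L^p` norms stay
below `M₀` during the step (`exists_persistence`). Transferring the averaging to the heat kernel
gives `‖e^{τΔ}(w - J_h w)‖_p ≤ C h τ^{-1/2}‖w‖_p` (`exists_eLpNorm_heat_sub_cubeAverage_le`), which
is at most `c₂/(4H)` by the choice of `h`. The heat flow of `J_h w` must carry what remains, so
`‖J_h w‖_p ≥ c₂/(2H)`. -/

/-! ### Derivatives of the heat kernel and their pointwise bounds -/

theorem hasDerivAt_coord_line (x : E3) (i k : Fin 3) (t : ℝ) :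
    HasDerivAt (fun t : ℝ => (x + t • EuclideanSpace.single k (1 : ℝ)) i)
      (if i = k then 1 else 0) t := by
  by_cases h : i = k
  · subst h; simpa using (hasDerivAt_id t).const_add (x i)
  · simpa [h] using hasDerivAt_const t (x i)

theorem hasDerivAt_heatKernel_line (s : ℝ) (x : E3) (k : Fin 3) (t : ℝ) :
    HasDerivAt (fun t : ℝ => heatKernel s (x + t • EuclideanSpace.single k (1 : ℝ)))
      (-((x + t • EuclideanSpace.single k (1 : ℝ)) k / (2 * s)) *
        heatKernel s (x + t • EuclideanSpace.single k (1 : ℝ))) t := by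
  have h1 : HasDerivAt (fun t : ℝ => x + t • EuclideanSpace.single k (1 : ℝ))
      (EuclideanSpace.single k (1 : ℝ)) t := by
    simpa using ((hasDerivAt_id t).smul_const (EuclideanSpace.single k (1 : ℝ))).const_add x
  have h2 := ((h1.norm_sq.neg.div_const (4 * s)).exp).const_mul ((4 * Real.pi * s) ^ (-(3 / 2) : ℝ))
  refine h2.congr_deriv ?_
  simp only [heatKernel, EuclideanSpace.inner_single_right]
  simp
  ring

theorem pd_heatKernel (s : ℝ) (i : Fin 3) :
    pd i (heatKernel s) = fun x => -(x i / (2 * s)) * heatKernel s x := by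
  funext x
  have := (hasDerivAt_heatKernel_line s x i 0).deriv
  simpa [pd, lineDeriv] using this

/-- The Hessian of the heat kernel. -/
def heatHess (i j : Fin 3) (s : ℝ) (x : E3) : ℝ :=
  (x i * x j / (4 * s ^ 2) - (if i = j then 1 else 0) / (2 * s)) * heatKernel s x

/-- The third derivatives of the heat kernel. -/
def heatThird (i j k : Fin 3) (s : ℝ) (x : E3) : ℝ :=
  (((if i = k then 1 else 0) * x j + x i * (if j = k then 1 else 0)) / (4 * s ^ 2)
    - (x i * x j / (4 * s ^ 2) - (if i = j then 1 else 0) / (2 * s)) * (x k / (2 * s)))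
    * heatKernel s x

theorem pd_pd_heatKernel (s : ℝ) (i j : Fin 3) :
    pd i (pd j (heatKernel s)) = heatHess i j s := by
  funext x
  have h := (((hasDerivAt_coord_line x j i 0).div_const (2 * s)).neg.mul
    (hasDerivAt_heatKernel_line s x i 0)).deriv
  rw [pd_heatKernel, pd, lineDeriv]
  refine h.trans ?_
  simp only [heatHess, zero_smul, add_zero, eq_comm (a := j), Pi.neg_apply]
  ring

theorem hasDerivAt_heatHess_line (i j k : Fin 3) (s : ℝ) (x : E3) (t : ℝ) :
    HasDerivAt (fun t : ℝ => heatHess i j s (x + t • EuclideanSpace.single k (1 : ℝ)))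
      (heatThird i j k s (x + t • EuclideanSpace.single k (1 : ℝ))) t := by
  have h := ((((hasDerivAt_coord_line x i k t).mul (hasDerivAt_coord_line x j k t)).div_const
    (4 * s ^ 2)).sub_const ((if i = j then 1 else 0) / (2 * s))).mul
    (hasDerivAt_heatKernel_line s x k t)
  refine h.congr_deriv ?_
  simp only [heatThird, Pi.mul_apply]
  ring

theorem heatKernel_nonneg {s : ℝ} (hs : 0 ≤ s) (x : E3) : 0 ≤ heatKernel s x := by
  unfold heatKernel; positivity

/-- Compare `exp` at `(1+z)/4` with its fifth Taylor term. The fifth power is what third derivatives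
of the heat kernel consume: their polynomial factor grows like `(1+z)²` in the similarity variable
`z = |x|²/s`, and a decay of `(1+z)⁻³` has to remain. -/
theorem pow_five_mul_exp_le {z : ℝ} (hz : 0 ≤ z) :
    (1 + z) ^ 5 * Real.exp (-z / 4) ≤ 4 ^ 5 * 120 * Real.exp (1 / 4) := by
  have h := Real.pow_div_factorial_le_exp ((1 + z) / 4) (by positivity) 5
  have h2 : Real.exp (-z / 4) * Real.exp ((1 + z) / 4) = Real.exp (1 / 4) := by
    rw [← Real.exp_add]; ring_nf
  have h3 := Real.exp_pos (-z / 4)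
  rw [← h2]
  have h4 : (1 + z) ^ 5 ≤ 4 ^ 5 * 120 * Real.exp ((1 + z) / 4) := by
    have : (Nat.factorial 5 : ℝ) = 120 := by norm_num [Nat.factorial]
    rw [this, div_pow, div_div, div_le_iff₀ (by norm_num)] at h
    linarith
  nlinarith

theorem four_pi_rpow_le {s : ℝ} (hs : 0 < s) :
    (4 * Real.pi * s) ^ (-(3 / 2) : ℝ) ≤ s ^ (-(3 / 2) : ℝ) := by
  apply Real.rpow_le_rpow_of_nonpos hs _ (by norm_num)
  nlinarith [Real.pi_gt_three]

/-- The heat kernel in the similarity variable. -/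
theorem heatKernel_le_similarity {s : ℝ} (hs : 0 < s) (x : E3) :
    heatKernel s x ≤ s ^ (-(3 / 2) : ℝ) *
      (4 ^ 5 * 120 * Real.exp (1 / 4) / (1 + ‖x‖ ^ 2 / s) ^ 5) := by
  have hz : 0 ≤ ‖x‖ ^ 2 / s := by positivity
  have h := pow_five_mul_exp_le hz
  unfold heatKernel
  refine mul_le_mul (four_pi_rpow_le hs) ?_ (Real.exp_pos _).le (by positivity)
  rw [le_div_iff₀ (by positivity)]
  have : -‖x‖ ^ 2 / (4 * s) = -(‖x‖ ^ 2 / s) / 4 := by field_simp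
  rw [this]; linarith

theorem abs_coord_le (x : E3) (i : Fin 3) : |x i| ≤ ‖x‖ := by
  simpa using PiLp.norm_apply_le x i

theorem norm_le_similarity {s : ℝ} (hs : 0 < s) (x : E3) :
    ‖x‖ ≤ √s * (1 + ‖x‖ ^ 2 / s) := by
  have h1 : ‖x‖ ^ 2 / s = (‖x‖ / √s) ^ 2 := by rw [div_pow, Real.sq_sqrt hs.le]
  have h2 : ‖x‖ = √s * (‖x‖ / √s) := by field_simp
  rw [h1]
  nlinarith [sq_nonneg (‖x‖ / √s - 1), Real.sqrt_pos.2 hs, norm_nonneg x,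
    div_nonneg (norm_nonneg x) (Real.sqrt_nonneg s)]

/-- Constant in the pointwise bounds for the heat kernel. -/
def kC : ℝ := 4 ^ 5 * 120 * Real.exp (1 / 4)

theorem kC_pos : 0 < kC := by unfold kC; positivity

theorem rpow_neg_three_halves {s : ℝ} (hs : 0 < s) : s ^ (-(3 / 2) : ℝ) = (√s)⁻¹ ^ 3 := by
  rw [Real.sqrt_eq_rpow, ← Real.rpow_neg hs.le, ← Real.rpow_natCast, ← Real.rpow_mul hs.le]
  norm_num

theorem norm_mul_heatKernel_le {s : ℝ} (hs : 0 < s) (x : E3) :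
    ‖x‖ / (2 * s) * heatKernel s x ≤ kC * ((s + ‖x‖ ^ 2) ^ 2)⁻¹ := by
  obtain ⟨r, hr, rfl⟩ : ∃ r : ℝ, 0 < r ∧ s = r ^ 2 :=
    ⟨√s, Real.sqrt_pos.2 hs, (Real.sq_sqrt hs.le).symm⟩
  have hG := heatKernel_le_similarity hs x
  have hx := norm_le_similarity hs x
  rw [rpow_neg_three_halves hs] at hG
  rw [Real.sqrt_sq hr.le] at hG hx
  have hz : ‖x‖ ^ 2 = r ^ 2 * (‖x‖ ^ 2 / r ^ 2) := by field_simp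
  set z := ‖x‖ ^ 2 / r ^ 2
  have hz0 : 0 ≤ z := by positivity
  have e : r ^ 2 + ‖x‖ ^ 2 = r ^ 2 * (1 + z) := by rw [hz]; ring
  rw [e]
  calc _ ≤ (r * (1 + z)) / (2 * r ^ 2) * (r⁻¹ ^ 3 * (kC / (1 + z) ^ 5)) := by
        gcongr
        · exact heatKernel_nonneg hs.le x
        · exact hG
    _ = kC * ((r ^ 2 * (1 + z)) ^ 2)⁻¹ * (1 / (2 * (1 + z) ^ 2)) := by
        have : 1 + z ≠ 0 := by positivity
        field_simp
    _ ≤ kC * ((r ^ 2 * (1 + z)) ^ 2)⁻¹ * 1 := by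
        have := kC_pos
        gcongr
        rw [div_le_one (by positivity)]
        nlinarith
    _ = _ := mul_one _

theorem abs_pd_heatKernel_le {s : ℝ} (hs : 0 < s) (x : E3) (i : Fin 3) :
    |pd i (heatKernel s) x| ≤ kC * ((s + ‖x‖ ^ 2) ^ 2)⁻¹ := by
  refine le_trans ?_ (norm_mul_heatKernel_le hs x)
  have := heatKernel_nonneg hs.le x
  rw [pd_heatKernel, abs_mul, abs_neg, abs_div, abs_of_nonneg this,
    abs_of_pos (by positivity : 0 < 2 * s)]
  gcongr
  exact abs_coord_le x i

/-- In the similarity variable the kernel is `s^{-3/2}` times a rapidly decaying profile and three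
derivatives cost `s^{-3/2}`. This form of the bound has an explicit integral over `s > σ`, namely a
multiple of `(σ + |x|²)⁻²`. -/
theorem abs_heatThird_le {s : ℝ} (hs : 0 < s) (x : E3) (i j k : Fin 3) :
    |heatThird i j k s x| ≤ kC * ((s + ‖x‖ ^ 2) ^ 3)⁻¹ := by
  obtain ⟨r, hr, rfl⟩ : ∃ r : ℝ, 0 < r ∧ s = r ^ 2 := ⟨√s, Real.sqrt_pos.2 hs, (Real.sq_sqrt hs.le).symm⟩
  have hG := heatKernel_le_similarity hs x
  have hx := norm_le_similarity hs x
  rw [rpow_neg_three_halves hs] at hG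
  rw [Real.sqrt_sq hr.le] at hG hx
  have hn := norm_nonneg x
  have hz : ‖x‖ ^ 2 = r ^ 2 * (‖x‖ ^ 2 / r ^ 2) := by field_simp
  set z := ‖x‖ ^ 2 / r ^ 2
  have hz0 : 0 ≤ z := by positivity
  have e : r ^ 2 + ‖x‖ ^ 2 = r ^ 2 * (1 + z) := by rw [hz]; ring
  have hd : ∀ a b : Fin 3, |(if a = b then (1 : ℝ) else 0)| ≤ 1 := by
    intro a b; split_ifs <;> simp
  have hxi := abs_coord_le x i
  have hxj := abs_coord_le x j
  have hxk := abs_coord_le x k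
  rw [heatThird, abs_mul, abs_of_nonneg (heatKernel_nonneg hs.le x), e]
  have hb : |((if i = k then (1 : ℝ) else 0) * x j + x i * (if j = k then 1 else 0)) / (4 * (r ^ 2) ^ 2)
    - (x i * x j / (4 * (r ^ 2) ^ 2) - (if i = j then 1 else 0) / (2 * r ^ 2)) * (x k / (2 * r ^ 2))|
      ≤ (1 * ‖x‖ + ‖x‖ * 1) / (4 * (r ^ 2) ^ 2)
        + (‖x‖ * ‖x‖ / (4 * (r ^ 2) ^ 2) + 1 / (2 * r ^ 2)) * (‖x‖ / (2 * r ^ 2)) := by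
    refine (abs_sub _ _).trans (add_le_add ?_ ?_)
    · rw [abs_div, abs_of_pos (by positivity : 0 < 4 * (r ^ 2) ^ 2)]
      gcongr
      refine (abs_add_le _ _).trans (add_le_add ?_ ?_)
      · rw [abs_mul]; gcongr; exact hd _ _
      · rw [abs_mul]; gcongr; exact hd _ _
    · rw [abs_mul, abs_div (x k), abs_of_pos (by positivity : 0 < 2 * r ^ 2)]
      gcongr
      refine (abs_sub _ _).trans (add_le_add ?_ ?_)
      · rw [abs_div, abs_mul, abs_of_pos (by positivity : 0 < 4 * (r ^ 2) ^ 2)]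
        gcongr
      · rw [abs_div, abs_of_pos (by positivity : 0 < 2 * r ^ 2)]
        gcongr; exact hd _ _
  have hb2 : (1 * ‖x‖ + ‖x‖ * 1) / (4 * (r ^ 2) ^ 2)
        + (‖x‖ * ‖x‖ / (4 * (r ^ 2) ^ 2) + 1 / (2 * r ^ 2)) * (‖x‖ / (2 * r ^ 2))
      ≤ (1 + z) ^ 2 / r ^ 3 := by
    have : (1 * ‖x‖ + ‖x‖ * 1) / (4 * (r ^ 2) ^ 2)
        + (‖x‖ * ‖x‖ / (4 * (r ^ 2) ^ 2) + 1 / (2 * r ^ 2)) * (‖x‖ / (2 * r ^ 2))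
        = ‖x‖ * (6 * r ^ 2 + ‖x‖ ^ 2) / (8 * r ^ 6) := by field_simp; ring
    rw [this, hz]
    calc _ ≤ (r * (1 + z)) * (8 * r ^ 2 + 8 * r ^ 2 * z) / (8 * r ^ 6) := by
          gcongr <;> nlinarith [sq_nonneg r, mul_nonneg (sq_nonneg r) hz0]
      _ = (1 + z) ^ 2 / r ^ 3 := by field_simp
  calc _ ≤ (1 + z) ^ 2 / r ^ 3 * (r⁻¹ ^ 3 * (kC / (1 + z) ^ 5)) := by
        gcongr
        · exact heatKernel_nonneg hs.le x
        · exact hb.trans hb2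
        · exact hG
    _ = kC * ((r ^ 2 * (1 + z)) ^ 3)⁻¹ := by
        have : 1 + z ≠ 0 := by positivity
        field_simp


/-- Decay in `x` is not needed here: the bound serves only to make the Hessian integrable over `s >
σ`, as differentiation under the integral requires. -/
theorem abs_heatHess_le {s : ℝ} (hs : 0 < s) (x : E3) (i j : Fin 3) :
    |heatHess i j s x| ≤ kC * s ^ (-(5 / 2) : ℝ) := by
  have hG := heatKernel_le_similarity hs x
  have hxi := abs_coord_le x i
  have hxj := abs_coord_le x j
  have hz : ‖x‖ ^ 2 = s * (‖x‖ ^ 2 / s) := by field_simp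
  have hsp : s ^ (-(5 / 2) : ℝ) = s ^ (-(3 / 2) : ℝ) / s := by
    rw [← Real.rpow_sub_one hs.ne']; norm_num
  set z := ‖x‖ ^ 2 / s
  have hz0 : 0 ≤ z := by positivity
  have hd : |(if i = j then (1 : ℝ) else 0)| ≤ 1 := by split_ifs <;> simp
  rw [heatHess, abs_mul, abs_of_nonneg (heatKernel_nonneg hs.le x), hsp]
  have hb : |x i * x j / (4 * s ^ 2) - (if i = j then 1 else 0) / (2 * s)| ≤ (1 + z) / s := by
    refine (abs_sub _ _).trans ?_
    rw [abs_div, abs_div, abs_mul, abs_of_pos (by positivity : 0 < 4 * s ^ 2),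
      abs_of_pos (by positivity : 0 < 2 * s)]
    calc _ ≤ ‖x‖ * ‖x‖ / (4 * s ^ 2) + 1 / (2 * s) := by gcongr
      _ = (z + 2) / (4 * s) := by rw [← sq, hz]; field_simp; ring
      _ ≤ _ := by rw [div_le_div_iff₀ (by positivity) hs]; nlinarith
  calc _ ≤ (1 + z) / s * (s ^ (-(3 / 2) : ℝ) * (kC / (1 + z) ^ 5)) := by
        gcongr
        · exact heatKernel_nonneg hs.le x
        · exact hG
    _ = kC * (s ^ (-(3 / 2) : ℝ) / s) * (1 / (1 + z) ^ 4) := by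
        have : 1 + z ≠ 0 := by positivity
        field_simp
    _ ≤ kC * (s ^ (-(3 / 2) : ℝ) / s) * 1 := by
        have := kC_pos
        gcongr
        rw [div_le_one (by positivity)]
        exact one_le_pow₀ (by linarith)
    _ = _ := mul_one _

theorem measurable_heatKernel : Measurable (fun z : ℝ × E3 => heatKernel z.1 z.2) := by
  unfold heatKernel; fun_prop

theorem measurable_heatHess (i j : Fin 3) (x : E3) : Measurable (fun s => heatHess i j s x) := by
  unfold heatHess heatKernel; fun_prop

theorem measurable_heatThird (i j k : Fin 3) (x : E3) :
    Measurable (fun s => heatThird i j k s x) := by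
  unfold heatThird heatKernel; fun_prop

/-! ### The derivative of the Oseen tensor and its majorant -/

theorem integrableOn_shifted_cube {σ a : ℝ} (hσ : 0 < σ) (ha : 0 ≤ a) :
    IntegrableOn (fun s : ℝ => ((s + a) ^ 3)⁻¹) (Ioi σ) ∧
      ∫ s in Ioi σ, ((s + a) ^ 3)⁻¹ = (2 * (σ + a) ^ 2)⁻¹ := by
  have hd : ∀ s ∈ Ici σ, HasDerivAt (fun s : ℝ => -(2 * (s + a) ^ 2)⁻¹) ((s + a) ^ 3)⁻¹ s := by
    intro s hs
    have h0 : 0 < s + a := by have := mem_Ici.1 hs; linarith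
    have := ((((hasDerivAt_id s).add_const a).pow 2).const_mul 2).inv (by simp; positivity)
    refine this.neg.congr_deriv ?_
    simp
    field_simp
  have hp : ∀ s ∈ Ioi σ, 0 ≤ ((s + a) ^ 3)⁻¹ := by
    intro s hs
    have h0 : 0 < s + a := by have := mem_Ioi.1 hs; linarith
    positivity
  have hl : Tendsto (fun s : ℝ => -(2 * (s + a) ^ 2)⁻¹) atTop (𝓝 0) := by
    rw [← neg_zero]
    refine (Tendsto.inv_tendsto_atTop ?_).neg
    exact ((tendsto_pow_atTop two_ne_zero).comp (tendsto_atTop_add_const_right _ a tendsto_id)).const_mul_atTop (by norm_num)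
  refine ⟨integrableOn_Ioi_deriv_of_nonneg' hd hp hl, ?_⟩
  rw [integral_Ioi_of_hasDerivAt_of_nonneg' hd hp hl]; ring

theorem pd_oseen {σ : ℝ} (hσ : 0 < σ) (i j k : Fin 3) (x : E3) :
    pd k (oseen σ i j) x = (if i = j then pd k (heatKernel σ) x else 0)
      + ∫ s in Ioi σ, heatThird i j k s x := by
  have h1 : HasDerivAt (fun t : ℝ => if i = j then
      heatKernel σ (x + t • EuclideanSpace.single k (1 : ℝ)) else 0)
      (if i = j then pd k (heatKernel σ) x else 0) 0 := by
    split_ifs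
    · have h := hasDerivAt_heatKernel_line σ x k 0
      rw [pd, lineDeriv, h.deriv]; exact h
    · exact hasDerivAt_const _ _
  have h2 : HasDerivAt (fun t : ℝ => ∫ s in Ioi σ, heatHess i j s
      (x + t • EuclideanSpace.single k (1 : ℝ)))
      (∫ s in Ioi σ, heatThird i j k s (x + (0 : ℝ) • EuclideanSpace.single k (1 : ℝ))) 0 := by
    refine (hasDerivAt_integral_of_dominated_loc_of_deriv_le (s := univ)
      (F := fun t s => heatHess i j s (x + t • EuclideanSpace.single k (1 : ℝ)))
      (F' := fun t s => heatThird i j k s (x + t • EuclideanSpace.single k (1 : ℝ)))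
      -- Dropping `|x|²` makes the bound uniform along the line; the `+ 0` matches
      -- `integrableOn_shifted_cube` with `a = 0`.
      (bound := fun s => kC * ((s + 0) ^ 3)⁻¹)
      Filter.univ_mem ?_ ?_ ?_ ?_ ?_ ?_).2
    · exact Eventually.of_forall fun t => (measurable_heatHess i j _).aestronglyMeasurable
    · refine Integrable.mono' ((integrableOn_Ioi_rpow_of_lt (a := -(5 / 2)) (by norm_num) hσ).const_mul kC)
        (measurable_heatHess i j _).aestronglyMeasurable ?_
      filter_upwards [ae_restrict_mem measurableSet_Ioi] with s hs
      exact abs_heatHess_le (hσ.trans hs) _ i j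
    · exact (measurable_heatThird i j k _).aestronglyMeasurable
    · filter_upwards [ae_restrict_mem measurableSet_Ioi] with s hs t _
      have hs0 : 0 < s := hσ.trans hs
      refine (abs_heatThird_le hs0 _ i j k).trans ?_
      have := kC_pos
      gcongr
      positivity
    · exact (integrableOn_shifted_cube hσ le_rfl).1.const_mul kC
    · exact Eventually.of_forall fun s t _ => hasDerivAt_heatHess_line i j k s x t
  have h3 := (h1.add h2).deriv
  simp only [zero_smul, add_zero] at h3
  rw [← h3, pd, lineDeriv]
  congr 1
  funext t
  simp only [oseen, pd_pd_heatKernel, Pi.add_apply]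

/-- The pointwise majorant `(σ + |x|²)⁻²` of the derivative of the Oseen tensor. -/
def kmaj (σ : ℝ) (x : E3) : ℝ≥0∞ := ENNReal.ofReal (((σ + ‖x‖ ^ 2) ^ 2)⁻¹)

/-- The local part is a first derivative of the heat kernel, and the tail integrates `(s + |x|²)⁻³`
over `s > σ`; both have size `(σ + |x|²)⁻²`. Every later estimate of the nonlinear term uses the
Oseen tensor through this bound alone. -/
theorem abs_pd_oseen_le {σ : ℝ} (hσ : 0 < σ) (i j k : Fin 3) (x : E3) :
    |pd k (oseen σ i j) x| ≤ 2 * kC * ((σ + ‖x‖ ^ 2) ^ 2)⁻¹ := by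
  have hk := kC_pos
  have h1 : |if i = j then pd k (heatKernel σ) x else 0| ≤ kC * ((σ + ‖x‖ ^ 2) ^ 2)⁻¹ := by
    split_ifs
    · exact abs_pd_heatKernel_le hσ x k
    · simp; positivity
  have h2 : |∫ s in Ioi σ, heatThird i j k s x| ≤ kC * ((σ + ‖x‖ ^ 2) ^ 2)⁻¹ := by
    obtain ⟨hi, he⟩ := integrableOn_shifted_cube hσ (sq_nonneg ‖x‖)
    have := norm_integral_le_of_norm_le (hi.const_mul kC) (f := fun s => heatThird i j k s x) (by
      filter_upwards [ae_restrict_mem measurableSet_Ioi] with s hs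
      exact abs_heatThird_le (hσ.trans hs) _ i j k)
    rw [integral_const_mul, he] at this
    refine this.trans ?_
    gcongr
    linarith [sq_nonneg (σ + ‖x‖ ^ 2)]
  rw [pd_oseen hσ]
  exact (abs_add_le _ _).trans (by linarith)

theorem lintegral_scale (f : E3 → ℝ≥0∞) {r : ℝ} (hr : 0 < r) :
    ∫⁻ x, f x = ENNReal.ofReal (r ^ 3) * ∫⁻ x, f (r • x) := by
  have h := Measure.map_addHaar_smul (volume : Measure E3) hr.ne'
  have h2 : ∫⁻ x, f (r • x) = ∫⁻ x, f x ∂(Measure.map (r • ·) (volume : Measure E3)) := by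
    exact (lintegral_map_equiv f (Homeomorph.smulOfNeZero r hr.ne').toMeasurableEquiv).symm
  rw [h2, h, lintegral_smul_measure, smul_eq_mul, ← mul_assoc, ← ENNReal.ofReal_mul (by positivity)]
  simp only [finrank_euclideanSpace, Fintype.card_fin]
  rw [abs_of_pos (by positivity), mul_inv_cancel₀ (by positivity)]
  simp

theorem measurable_kmaj : Measurable (fun z : ℝ × E3 => kmaj z.1 z.2) := by
  unfold kmaj; fun_prop

/-- Rescaling by `√σ` reduces to `σ = 1`, where the integral converges because the decay exponent
`4m` exceeds the dimension. -/
theorem exists_lintegral_kmaj_rpow_le {m : ℝ} (hm : 1 ≤ m) :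
    ∃ C : ℝ≥0, ∀ σ : ℝ, 0 < σ →
      ∫⁻ x, kmaj σ x ^ m ≤ C * ENNReal.ofReal (σ ^ (3 / 2 - 2 * m)) := by
  have hint : Integrable (fun x : E3 => (1 + ‖x‖ ^ 2) ^ (-(4 * m) / 2)) :=
    integrable_rpow_neg_one_add_norm_sq (by simp; linarith)
  refine ⟨(∫⁻ x : E3, ENNReal.ofReal ((1 + ‖x‖ ^ 2) ^ (-(4 * m) / 2))).toNNReal, fun σ hσ => ?_⟩
  rw [ENNReal.coe_toNNReal hint.lintegral_lt_top.ne, lintegral_scale _ (Real.sqrt_pos.2 hσ)]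
  have key : ∀ x : E3, kmaj σ (√σ • x) ^ m =
      ENNReal.ofReal (σ ^ (-2 * m)) * ENNReal.ofReal ((1 + ‖x‖ ^ 2) ^ (-(4 * m) / 2)) := by
    intro x
    rw [kmaj, ENNReal.ofReal_rpow_of_nonneg (by positivity) (by linarith),
      ← ENNReal.ofReal_mul (by positivity), norm_smul, Real.norm_of_nonneg (Real.sqrt_nonneg _),
      mul_pow, Real.sq_sqrt hσ.le]
    congr 1
    have : σ + σ * ‖x‖ ^ 2 = σ * (1 + ‖x‖ ^ 2) := by ring
    rw [this, ← Real.rpow_natCast, ← Real.rpow_neg (by positivity), ← Real.rpow_mul (by positivity),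
      Real.mul_rpow hσ.le (by positivity)]
    congr 2
    push_cast; ring
  simp_rw [key]
  rw [lintegral_const_mul _ (by fun_prop), ← mul_assoc, mul_comm, ← ENNReal.ofReal_mul (by positivity)]
  gcongr
  rw [Real.sqrt_eq_rpow, ← Real.rpow_natCast, ← Real.rpow_mul hσ.le, ← Real.rpow_add hσ]
  apply le_of_eq; congr 1; push_cast; ring

theorem integral_heatKernel {τ : ℝ} (hτ : 0 < τ) :
    ∫ x, heatKernel τ x = 1 := by
  have h := GaussianFourier.integral_rexp_neg_mul_sq_norm (V := E3) (b := (4 * τ)⁻¹) (by positivity)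
  unfold heatKernel
  rw [integral_const_mul]
  have : ∀ x : E3, -‖x‖ ^ 2 / (4 * τ) = -(4 * τ)⁻¹ * ‖x‖ ^ 2 := by intro x; ring
  simp_rw [this]
  rw [h, ← Real.rpow_neg_one (4 * τ)]
  simp only [finrank_euclideanSpace, Fintype.card_fin]
  have e : Real.pi / (4 * τ) ^ (-1 : ℝ) = 4 * Real.pi * τ := by
    rw [Real.rpow_neg_one]; field_simp
  rw [e, ← Real.rpow_add (by positivity)]; norm_num

theorem lintegral_heatKernel {τ : ℝ} (hτ : 0 < τ) :
    ∫⁻ x, ENNReal.ofReal (heatKernel τ x) = 1 := by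
  have hi : Integrable (heatKernel τ) := by
    -- A function that is not integrable has Bochner integral `0`, so the value `1` already proves
    -- integrability.
    by_contra h
    have := integral_undef h
    rw [integral_heatKernel hτ] at this; norm_num at this
  rw [← ofReal_integral_eq_lintegral_ofReal hi
    (Eventually.of_forall fun x => heatKernel_nonneg hτ.le x), integral_heatKernel hτ]
  simp


/-! ### Hölder, Minkowski and Young inequalities, with finite and infinite exponents treated
together -/

section Inequalities

variable {α β : Type*} [MeasurableSpace α] [MeasurableSpace β] {μ : Measure α} {ν : Measure β}

/-- With `1/∞ = 0` the pointwise hypothesis becomes `F ≤ C` when `p = ∞`. Together with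
`exists_rpow_representation` this lets one Hölder computation cover finite `p` and `p = ∞`. No
measurability of `F` is needed. -/
theorem eLpNorm_le_of_ae_le_const_mul_rpow {p : ℝ≥0∞} (hp : 1 ≤ p) {F Φ : α → ℝ≥0∞} {C : ℝ≥0∞}
    (hΦ : AEMeasurable Φ μ) (h : ∀ᵐ x ∂μ, F x ≤ C * Φ x ^ (p⁻¹).toReal) :
    eLpNorm F p μ ≤ C * (∫⁻ x, Φ x ∂μ) ^ (p⁻¹).toReal := by
  have hp0 : p ≠ 0 := (zero_lt_one.trans_le hp).ne'
  by_cases hpt : p = ∞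
  · subst hpt
    simp only [ENNReal.inv_top, ENNReal.toReal_zero, ENNReal.rpow_zero, mul_one] at h ⊢
    rw [eLpNorm_exponent_top]
    exact eLpNormEssSup_le_of_ae_enorm_bound (by simpa using h)
  · have hr : 0 < p.toReal := ENNReal.toReal_pos hp0 hpt
    rw [eLpNorm_eq_lintegral_rpow_enorm_toReal hp0 hpt, ENNReal.toReal_inv, one_div]
    have : ∫⁻ x, ‖F x‖ₑ ^ p.toReal ∂μ ≤ C ^ p.toReal * ∫⁻ x, Φ x ∂μ := by
      rw [← lintegral_const_mul'' _ hΦ]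
      refine lintegral_mono_ae ?_
      filter_upwards [h] with x hx
      rw [ENNReal.toReal_inv] at hx
      refine (ENNReal.rpow_le_rpow hx hr.le).trans ?_
      rw [ENNReal.mul_rpow_of_nonneg _ _ hr.le, ← ENNReal.rpow_mul, inv_mul_cancel₀ hr.ne',
        ENNReal.rpow_one]
    refine (ENNReal.rpow_le_rpow this (by positivity)).trans ?_
    rw [ENNReal.mul_rpow_of_nonneg _ _ (by positivity), ← ENNReal.rpow_mul, mul_inv_cancel₀ hr.ne',
      ENNReal.rpow_one]

theorem exists_rpow_representation {p : ℝ≥0∞} (hp : 1 ≤ p) {g : α → ℝ≥0∞} (hg : AEMeasurable g μ) :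
    ∃ (G : ℝ≥0∞) (γ : α → ℝ≥0∞), AEMeasurable γ μ ∧
      (∀ᵐ x ∂μ, g x ≤ G * γ x ^ (p⁻¹).toReal) ∧
      G * (∫⁻ x, γ x ∂μ) ^ (p⁻¹).toReal = eLpNorm g p μ := by
  have hp0 : p ≠ 0 := (zero_lt_one.trans_le hp).ne'
  by_cases hpt : p = ∞
  · subst hpt
    -- The choice `γ = 0` works because `0 ^ 0 = 1`, both pointwise and for the integral.
    refine ⟨eLpNorm g ∞ μ, 0, measurable_const.aemeasurable, ?_, by simp⟩
    filter_upwards [ae_le_eLpNormEssSup (f := g) (μ := μ)] with x hx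
    simpa [eLpNorm_exponent_top] using hx
  · have hr : 0 < p.toReal := ENNReal.toReal_pos hp0 hpt
    refine ⟨1, fun x => g x ^ p.toReal, hg.pow_const _, Eventually.of_forall fun x => ?_, ?_⟩
    · rw [ENNReal.toReal_inv, ← ENNReal.rpow_mul, mul_inv_cancel₀ hr.ne', ENNReal.rpow_one, one_mul]
    · rw [eLpNorm_eq_lintegral_rpow_enorm_toReal hp0 hpt, ENNReal.toReal_inv, one_div, one_mul]
      rfl

theorem eLpNorm_le_const_mul_of_ae_enorm_le {E : Type*} [NormedAddCommGroup E] {p : ℝ≥0∞}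
    (hp : 1 ≤ p) {F : α → E} {f : α → ℝ≥0∞} (hf : AEMeasurable f μ) {C : ℝ≥0∞}
    (h : ∀ᵐ x ∂μ, ‖F x‖ₑ ≤ C * f x) : eLpNorm F p μ ≤ C * eLpNorm f p μ := by
  obtain ⟨G, γ, hγ, hle, heq⟩ := exists_rpow_representation hp hf
  rw [← eLpNorm_enorm, ← heq, ← mul_assoc]
  refine eLpNorm_le_of_ae_le_const_mul_rpow hp hγ ?_
  filter_upwards [h, hle] with x h1 h2
  rw [mul_assoc]
  exact h1.trans (by gcongr)

/-- **Minkowski's integral inequality**, with a prescribed bound for the norms of the slices. -/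
theorem eLpNorm_lintegral_le [SFinite μ] [SFinite ν] {p : ℝ≥0∞} (hp : 1 ≤ p)
    {F : β × α → ℝ≥0∞} (hF : Measurable F) {b : β → ℝ≥0∞} (hb : Measurable b)
    (hb0 : ∀ᵐ s ∂ν, b s ≠ 0) (hbt : ∀ᵐ s ∂ν, b s ≠ ∞)
    (h : ∀ᵐ s ∂ν, eLpNorm (fun x => F (s, x)) p μ ≤ b s) :
    eLpNorm (fun x => ∫⁻ s, F (s, x) ∂ν) p μ ≤ ∫⁻ s, b s ∂ν := by
  have hp0 : p ≠ 0 := (zero_lt_one.trans_le hp).ne'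
  by_cases hpt : p = ∞
  · subst hpt
    have h1 : ∀ᵐ s ∂ν, ∀ᵐ x ∂μ, F (s, x) ≤ b s := by
      filter_upwards [h] with s hs
      rw [eLpNorm_exponent_top] at hs
      filter_upwards [ae_le_eLpNormEssSup (f := fun x => F (s, x)) (μ := μ)] with x hx
      exact hx.trans hs
    have h2 : ∀ᵐ x ∂μ, ∀ᵐ s ∂ν, F (s, x) ≤ b s :=
      (Measure.ae_ae_comm (p := fun s x => F (s, x) ≤ b s)
        (measurableSet_le hF (hb.comp measurable_fst))).1 h1
    rw [eLpNorm_exponent_top]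
    refine eLpNormEssSup_le_of_ae_enorm_bound ?_
    filter_upwards [h2] with x hx
    exact lintegral_mono_ae hx
  · have hr : 0 < p.toReal := ENNReal.toReal_pos hp0 hpt
    have hr1 : 1 ≤ p.toReal := by
      rw [← ENNReal.toReal_one]; exact ENNReal.toReal_mono hpt hp
    have ha1 : (p⁻¹).toReal ≤ 1 := by
      rw [ENNReal.toReal_inv]; exact inv_le_one_of_one_le₀ hr1
    set r := p.toReal with hrd
    have ha : (p⁻¹).toReal = r⁻¹ := ENNReal.toReal_inv p
    have hΦm : Measurable fun z : β × α => F z ^ r * b z.1 ^ (1 - r) :=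
      (hF.pow_const _).mul ((hb.comp measurable_fst).pow_const _)
    -- Hölder in `s` for the factorisation `F = (F^r b^{1-r})^{1/r} · b^{1-1/r}`, with the
    -- prescribed slice bound `b` as weight. The powers of `b` cancel only where `b` is neither `0`
    -- nor `∞`. Integrating `F^r b^{1-r}` over `x` then returns at most `b`.
    have key := eLpNorm_le_of_ae_le_const_mul_rpow (μ := μ) hp
      (F := fun x => ∫⁻ s, F (s, x) ∂ν) (C := (∫⁻ s, b s ∂ν) ^ (1 - (p⁻¹).toReal))
      (Φ := fun x => ∫⁻ s, F (s, x) ^ r * b s ^ (1 - r) ∂ν)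
      hΦm.lintegral_prod_left'.aemeasurable (Eventually.of_forall fun x => by
        rw [mul_comm]
        refine le_trans (lintegral_mono_ae ?_) (ENNReal.lintegral_mul_norm_pow_le
          ((hΦm.comp (measurable_prodMk_right (y := x))).aemeasurable) hb.aemeasurable
          ENNReal.toReal_nonneg (by linarith : 0 ≤ 1 - (p⁻¹).toReal) (by ring))
        filter_upwards [hb0, hbt] with s hs0 hst
        simp only [Function.comp]
        rw [ha, ENNReal.mul_rpow_of_nonneg _ _ (by positivity), ← ENNReal.rpow_mul,
          ← ENNReal.rpow_mul, mul_inv_cancel₀ hr.ne', ENNReal.rpow_one, mul_assoc,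
          ← ENNReal.rpow_add _ _ hs0 hst]
        have : (1 - r) * r⁻¹ + (1 - r⁻¹) = 0 := by field_simp; ring
        rw [this]; simp)
    refine key.trans ?_
    have hI : ∫⁻ x, ∫⁻ s, F (s, x) ^ r * b s ^ (1 - r) ∂ν ∂μ ≤ ∫⁻ s, b s ∂ν := by
      rw [lintegral_lintegral_swap (f := fun x s => F (s, x) ^ r * b s ^ (1 - r))
        (hΦm.comp measurable_swap).aemeasurable]
      refine lintegral_mono_ae ?_
      filter_upwards [hb0, hbt, h] with s hs0 hst hs
      have hFs : Measurable fun x => F (s, x) := hF.comp measurable_prodMk_left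
      rw [lintegral_mul_const _ (hFs.pow_const _)]
      rw [eLpNorm_eq_lintegral_rpow_enorm_toReal hp0 hpt, one_div, ENNReal.rpow_inv_le_iff hr] at hs
      calc _ ≤ b s ^ r * b s ^ (1 - r) := by gcongr; exact hs
        _ = b s := by rw [← ENNReal.rpow_add _ _ hs0 hst]; simp
    calc _ ≤ (∫⁻ s, b s ∂ν) ^ (1 - (p⁻¹).toReal) * (∫⁻ s, b s ∂ν) ^ (p⁻¹).toReal := by gcongr
      _ = ∫⁻ s, b s ∂ν := by
        rw [← ENNReal.rpow_add_of_nonneg _ _ (by linarith) ENNReal.toReal_nonneg]; simp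

theorem lintegral_three_rpow_le {a b c : ℝ} (ha : 0 ≤ a) (hb : 0 ≤ b) (hc : 0 ≤ c)
    (habc : a + b + c = 1) {f g h : α → ℝ≥0∞} (hf : AEMeasurable f μ) (hg : AEMeasurable g μ)
    (hh : AEMeasurable h μ) :
    ∫⁻ x, f x ^ a * g x ^ b * h x ^ c ∂μ ≤
      (∫⁻ x, f x ∂μ) ^ a * (∫⁻ x, g x ∂μ) ^ b * (∫⁻ x, h x ∂μ) ^ c := by
  have := ENNReal.lintegral_prod_norm_pow_le (μ := μ) (Finset.univ : Finset (Fin 3))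
    (f := ![f, g, h]) (p := ![a, b, c]) (by intro i _; fin_cases i <;> assumption)
    (by simpa [Fin.sum_univ_three] using habc) (by intro i _; fin_cases i <;> assumption)
  simpa [Fin.prod_univ_three] using this

/-- **Young's inequality** for the convolution of a kernel with a product. -/
theorem eLpNorm_conv_mul_le {p q : ℝ≥0∞} (hp : 1 ≤ p) (hq : 1 ≤ q) {m : ℝ}
    (hm : m * (1 - (q⁻¹).toReal) = 1) (hpq : (p⁻¹).toReal + (q⁻¹).toReal ≤ 1)
    {k g ω : E3 → ℝ≥0∞} (hk : Measurable k) (hg : AEMeasurable g) (hω : AEMeasurable ω) :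
    eLpNorm (fun x => ∫⁻ y, k (x - y) * (g y * ω y)) p volume ≤
      (∫⁻ x, k x ^ m) ^ (1 - (q⁻¹).toReal) * (eLpNorm g q volume * eLpNorm ω p volume) := by
  obtain ⟨G, γ, hγ, hgγ, hGγ⟩ := exists_rpow_representation hq hg
  obtain ⟨W, Ω, hΩ, hωΩ, hWΩ⟩ := exists_rpow_representation hp hω
  have ha : 0 ≤ (p⁻¹).toReal := ENNReal.toReal_nonneg
  have hb : 0 ≤ (q⁻¹).toReal := ENNReal.toReal_nonneg
  have hm0 : 0 < m := by
    rcases lt_or_ge 0 m with h | h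
    · exact h
    · have := mul_nonpos_of_nonpos_of_nonneg h (by linarith : 0 ≤ 1 - (q⁻¹).toReal); linarith
  set a := (p⁻¹).toReal
  set b := (q⁻¹).toReal
  -- A genuinely measurable representative makes the convolution integrand jointly measurable, as
  -- Tonelli requires.
  obtain ⟨Ω', hΩ', hΩΩ'⟩ := hΩ
  have hkm : Measurable fun z : E3 × E3 => k (z.1 - z.2) ^ m * Ω' z.2 :=
    ((hk.comp (measurable_fst.sub measurable_snd)).pow_const m).mul (hΩ'.comp measurable_snd)
  have hsub : ∀ x : E3, ∫⁻ y, k (x - y) ^ m = ∫⁻ y, k y ^ m := fun x =>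
    lintegral_sub_left_eq_self (fun y => k y ^ m) x
  -- Three-factor Hölder with exponents `a`, `b`, `1-a-b` applied to `(k^m Ω')^a γ^b (k^m)^{1-a-b}`;
  -- the relation `m(1-b) = 1` makes the powers of `k` add up to one.
  have key := eLpNorm_le_of_ae_le_const_mul_rpow (μ := (volume : Measure E3)) hp
    (F := fun x => ∫⁻ y, k (x - y) * (g y * ω y))
    (C := G * W * ((∫⁻ y, γ y) ^ b * (∫⁻ y, k y ^ m) ^ (1 - a - b)))
    (Φ := fun x => ∫⁻ y, k (x - y) ^ m * Ω' y) hkm.lintegral_prod_right'.aemeasurable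
    (Eventually.of_forall fun x => by
      have hkx : Measurable fun y => k (x - y) := hk.comp (measurable_const.sub measurable_id)
      have h3 := lintegral_three_rpow_le (μ := (volume : Measure E3)) ha hb
        (by linarith : 0 ≤ 1 - a - b) (by ring)
        (f := fun y => k (x - y) ^ m * Ω' y) (g := γ) (h := fun y => k (x - y) ^ m)
        (hkm.comp measurable_prodMk_left).aemeasurable hγ (hkx.pow_const m).aemeasurable
      rw [hsub x] at h3
      calc ∫⁻ y, k (x - y) * (g y * ω y)
          ≤ ∫⁻ y, G * W * ((k (x - y) ^ m * Ω' y) ^ a * γ y ^ b *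
              (k (x - y) ^ m) ^ (1 - a - b)) := by
            refine lintegral_mono_ae ?_
            filter_upwards [hgγ, hωΩ, hΩΩ'] with y h1 h2 h4
            rw [h4] at h2
            calc k (x - y) * (g y * ω y) ≤ k (x - y) * ((G * γ y ^ b) * (W * Ω' y ^ a)) := by gcongr
              _ = G * W * ((k (x - y)) * Ω' y ^ a * γ y ^ b) := by ring
              _ = _ := by
                rw [ENNReal.mul_rpow_of_nonneg _ _ ha]
                have : k (x - y) = (k (x - y) ^ m) ^ a * (k (x - y) ^ m) ^ (1 - a - b) := by
                  rw [← ENNReal.rpow_add_of_nonneg _ _ ha (by linarith), ← ENNReal.rpow_mul]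
                  have : m * (a + (1 - a - b)) = 1 := by linear_combination hm
                  rw [this, ENNReal.rpow_one]
                nth_rewrite 1 [this]
                ring
        _ = G * W * ∫⁻ y, ((k (x - y) ^ m * Ω' y) ^ a * γ y ^ b *
              (k (x - y) ^ m) ^ (1 - a - b)) := by
            refine lintegral_const_mul'' _ (AEMeasurable.mul (AEMeasurable.mul ?_ ?_) ?_)
            · exact ((hkm.comp measurable_prodMk_left).pow_const a).aemeasurable
            · exact hγ.pow_const b
            · exact ((hkx.pow_const m).pow_const _).aemeasurable
        _ ≤ G * W * ((∫⁻ y, k (x - y) ^ m * Ω' y) ^ a * (∫⁻ y, γ y) ^ b *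
              (∫⁻ y, k y ^ m) ^ (1 - a - b)) := by gcongr
        _ = _ := by ring)
  refine key.trans (le_of_eq ?_)
  have hfub : ∫⁻ x, ∫⁻ y, k (x - y) ^ m * Ω' y = (∫⁻ y, k y ^ m) * ∫⁻ y, Ω y := by
    rw [lintegral_lintegral_swap hkm.aemeasurable, lintegral_congr_ae hΩΩ',
      ← lintegral_const_mul _ hΩ']
    refine lintegral_congr fun y => ?_
    have hky : Measurable fun x => k (x - y) := hk.comp (measurable_id.sub measurable_const)
    rw [lintegral_mul_const _ (hky.pow_const m),
      lintegral_sub_right_eq_self (fun x => k x ^ m) y]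
  rw [hfub, ENNReal.mul_rpow_of_nonneg _ _ ha, ← hGγ, ← hWΩ]
  have : (∫⁻ y, k y ^ m) ^ (1 - b) =
      (∫⁻ y, k y ^ m) ^ (1 - a - b) * (∫⁻ y, k y ^ m) ^ a := by
    rw [← ENNReal.rpow_add_of_nonneg _ _ (by linarith) ha]; congr 1; ring
  rw [this]; ring

end Inequalities


/-! ### Duhamel's formula as an integral inequality for the difference -/

/-- Young's inequality for the majorant of the Oseen kernel. -/
theorem exists_eLpNorm_kmaj_conv_le {q : ℝ≥0∞} (hq : 1 < q) :
    ∃ C : ℝ≥0, ∀ (p : ℝ≥0∞), 1 ≤ p → (p⁻¹).toReal + (q⁻¹).toReal ≤ 1 →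
      ∀ (σ : ℝ), 0 < σ → ∀ g ω : E3 → ℝ≥0∞, AEMeasurable g → AEMeasurable ω →
      eLpNorm (fun x => ∫⁻ y, kmaj σ (x - y) * (g y * ω y)) p volume ≤
        C * ENNReal.ofReal (σ ^ (-(1 / 2) - 3 / 2 * (q⁻¹).toReal)) *
          (eLpNorm g q volume * eLpNorm ω p volume) := by
  have hb1 : (q⁻¹).toReal < 1 := by
    rw [← ENNReal.toReal_one]
    exact ENNReal.toReal_strict_mono ENNReal.one_ne_top (ENNReal.inv_lt_one.2 hq)
  have hb0 : 0 ≤ (q⁻¹).toReal := ENNReal.toReal_nonneg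
  set b := (q⁻¹).toReal with hb
  obtain ⟨C, hC⟩ := exists_lintegral_kmaj_rpow_le (m := (1 - b)⁻¹)
    (by rw [one_le_inv₀ (by linarith)]; linarith)
  refine ⟨C ^ (1 - b), fun p hp hpq σ hσ g ω hg hω => ?_⟩
  refine (eLpNorm_conv_mul_le hp hq.le (m := (1 - b)⁻¹) (inv_mul_cancel₀ (by linarith)) hpq
    (measurable_kmaj.comp measurable_prodMk_left) hg hω).trans ?_
  rw [← hb]
  refine mul_le_mul_left ?_ _
  refine (ENNReal.rpow_le_rpow (hC σ hσ) (by linarith)).trans ?_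
  rw [ENNReal.mul_rpow_of_nonneg _ _ (by linarith), ENNReal.coe_rpow_of_nonneg _ (by linarith),
    ENNReal.ofReal_rpow_of_nonneg (by positivity) (by linarith), ← Real.rpow_mul hσ.le]
  -- With `m = (1-b)⁻¹`, `(3/2 - 2m)(1-b) = 3/2 (1-b) - 2 = -1/2 - 3/2 b`.
  refine le_of_eq ?_
  congr 3
  have : 1 - b ≠ 0 := by linarith
  field_simp; ring

/-- The part of the notion of mild solution that does not refer to the initial data. -/
structure IsDuhamelFlow (T : ℝ≥0∞) (u : ℝ → E3 → E3) : Prop where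
  measurable : AEStronglyMeasurable (fun z : ℝ × E3 => u z.1 z.2) (volume.restrict (slab T))
  slice : ∀ t, 0 < t → ENNReal.ofReal t < T → AEStronglyMeasurable (u t) volume
  duhamel : ∀ t τ, 0 < t → 0 < τ → ENNReal.ofReal (t + τ) < T → ∀ᵐ x,
    Integrable (fun y => heatKernel τ (x - y) • u t y) ∧
    IntegrableOn (duhamelIntegrand u t τ x) (Ioo 0 τ ×ˢ univ) ∧
    u (t + τ) x = heat τ (u t) x - ∫ z in Ioo 0 τ ×ˢ univ, duhamelIntegrand u t τ x z

theorem IsMildSolution.isDuhamelFlow {T : ℝ≥0∞}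
    {U₀ : 𝓓((⊤ : TopologicalSpace.Opens E3), ℝ) → E3} {u : ℝ → E3 → E3}
    (h : IsMildSolution T U₀ u) : IsDuhamelFlow T u :=
  ⟨h.measurable, fun t h0 hT => (h.locallyIntegrable t h0 hT).aestronglyMeasurable, h.duhamel⟩

theorem oseenDiv_zero (t : ℝ) (x : E3) : oseenDiv t x 0 = 0 := by
  ext i; simp [oseenDiv]

theorem duhamelIntegrand_zero (t τ : ℝ) (x : E3) :
    duhamelIntegrand (0 : ℝ → E3 → E3) t τ x = 0 := by
  funext z; simp [duhamelIntegrand, oseenDiv_zero]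

/-- Taking the second flow to be zero turns estimates for differences into estimates for a single
flow. -/
theorem isDuhamelFlow_zero (T : ℝ≥0∞) : IsDuhamelFlow T 0 := by
  refine ⟨aestronglyMeasurable_const, fun t _ _ => aestronglyMeasurable_const,
    fun t τ _ _ _ => Eventually.of_forall fun x => ⟨by simp, ?_, ?_⟩⟩
  · rw [duhamelIntegrand_zero]; exact integrableOn_zero
  · rw [duhamelIntegrand_zero]; simp [heat]

theorem norm_le_two_mul_of_abs_le {v : E3} {B : ℝ} (h : ∀ i, |v i| ≤ B) : ‖v‖ ≤ 2 * B := by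
  have hB : 0 ≤ B := (abs_nonneg _).trans (h 0)
  rw [EuclideanSpace.norm_eq, Real.sqrt_le_left (by positivity), Fin.sum_univ_three]
  have : ∀ i, ‖v i‖ ^ 2 ≤ B ^ 2 := fun i => by
    rw [Real.norm_eq_abs]; exact pow_le_pow_left₀ (abs_nonneg _) (h i) 2
  nlinarith [this 0, this 1, this 2, sq_nonneg B]

theorem norm_oseenDiv_sub_le {σ : ℝ} (hσ : 0 < σ) (x a b : E3) :
    ‖oseenDiv σ x a - oseenDiv σ x b‖ ≤
      36 * kC * (((σ + ‖x‖ ^ 2) ^ 2)⁻¹ * ((‖a‖ + ‖b‖) * ‖a - b‖)) := by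
  have hk := kC_pos
  have h1 : ∀ j k : Fin 3, |a j * a k - b j * b k| ≤ (‖a‖ + ‖b‖) * ‖a - b‖ := by
    intro j k
    have e : a j * a k - b j * b k = (a - b) j * a k + b j * (a - b) k := by simp; ring
    rw [e]
    refine (abs_add_le _ _).trans ?_
    rw [abs_mul, abs_mul]
    have := mul_le_mul (abs_coord_le (a - b) j) (abs_coord_le a k) (abs_nonneg _) (norm_nonneg _)
    have := mul_le_mul (abs_coord_le b j) (abs_coord_le (a - b) k) (abs_nonneg _) (norm_nonneg _)
    nlinarith
  -- The constant is `36 = 2 · 9 · 2`: the passage from coordinates to the norm, the nine pairs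
  -- `(j,k)`, and the factor in `abs_pd_oseen_le`.
  refine (norm_le_two_mul_of_abs_le (B := 9 * (2 * kC * ((σ + ‖x‖ ^ 2) ^ 2)⁻¹ *
    ((‖a‖ + ‖b‖) * ‖a - b‖))) fun i => ?_).trans (le_of_eq (by ring))
  have e : (oseenDiv σ x a - oseenDiv σ x b) i =
      ∑ j, ∑ k, pd k (oseen σ i j) x * (a j * a k - b j * b k) := by
    simp only [oseenDiv, PiLp.sub_apply, ← Finset.sum_sub_distrib, mul_sub]
  rw [e]
  refine (Finset.abs_sum_le_sum_abs _ _).trans ((Finset.sum_le_sum fun j _ =>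
    (Finset.abs_sum_le_sum_abs _ _).trans (Finset.sum_le_sum fun k _ => ?_)).trans
    (le_of_eq (a := ∑ _j : Fin 3, ∑ _k : Fin 3, 2 * kC * ((σ + ‖x‖ ^ 2) ^ 2)⁻¹ *
    ((‖a‖ + ‖b‖) * ‖a - b‖)) ?_))
  · rw [abs_mul]
    exact mul_le_mul (abs_pd_oseen_le hσ i j k x) (h1 j k) (abs_nonneg _) (by positivity)
  · simp; ring

theorem enorm_oseenDiv_sub_le {σ : ℝ} (hσ : 0 < σ) (x a b : E3) :
    ‖oseenDiv σ x a - oseenDiv σ x b‖ₑ ≤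
      ENNReal.ofReal (36 * kC) * (kmaj σ x * ((‖a‖ₑ + ‖b‖ₑ) * ‖a - b‖ₑ)) := by
  have hk := kC_pos
  rw [kmaj, ← ofReal_norm a, ← ofReal_norm b, ← ofReal_norm (a - b),
    ← ofReal_norm, ← ENNReal.ofReal_add (norm_nonneg _) (norm_nonneg _),
    ← ENNReal.ofReal_mul (by positivity), ← ENNReal.ofReal_mul (by positivity),
    ← ENNReal.ofReal_mul (by positivity)]
  exact ENNReal.ofReal_le_ofReal (norm_oseenDiv_sub_le hσ x a b)

/-- The potential `∫₀^τ ∫ (τ - s + |x - y|²)⁻² f(t + s, y) dy ds` dominating Duhamel integrals. -/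
def duhamelPotential (f : ℝ × E3 → ℝ≥0∞) (t τ : ℝ) (x : E3) : ℝ≥0∞ :=
  ∫⁻ s in Ioo 0 τ, ∫⁻ y, kmaj (τ - s) (x - y) * f (t + s, y)

theorem measurable_duhamelPotential_slice {f : ℝ × E3 → ℝ≥0∞} (hf : Measurable f) (t τ : ℝ) :
    Measurable fun z : ℝ × E3 => ∫⁻ y, kmaj (τ - z.1) (z.2 - y) * f (t + z.1, y) := by
  have : Measurable fun z : (ℝ × E3) × E3 => kmaj (τ - z.1.1) (z.1.2 - z.2) * f (t + z.1.1, z.2) :=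
    (measurable_kmaj.comp (f := fun z : (ℝ × E3) × E3 => (τ - z.1.1, z.1.2 - z.2))
      (by fun_prop)).mul (hf.comp (f := fun z : (ℝ × E3) × E3 => (t + z.1.1, z.2)) (by fun_prop))
  exact this.lintegral_prod_right'

theorem measurable_duhamelPotential {f : ℝ × E3 → ℝ≥0∞} (hf : Measurable f) (t τ : ℝ) :
    Measurable (duhamelPotential f t τ) :=
  (measurable_duhamelPotential_slice hf t τ).lintegral_prod_left'

/-- Duhamel's formula gives an integral inequality for the difference of two flows. -/
theorem IsDuhamelFlow.exists_interaction {T : ℝ≥0∞} {u v : ℝ → E3 → E3}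
    (hu : IsDuhamelFlow T u) (hv : IsDuhamelFlow T v) :
    ∃ f : ℝ × E3 → ℝ≥0∞, Measurable f ∧
      (∀ᵐ s : ℝ, 0 < s → ENNReal.ofReal s < T →
        ∀ᵐ y, f (s, y) = (‖u s y‖ₑ + ‖v s y‖ₑ) * ‖(u - v) s y‖ₑ) ∧
      ∀ t τ, 0 < t → 0 < τ → ENNReal.ofReal (t + τ) < T → ∀ᵐ x,
        Integrable (fun y => heatKernel τ (x - y) • (u - v) t y) ∧
        ‖(u - v) (t + τ) x - heat τ ((u - v) t) x‖ₑ ≤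
          ENNReal.ofReal (36 * kC) * duhamelPotential f t τ x := by
  -- The interaction is built from jointly measurable representatives, so that it is Borel on all of
  -- space-time; it agrees with the flows on almost every slice only.
  set U := hu.measurable.mk with hUd
  set V := hv.measurable.mk with hVd
  have hU : Measurable U := hu.measurable.stronglyMeasurable_mk.measurable
  have hV : Measurable V := hv.measurable.stronglyMeasurable_mk.measurable
  have hf : Measurable fun z => (‖U z‖ₑ + ‖V z‖ₑ) * ‖U z - V z‖ₑ :=
    (hU.enorm.add hV.enorm).mul (hU.sub hV).enorm
  have hms : MeasurableSet (slab T : Set (ℝ × E3)) := (slab T).isOpen.measurableSet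
  have hae : ∀ᵐ z : ℝ × E3, z ∈ slab T → u z.1 z.2 = U z ∧ v z.1 z.2 = V z := by
    have h1 := (ae_restrict_iff' hms).1 hu.measurable.ae_eq_mk
    have h2 := (ae_restrict_iff' hms).1 hv.measurable.ae_eq_mk
    filter_upwards [h1, h2] with z h1 h2 hz
    exact ⟨h1 hz, h2 hz⟩
  refine ⟨_, hf, ?_, ?_⟩
  · have := Measure.ae_ae_of_ae_prod (μ := (volume : Measure ℝ)) (ν := (volume : Measure E3)) hae
    filter_upwards [this] with s hs h0 hT
    filter_upwards [hs] with y hy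
    obtain ⟨h1, h2⟩ := hy ⟨h0, hT⟩
    simp only [Pi.sub_apply, h1, h2]
  · intro t τ ht hτ hT
    -- The exceptional null set of space-time must remain null after the shift by `t` in time.
    have hshift : MeasurePreserving (fun z : ℝ × E3 => (t + z.1, z.2)) volume volume :=
      (measurePreserving_add_left volume t).prod (MeasurePreserving.id volume)
    have hae2 := hshift.quasiMeasurePreserving.ae hae
    filter_upwards [hu.duhamel t τ ht hτ hT, hv.duhamel t τ ht hτ hT] with x hx hy
    obtain ⟨hx1, hx2, hx3⟩ := hx
    obtain ⟨hy1, hy2, hy3⟩ := hy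
    have hI : Integrable (fun y => heatKernel τ (x - y) • (u - v) t y) := by
      refine (hx1.sub hy1).congr (Eventually.of_forall fun y => ?_)
      simp [smul_sub]
    have hheat : heat τ ((u - v) t) x = heat τ (u t) x - heat τ (v t) x := by
      rw [heat, heat, heat, ← integral_sub hx1 hy1]
      simp [smul_sub]
    refine ⟨hI, ?_⟩
    have e : (u - v) (t + τ) x - heat τ ((u - v) t) x =
        -∫ z in Ioo 0 τ ×ˢ univ, (duhamelIntegrand u t τ x z - duhamelIntegrand v t τ x z) := by
      rw [integral_sub hx2 hy2, hheat, Pi.sub_apply, Pi.sub_apply, hx3, hy3]; abel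
    rw [e, enorm_neg]
    refine (enorm_integral_le_lintegral_enorm _).trans ?_
    have hmeas : Measurable fun z : ℝ × E3 =>
        kmaj (τ - z.1) (x - z.2) * ((‖U (t + z.1, z.2)‖ₑ + ‖V (t + z.1, z.2)‖ₑ) *
          ‖U (t + z.1, z.2) - V (t + z.1, z.2)‖ₑ) :=
      (measurable_kmaj.comp (f := fun z : ℝ × E3 => (τ - z.1, x - z.2)) (by fun_prop)).mul
        (hf.comp hshift.measurable)
    calc _ ≤ ∫⁻ z in Ioo 0 τ ×ˢ univ, ENNReal.ofReal (36 * kC) *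
          (kmaj (τ - z.1) (x - z.2) * ((‖U (t + z.1, z.2)‖ₑ + ‖V (t + z.1, z.2)‖ₑ) *
          ‖U (t + z.1, z.2) - V (t + z.1, z.2)‖ₑ)) := by
          refine setLIntegral_mono_ae' (measurableSet_Ioo.prod MeasurableSet.univ) ?_
          filter_upwards [hae2] with z hz hzm
          have hz1 := hzm.1
          have hm : (t + z.1, z.2) ∈ slab T := by
            refine ⟨?_, lt_of_le_of_lt (ENNReal.ofReal_le_ofReal ?_) hT⟩
            · show 0 < t + z.1
              linarith [hz1.1]
            · show t + z.1 ≤ t + τ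
              linarith [hz1.2]
          obtain ⟨h1, h2⟩ := hz hm
          rw [duhamelIntegrand, duhamelIntegrand, ← h1, ← h2]
          exact enorm_oseenDiv_sub_le (by linarith [hz1.2]) _ _ _
      _ = _ := by
          rw [lintegral_const_mul _ hmeas, duhamelPotential, Measure.volume_eq_prod,
            ← Measure.prod_restrict, Measure.restrict_univ, lintegral_prod _ hmeas.aemeasurable]

/-- Minkowski's inequality in the time variable. Strict positivity of `b` is asked for because `b`
serves there as a weight. -/
theorem eLpNorm_duhamelPotential_le {p : ℝ≥0∞} (hp : 1 ≤ p) {f : ℝ × E3 → ℝ≥0∞}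
    (hf : Measurable f) {t τ : ℝ} {b : ℝ → ℝ} (hb : Measurable b) (hb0 : ∀ s ∈ Ioo 0 τ, 0 < b s)
    (h : ∀ᵐ s, s ∈ Ioo 0 τ →
      eLpNorm (fun x => ∫⁻ y, kmaj (τ - s) (x - y) * f (t + s, y)) p volume ≤ ENNReal.ofReal (b s)) :
    eLpNorm (duhamelPotential f t τ) p volume ≤ ∫⁻ s in Ioo 0 τ, ENNReal.ofReal (b s) := by
  refine eLpNorm_lintegral_le hp (measurable_duhamelPotential_slice hf t τ) hb.ennreal_ofReal ?_
    (Eventually.of_forall fun s => ENNReal.ofReal_ne_top) ((ae_restrict_iff' measurableSet_Ioo).2 h)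
  filter_upwards [ae_restrict_mem measurableSet_Ioo] with s hs
  simpa using hb0 s hs

theorem lintegral_rpow_Ioo {τ e : ℝ} (hτ : 0 ≤ τ) (he : -1 < e) :
    ∫⁻ s in Ioo 0 τ, ENNReal.ofReal (s ^ e) = ENNReal.ofReal (τ ^ (e + 1) / (e + 1)) := by
  have hi : IntegrableOn (fun s : ℝ => s ^ e) (Ioo 0 τ) :=
    ((intervalIntegral.intervalIntegrable_rpow' he (a := 0) (b := τ)).1).mono_set Ioo_subset_Ioc_self
  rw [← ofReal_integral_eq_lintegral_ofReal hi, ← integral_Ioc_eq_integral_Ioo,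
    ← intervalIntegral.integral_of_le hτ, integral_rpow (Or.inl he),
    Real.zero_rpow (by linarith), sub_zero]
  filter_upwards [ae_restrict_mem measurableSet_Ioo] with s hs
  exact Real.rpow_nonneg hs.1.le _

theorem lintegral_Ioo_reflect {τ : ℝ} (f : ℝ → ℝ≥0∞) :
    ∫⁻ s in Ioo 0 τ, f (τ - s) = ∫⁻ s in Ioo 0 τ, f s := by
  have h := (Measure.measurePreserving_sub_left (volume : Measure ℝ) τ).setLIntegral_comp_preimage_emb
    (MeasurableEquiv.subLeft τ).measurableEmbedding f (Ioo 0 τ)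
  rw [← h]
  congr 2
  ext s; simp

/-- An upper bound for the Beta integral. -/
theorem lintegral_beta_le {t a b : ℝ} (ht : 0 < t) (ha : -1 < a) (ha0 : a ≤ 0) (hb : -1 < b)
    (hb0 : b ≤ 0) :
    ∫⁻ s in Ioo 0 t, ENNReal.ofReal ((t - s) ^ a * s ^ b) ≤
      ENNReal.ofReal (2 * (1 / (a + 1) + 1 / (b + 1)) * t ^ (a + b + 1)) := by
  -- On each half of `(0,t)` only one of the two factors can be singular; the other is bounded by
  -- its value at the midpoint.
  have hpt : ∀ s ∈ Ioo 0 t, (t - s) ^ a * s ^ b ≤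
      (t / 2) ^ a * s ^ b + (t / 2) ^ b * (t - s) ^ a := by
    intro s hs
    have h1 : 0 < t - s := by linarith [hs.2]
    have h2 := hs.1
    rcases le_total s (t / 2) with h | h
    · have : (t - s) ^ a ≤ (t / 2) ^ a :=
        Real.rpow_le_rpow_of_nonpos (by linarith) (by linarith) ha0
      have h3 : 0 ≤ s ^ b := by positivity
      have h4 : 0 ≤ (t / 2) ^ b * (t - s) ^ a := by positivity
      nlinarith
    · have : s ^ b ≤ (t / 2) ^ b := Real.rpow_le_rpow_of_nonpos (by linarith) h hb0
      have h3 : 0 ≤ (t - s) ^ a := by positivity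
      have h4 : 0 ≤ (t / 2) ^ a * s ^ b := by positivity
      nlinarith
  have h2 : ∀ e : ℝ, -1 < e → e ≤ 0 → (t / 2) ^ e ≤ 2 * t ^ e := by
    intro e he he0
    rw [Real.div_rpow ht.le zero_le_two, div_le_iff₀ (by positivity)]
    have : (2 : ℝ) ^ (-1 : ℝ) ≤ 2 ^ e := Real.rpow_le_rpow_of_exponent_le one_le_two he.le
    rw [Real.rpow_neg_one] at this
    nlinarith [Real.rpow_pos_of_pos ht e]
  calc _ ≤ ∫⁻ s in Ioo 0 t, (ENNReal.ofReal ((t / 2) ^ a) * ENNReal.ofReal (s ^ b) +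
        ENNReal.ofReal ((t / 2) ^ b) * ENNReal.ofReal ((t - s) ^ a)) := by
        refine setLIntegral_mono' measurableSet_Ioo fun s hs => ?_
        have h1 : 0 < t - s := by linarith [hs.2]
        have h2 := hs.1
        rw [← ENNReal.ofReal_mul (by positivity), ← ENNReal.ofReal_mul (by positivity),
          ← ENNReal.ofReal_add (by positivity) (by positivity)]
        exact ENNReal.ofReal_le_ofReal (hpt s hs)
    _ = ENNReal.ofReal ((t / 2) ^ a * (t ^ (b + 1) / (b + 1)) +
        (t / 2) ^ b * (t ^ (a + 1) / (a + 1))) := by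
        have ha1 : 0 < a + 1 := by linarith
        have hb1 : 0 < b + 1 := by linarith
        rw [lintegral_add_left (by fun_prop), lintegral_const_mul _ (by fun_prop),
          lintegral_const_mul _ (by fun_prop),
          lintegral_Ioo_reflect (fun s => ENNReal.ofReal (s ^ a)), lintegral_rpow_Ioo ht.le ha,
          lintegral_rpow_Ioo ht.le hb, ← ENNReal.ofReal_mul (by positivity),
          ← ENNReal.ofReal_mul (by positivity), ← ENNReal.ofReal_add (by positivity) (by positivity)]
    _ ≤ _ := by
        refine ENNReal.ofReal_le_ofReal ?_
        have ha1 : 0 < a + 1 := by linarith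
        have hb1 : 0 < b + 1 := by linarith
        calc _ ≤ (2 * t ^ a) * (t ^ (b + 1) / (b + 1)) + (2 * t ^ b) * (t ^ (a + 1) / (a + 1)) := by
              gcongr
              · exact h2 a ha ha0
              · exact h2 b hb hb0
          _ = _ := by
              rw [Real.rpow_add_one ht.ne', Real.rpow_add_one ht.ne', Real.rpow_add_one ht.ne',
                Real.rpow_add ht]
              field_simp; ring


/-! ### Translates of the heat kernel in `L¹` -/

theorem hasDerivAt_heatKernel_segment (s : ℝ) (x ζ : E3) (t : ℝ) :
    HasDerivAt (fun t : ℝ => heatKernel s (x + t • ζ))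
      (-(inner ℝ (x + t • ζ) ζ / (2 * s)) * heatKernel s (x + t • ζ)) t := by
  have h1 : HasDerivAt (fun t : ℝ => x + t • ζ) ζ t := by
    simpa using ((hasDerivAt_id t).smul_const ζ).const_add x
  have h2 := ((h1.norm_sq.neg.div_const (4 * s)).exp).const_mul ((4 * Real.pi * s) ^ (-(3 / 2) : ℝ))
  refine h2.congr_deriv ?_
  simp only [heatKernel, Pi.neg_apply]
  ring

/-- Fundamental theorem of calculus along the segment from `x` to `x + ζ`, with the gradient bounded
by the same majorant as the Oseen kernel. -/
theorem enorm_heatKernel_translate_sub_le {s : ℝ} (hs : 0 < s) (x ζ : E3) :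
    ‖heatKernel s (x + ζ) - heatKernel s x‖ₑ ≤
      ENNReal.ofReal (kC * ‖ζ‖) * ∫⁻ θ in Ioc (0 : ℝ) 1, kmaj s (x + θ • ζ) := by
  have hk := kC_pos
  have hc : Continuous fun t : ℝ =>
      -(inner ℝ (x + t • ζ) ζ / (2 * s)) * heatKernel s (x + t • ζ) := by
    unfold heatKernel; fun_prop
  have h := intervalIntegral.integral_eq_sub_of_hasDerivAt
    (fun t _ => hasDerivAt_heatKernel_segment s x ζ t) (hc.intervalIntegrable 0 1)
  simp only [one_smul, zero_smul, add_zero] at h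
  rw [← h, intervalIntegral.integral_of_le zero_le_one]
  refine (enorm_integral_le_lintegral_enorm _).trans ?_
  have hm : Measurable fun θ : ℝ => kmaj s (x + θ • ζ) :=
    measurable_kmaj.comp (f := fun θ : ℝ => (s, x + θ • ζ)) (by fun_prop)
  rw [← lintegral_const_mul _ hm]
  refine lintegral_mono fun θ => ?_
  rw [kmaj, ← ofReal_norm, ← ENNReal.ofReal_mul (by positivity)]
  refine ENNReal.ofReal_le_ofReal ?_
  set y := x + θ • ζ
  have hG := heatKernel_nonneg hs.le y
  rw [norm_mul, norm_neg, Real.norm_of_nonneg hG, norm_div, Real.norm_of_nonneg (by positivity : 0 ≤ 2 * s)]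
  calc _ ≤ (‖y‖ * ‖ζ‖) / (2 * s) * heatKernel s y := by gcongr; exact norm_inner_le_norm y ζ
    _ = ‖ζ‖ * (‖y‖ / (2 * s) * heatKernel s y) := by ring
    _ ≤ ‖ζ‖ * (kC * ((s + ‖y‖ ^ 2) ^ 2)⁻¹) :=
        mul_le_mul_of_nonneg_left (norm_mul_heatKernel_le hs y) (norm_nonneg ζ)
    _ = _ := by ring

theorem exists_lintegral_kmaj_le :
    ∃ C : ℝ≥0, ∀ σ : ℝ, 0 < σ → ∫⁻ x, kmaj σ x ≤ C * ENNReal.ofReal (σ ^ (-(1 / 2) : ℝ)) := by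
  obtain ⟨C, hC⟩ := exists_lintegral_kmaj_rpow_le le_rfl
  refine ⟨C, fun σ hσ => ?_⟩
  have := hC σ hσ
  simp only [ENNReal.rpow_one] at this
  norm_num at this ⊢
  exact this

/-- By translation invariance each point of the segment contributes the full mass of `kmaj s`, which
is of order `s^{-1/2}`. -/
theorem exists_lintegral_heatKernel_translate_le :
    ∃ C : ℝ≥0, ∀ s : ℝ, 0 < s → ∀ ζ : E3,
      ∫⁻ x, ‖heatKernel s (x + ζ) - heatKernel s x‖ₑ ≤
        C * ENNReal.ofReal (‖ζ‖ * s ^ (-(1 / 2) : ℝ)) := by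
  have hk := kC_pos
  obtain ⟨C, hC⟩ := exists_lintegral_kmaj_le
  refine ⟨C * Real.toNNReal kC, fun s hs ζ => ?_⟩
  have hm : Measurable fun z : E3 × ℝ => kmaj s (z.1 + z.2 • ζ) :=
    measurable_kmaj.comp (f := fun z : E3 × ℝ => (s, z.1 + z.2 • ζ)) (by fun_prop)
  refine (lintegral_mono fun x => enorm_heatKernel_translate_sub_le hs x ζ).trans ?_
  rw [lintegral_const_mul _ hm.lintegral_prod_right', lintegral_lintegral_swap hm.aemeasurable]
  have : ∀ θ : ℝ, ∫⁻ x, kmaj s (x + θ • ζ) = ∫⁻ x, kmaj s x := fun θ =>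
    lintegral_add_right_eq_self (fun x => kmaj s x) _
  simp_rw [this]
  simp only [lintegral_const, Measure.restrict_apply MeasurableSet.univ, univ_inter,
    Real.volume_Ioc, sub_zero, ENNReal.ofReal_one, mul_one]
  calc _ ≤ ENNReal.ofReal (kC * ‖ζ‖) * (C * ENNReal.ofReal (s ^ (-(1 / 2) : ℝ))) := by
        gcongr; exact hC s hs
    _ = _ := by
        rw [ENNReal.ofReal_mul hk.le, ENNReal.ofReal_mul (norm_nonneg ζ), ENNReal.coe_mul]
        simp only [ENNReal.ofReal]
        ring

/-! ### Lattice cubes and cube averages -/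

section Lattice

theorem mem_latticeCube_comm {h : ℝ} {x y : E3} : y ∈ latticeCube h x ↔ x ∈ latticeCube h y :=
  ⟨fun H i => (H i).symm, fun H i => (H i).symm⟩

theorem measurableSet_latticeCube_prod (h : ℝ) :
    MeasurableSet {z : E3 × E3 | z.2 ∈ latticeCube h z.1} := by
  have : {z : E3 × E3 | z.2 ∈ latticeCube h z.1} =
      ⋂ i, {z : E3 × E3 | ⌊z.2 i / h + 1 / 2⌋ = ⌊z.1 i / h + 1 / 2⌋} := by
    ext z; simp [latticeCube]
  rw [this]
  refine MeasurableSet.iInter fun i => measurableSet_eq_fun ?_ ?_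
  · exact Int.measurable_floor.comp (by fun_prop)
  · exact Int.measurable_floor.comp (by fun_prop)

theorem measurableSet_latticeCube (h : ℝ) (x : E3) : MeasurableSet (latticeCube h x) :=
  measurable_prodMk_left (measurableSet_latticeCube_prod h)

theorem latticeCube_eq_preimage {h : ℝ} (hh : 0 < h) (x : E3) :
    latticeCube h x = WithLp.ofLp ⁻¹' (Set.pi univ fun i =>
      Ico (h * (⌊x i / h + 1 / 2⌋ - 1 / 2)) (h * (⌊x i / h + 1 / 2⌋ + 1 / 2))) := by
  ext y
  simp only [latticeCube, mem_ofPred_eq, mem_preimage, Set.mem_pi, mem_univ, forall_true_left, mem_Ico]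
  refine forall_congr' fun i => ?_
  rw [Int.floor_eq_iff]
  have : y i = h * (y i / h) := by field_simp
  constructor
  · rintro ⟨h1, h2⟩
    rw [this]
    exact ⟨mul_le_mul_of_nonneg_left (by linarith) hh.le, mul_lt_mul_of_pos_left (by linarith) hh⟩
  · rintro ⟨h1, h2⟩
    rw [this] at h1 h2
    have h3 := le_of_mul_le_mul_left h1 hh
    have h4 := lt_of_mul_lt_mul_left h2 hh.le
    exact ⟨by linarith, by linarith⟩

theorem volume_latticeCube {h : ℝ} (hh : 0 < h) (x : E3) :
    volume (latticeCube h x) = ENNReal.ofReal (h ^ 3) := by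
  rw [latticeCube_eq_preimage hh, (PiLp.volume_preserving_ofLp (Fin 3)).measure_preimage
    (MeasurableSet.univ_pi fun i => measurableSet_Ico).nullMeasurableSet, volume_pi_pi]
  simp only [Real.volume_Ico]
  have : ∀ i : Fin 3, h * (⌊x i / h + 1 / 2⌋ + 1 / 2) - h * (⌊x i / h + 1 / 2⌋ - 1 / 2) = h := by
    intro i; ring
  simp_rw [this]
  simp [ENNReal.ofReal_pow hh.le]

theorem norm_sub_le_of_mem_latticeCube {h : ℝ} (hh : 0 < h) {x y : E3} (H : y ∈ latticeCube h x) :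
    ‖y - x‖ ≤ 2 * h := by
  refine norm_le_two_mul_of_abs_le fun i => ?_
  have h1 := Int.floor_eq_iff.1 (H i)
  have h2 := Int.floor_eq_iff.1 (rfl : ⌊x i / h + 1 / 2⌋ = ⌊x i / h + 1 / 2⌋)
  have : (y - x) i = h * (y i / h - x i / h) := by simp; field_simp
  rw [this, abs_mul, abs_of_pos hh]
  have : |y i / h - x i / h| ≤ 1 := by rw [abs_le]; constructor <;> linarith [h1.1, h1.2, h2.1, h2.2]
  nlinarith

/-- The average factors through the cube index in `ℤ³`, and every map out of a countable discrete
space is measurable; nothing is required of `f`. -/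
theorem stronglyMeasurable_cubeAverage (h : ℝ) (f : E3 → E3) :
    StronglyMeasurable (cubeAverage h f) := by
  have hm : Measurable fun x : E3 => fun i : Fin 3 => ⌊x i / h + 1 / 2⌋ :=
    measurable_pi_lambda _ fun i => Int.measurable_floor.comp (by fun_prop)
  have : cubeAverage h f = (fun n : Fin 3 → ℤ =>
      ⨍ y in {y : E3 | ∀ i, ⌊y i / h + 1 / 2⌋ = n i}, f y) ∘
      fun x : E3 => fun i : Fin 3 => ⌊x i / h + 1 / 2⌋ := rfl
  rw [this]
  exact ((measurable_of_countable _).comp hm).stronglyMeasurable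

theorem cubeAverage_eq {h : ℝ} (hh : 0 < h) (f : E3 → E3) (x : E3) :
    cubeAverage h f x = (h ^ 3)⁻¹ • ∫ y in latticeCube h x, f y := by
  rw [cubeAverage, setAverage_eq, Measure.real, volume_latticeCube hh,
    ENNReal.toReal_ofReal (by positivity)]

theorem setLIntegral_latticeCube_le {h : ℝ} (hh : 0 < h) {p : ℝ≥0∞} (hp : 1 ≤ p) {f : E3 → E3}
    (hf : AEStronglyMeasurable f volume) (x : E3) :
    ∫⁻ y in latticeCube h x, ‖f y‖ₑ ≤
      eLpNorm f p volume * ENNReal.ofReal (h ^ 3) ^ (1 - 1 / p.toReal) := by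
  have := eLpNorm_le_eLpNorm_mul_rpow_measure_univ hp
    (hf.mono_measure (Measure.restrict_le_self (s := latticeCube h x)))
  rw [eLpNorm_one_eq_lintegral_enorm, Measure.restrict_apply_univ, volume_latticeCube hh] at this
  refine this.trans ?_
  rw [ENNReal.toReal_one, one_div_one]
  gcongr
  exact Measure.restrict_le_self

/-- Cauchy–Schwarz on a cube of volume `h³`. This turns the `L²` bound on the difference of two
flows into a pointwise bound on its averages. -/
theorem enorm_cubeAverage_le {h : ℝ} (hh : 0 < h) {f : E3 → E3}
    (hf : AEStronglyMeasurable f volume) (x : E3) :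
    ‖cubeAverage h f x‖ₑ ≤ ENNReal.ofReal (h ^ (-(3 / 2) : ℝ)) * eLpNorm f 2 volume := by
  rw [cubeAverage_eq hh, enorm_smul]
  calc _ ≤ ‖(h ^ 3)⁻¹‖ₑ * (eLpNorm f 2 volume * ENNReal.ofReal (h ^ 3) ^ (1 - 1 / (2 : ℝ≥0∞).toReal)) := by
        gcongr
        exact (enorm_integral_le_lintegral_enorm _).trans
          (setLIntegral_latticeCube_le hh (by norm_num) hf x)
    _ = _ := by
        rw [Real.enorm_of_nonneg (by positivity), mul_left_comm, mul_comm,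
          ENNReal.ofReal_rpow_of_pos (by positivity), ← ENNReal.ofReal_mul (by positivity)]
        congr 2
        rw [← Real.rpow_natCast, ← Real.rpow_neg hh.le, ← Real.rpow_mul hh.le, ← Real.rpow_add hh]
        norm_num

end Lattice


/-! ### Heat flow of the fluctuation about cube averages -/

/-- The mean over increments `ζ`, `|ζ| ≤ 2h`, of the oscillation of the heat kernel. -/
def heatOscillation (τ h : ℝ) (a : E3) : ℝ≥0∞ :=
  ENNReal.ofReal ((h ^ 3)⁻¹) *
    ∫⁻ ζ in Metric.closedBall (0 : E3) (2 * h), ‖heatKernel τ (a + ζ) - heatKernel τ a‖ₑ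

theorem measurable_heatKernel_slice (τ : ℝ) : Measurable (heatKernel τ) :=
  measurable_heatKernel.comp measurable_prodMk_left

theorem measurable_heatKernel_increment (τ : ℝ) :
    Measurable fun z : E3 × E3 => ‖heatKernel τ (z.1 + z.2) - heatKernel τ z.1‖ₑ :=
  (((measurable_heatKernel_slice τ).comp (measurable_fst.add measurable_snd)).sub
    ((measurable_heatKernel_slice τ).comp measurable_fst)).enorm

theorem measurable_heatOscillation (τ h : ℝ) : Measurable (heatOscillation τ h) :=
  (measurable_heatKernel_increment τ).lintegral_prod_right'.const_mul _

/-- The volume of the ball of radius `2h` cancels the normalisation `h⁻³`, leaving the cost `h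
τ^{-1/2}` of one translation of length at most `2h`. -/
theorem exists_lintegral_heatOscillation_le :
    ∃ C : ℝ≥0, ∀ τ h : ℝ, 0 < τ → 0 < h →
      ∫⁻ a, heatOscillation τ h a ≤ C * ENNReal.ofReal (h * τ ^ (-(1 / 2) : ℝ)) := by
  obtain ⟨C, hC⟩ := exists_lintegral_heatKernel_translate_le
  have hV : volume (Metric.closedBall (0 : E3) 1) ≠ ∞ := measure_closedBall_lt_top.ne
  refine ⟨C * (8 * (volume (Metric.closedBall (0 : E3) 1)).toNNReal * 2), fun τ h hτ hh => ?_⟩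
  unfold heatOscillation
  rw [lintegral_const_mul _ (measurable_heatKernel_increment τ).lintegral_prod_right',
    lintegral_lintegral_swap (measurable_heatKernel_increment τ).aemeasurable]
  have hb : ∫⁻ ζ in Metric.closedBall (0 : E3) (2 * h), ∫⁻ x, ‖heatKernel τ (x + ζ) - heatKernel τ x‖ₑ
      ≤ C * ENNReal.ofReal (2 * h * τ ^ (-(1 / 2) : ℝ)) *
        (ENNReal.ofReal ((2 * h) ^ 3) * volume (Metric.closedBall (0 : E3) 1)) := by
    have hv : volume (Metric.closedBall (0 : E3) (2 * h)) =
        ENNReal.ofReal ((2 * h) ^ 3) * volume (Metric.closedBall (0 : E3) 1) := by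
      rw [Measure.addHaar_closedBall' _ _ (by positivity)]; simp
    rw [← hv]
    refine (setLIntegral_mono' measurableSet_closedBall (g := fun _ =>
      C * ENNReal.ofReal (2 * h * τ ^ (-(1 / 2) : ℝ))) fun ζ hζ => ?_).trans ?_
    · refine (hC τ hτ ζ).trans ?_
      gcongr
      simpa using hζ
    · rw [setLIntegral_const]
  calc _ ≤ ENNReal.ofReal ((h ^ 3)⁻¹) * (C * ENNReal.ofReal (2 * h * τ ^ (-(1 / 2) : ℝ)) *
        (ENNReal.ofReal ((2 * h) ^ 3) * volume (Metric.closedBall (0 : E3) 1))) := by gcongr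
    _ = C * volume (Metric.closedBall (0 : E3) 1) * (ENNReal.ofReal ((h ^ 3)⁻¹) *
        ENNReal.ofReal (2 * h * τ ^ (-(1 / 2) : ℝ)) * ENNReal.ofReal ((2 * h) ^ 3)) := by ring
    _ = C * volume (Metric.closedBall (0 : E3) 1) * (16 * ENNReal.ofReal (h * τ ^ (-(1 / 2) : ℝ))) := by
        congr 1
        rw [← ENNReal.ofReal_mul (by positivity), ← ENNReal.ofReal_mul (by positivity)]
        have : (16 : ℝ≥0∞) = ENNReal.ofReal 16 := by simp
        rw [this, ← ENNReal.ofReal_mul (by positivity)]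
        congr 1
        field_simp; ring
    _ = _ := by
        simp only [ENNReal.coe_mul, ENNReal.coe_toNNReal hV, ENNReal.coe_ofNat]
        ring

theorem lintegral_heatKernel_sub {τ : ℝ} (hτ : 0 < τ) (x : E3) :
    ∫⁻ y, ENNReal.ofReal (heatKernel τ (x - y)) = 1 := by
  rw [lintegral_sub_left_eq_self (fun y => ENNReal.ofReal (heatKernel τ y)) x,
    lintegral_heatKernel hτ]

theorem enorm_heatKernel {τ : ℝ} (hτ : 0 < τ) (x : E3) :
    ‖heatKernel τ x‖ₑ = ENNReal.ofReal (heatKernel τ x) :=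
  Real.enorm_of_nonneg (heatKernel_nonneg hτ.le x)

theorem integrable_heatKernel_sub {τ : ℝ} (hτ : 0 < τ) (x : E3) :
    Integrable fun y => heatKernel τ (x - y) := by
  refine ⟨((measurable_heatKernel_slice τ).comp (measurable_const.sub measurable_id)).aestronglyMeasurable, ?_⟩
  rw [hasFiniteIntegral_iff_enorm]
  simp_rw [enorm_heatKernel hτ]
  rw [lintegral_heatKernel_sub hτ]; simp

/-- Fubini's hypothesis for moving the average from `w` to the kernel: Hölder bounds the integral of
`|w|` over a cube uniformly in the cube, and the heat kernel has mass one. -/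
theorem integrable_latticeKernel {τ h : ℝ} (hτ : 0 < τ) (hh : 0 < h) {p : ℝ≥0∞} (hp : 1 ≤ p)
    {w : E3 → E3} (hw : MemLp w p volume) (x : E3) :
    Integrable (fun z : E3 × E3 => {z : E3 × E3 | z.2 ∈ latticeCube h z.1}.indicator
      (fun z => heatKernel τ (x - z.1) • w z.2) z) := by
  have hS := measurableSet_latticeCube_prod h
  have hG : Measurable fun y => heatKernel τ (x - y) :=
    (measurable_heatKernel_slice τ).comp (measurable_const.sub measurable_id)
  have hae : AEStronglyMeasurable (fun z : E3 × E3 => heatKernel τ (x - z.1) • w z.2)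
      (volume : Measure (E3 × E3)) :=
    (hG.comp measurable_fst).aestronglyMeasurable.smul hw.1.comp_snd
  refine ⟨hae.indicator hS, ?_⟩
  rw [hasFiniteIntegral_iff_enorm, Measure.volume_eq_prod, lintegral_prod _ (hae.indicator hS).enorm]
  calc _ ≤ ∫⁻ y, ENNReal.ofReal (heatKernel τ (x - y)) *
        (eLpNorm w p volume * ENNReal.ofReal (h ^ 3) ^ (1 - 1 / p.toReal)) := by
        refine lintegral_mono fun y => ?_
        have e : ∀ z, ‖{z : E3 × E3 | z.2 ∈ latticeCube h z.1}.indicator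
            (fun z => heatKernel τ (x - z.1) • w z.2) (y, z)‖ₑ =
            (latticeCube h y).indicator (fun z => ENNReal.ofReal (heatKernel τ (x - y)) * ‖w z‖ₑ) z := by
          intro z
          by_cases hz : z ∈ latticeCube h y
          · rw [indicator_of_mem (show (y, z) ∈ {z : E3 × E3 | z.2 ∈ latticeCube h z.1} from hz),
              indicator_of_mem hz, enorm_smul, enorm_heatKernel hτ]
          · rw [indicator_of_notMem (show (y, z) ∉ {z : E3 × E3 | z.2 ∈ latticeCube h z.1} from hz),
              indicator_of_notMem hz, enorm_zero]
        simp_rw [e]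
        rw [lintegral_indicator (measurableSet_latticeCube h y),
          lintegral_const_mul' _ _ ENNReal.ofReal_ne_top]
        gcongr
        exact setLIntegral_latticeCube_le hh hp hw.1 y
    _ = eLpNorm w p volume * ENNReal.ofReal (h ^ 3) ^ (1 - 1 / p.toReal) := by
        rw [lintegral_mul_const _ hG.ennreal_ofReal, lintegral_heatKernel_sub hτ, one_mul]
    _ < ∞ := by
        refine ENNReal.mul_lt_top hw.2 ?_
        rw [ENNReal.ofReal_rpow_of_pos (by positivity)]
        exact ENNReal.ofReal_lt_top

/-- Averaging is self-adjoint because lying in the same cube is a symmetric relation. The smoothness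
of the heat kernel can thereby be used, although `w` itself has none. -/
theorem heat_cubeAverage {τ h : ℝ} (hτ : 0 < τ) (hh : 0 < h) {p : ℝ≥0∞} (hp : 1 ≤ p)
    {w : E3 → E3} (hw : MemLp w p volume) (x : E3) :
    Integrable (fun y => heatKernel τ (x - y) • cubeAverage h w y) ∧
    Integrable (fun y => ((h ^ 3)⁻¹ * ∫ z in latticeCube h y, heatKernel τ (x - z)) • w y) ∧
    heat τ (cubeAverage h w) x =
      ∫ y, ((h ^ 3)⁻¹ * ∫ z in latticeCube h y, heatKernel τ (x - z)) • w y := by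
  have hI := integrable_latticeKernel hτ hh hp hw x
  have e1 : ∀ y, ∫ z, {z : E3 × E3 | z.2 ∈ latticeCube h z.1}.indicator
      (fun z => heatKernel τ (x - z.1) • w z.2) (y, z) =
      heatKernel τ (x - y) • ∫ z in latticeCube h y, w z := by
    intro y
    rw [← integral_smul, ← integral_indicator (measurableSet_latticeCube h y)]
    rfl
  have e2 : ∀ z, ∫ y, {z : E3 × E3 | z.2 ∈ latticeCube h z.1}.indicator
      (fun z => heatKernel τ (x - z.1) • w z.2) (y, z) =
      (∫ y in latticeCube h z, heatKernel τ (x - y)) • w z := by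
    intro z
    rw [← integral_smul_const, ← integral_indicator (measurableSet_latticeCube h z)]
    refine integral_congr_ae (Eventually.of_forall fun y => ?_)
    by_cases hz : z ∈ latticeCube h y
    · simp only
      rw [indicator_of_mem (show (y, z) ∈ {z : E3 × E3 | z.2 ∈ latticeCube h z.1} from hz),
        indicator_of_mem (mem_latticeCube_comm.1 hz)]
    · simp only
      rw [indicator_of_notMem (show (y, z) ∉ {z : E3 × E3 | z.2 ∈ latticeCube h z.1} from hz),
        indicator_of_notMem (fun H => hz (mem_latticeCube_comm.1 H))]
  have i1 := hI.integral_prod_left.smul (h ^ 3)⁻¹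
  have i2 := hI.integral_prod_right.smul (h ^ 3)⁻¹
  have es := integral_integral_swap (f := fun y z => {z : E3 × E3 | z.2 ∈ latticeCube h z.1}.indicator
      (fun z => heatKernel τ (x - z.1) • w z.2) (y, z)) hI
  simp only [e1, e2] at es
  refine ⟨i1.congr (Eventually.of_forall fun y => ?_), i2.congr (Eventually.of_forall fun y => ?_), ?_⟩
  · simp only [Pi.smul_apply, e1]
    rw [cubeAverage_eq hh, smul_comm]
  · simp only [Pi.smul_apply, e2, smul_smul]
  · simp only [heat, cubeAverage_eq hh, mul_smul, integral_smul]
    rw [← es, ← integral_smul]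
    exact integral_congr_ae (Eventually.of_forall fun y => smul_comm _ _ _)

/-- Heat flow of the fluctuation of a field about its cube averages. -/
theorem exists_eLpNorm_heat_sub_cubeAverage_le :
    ∃ C : ℝ≥0, ∀ τ h : ℝ, 0 < τ → 0 < h → ∀ p : ℝ≥0∞, 1 ≤ p → ∀ w : E3 → E3, MemLp w p volume →
      (∀ᵐ x, Integrable (fun y => heatKernel τ (x - y) • w y)) →
      eLpNorm (fun x => heat τ w x - heat τ (cubeAverage h w) x) p volume ≤
        C * ENNReal.ofReal (h * τ ^ (-(1 / 2) : ℝ)) * eLpNorm w p volume := by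
  obtain ⟨C, hC⟩ := exists_lintegral_heatOscillation_le
  refine ⟨C, fun τ h hτ hh p hp w hw hint => ?_⟩
  -- With `g = 1` and `q = ∞` this is the ordinary `L¹ * L^p → L^p` inequality.
  have hy := eLpNorm_conv_mul_le (p := p) (q := ∞) (m := 1) hp le_top (by simp)
    (by simpa using ENNReal.toReal_mono ENNReal.one_ne_top (ENNReal.inv_le_one.2 hp))
    (measurable_heatOscillation τ h) (g := fun _ => 1) (ω := fun y => ‖w y‖ₑ)
    aemeasurable_const hw.1.enorm
  simp only [ENNReal.rpow_one, ENNReal.inv_top, ENNReal.toReal_zero, sub_zero, one_mul] at hy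
  rw [eLpNorm_enorm] at hy
  have h1 : eLpNorm (fun _ : E3 => (1 : ℝ≥0∞)) ∞ volume ≤ 1 := by
    rw [eLpNorm_exponent_top]
    exact eLpNormEssSup_le_of_ae_enorm_bound (by simp)
  calc _ ≤ eLpNorm (fun x => ∫⁻ y, heatOscillation τ h (x - y) * ‖w y‖ₑ) p volume := by
        refine eLpNorm_mono_enorm_ae ?_
        filter_upwards [hint] with x hint
        obtain ⟨i1, i2, e⟩ := heat_cubeAverage hτ hh hp hw x
        rw [e, heat, ← integral_sub hint i2]
        refine (enorm_integral_le_lintegral_enorm _).trans (lintegral_mono fun y => ?_)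
        rw [← sub_smul, enorm_smul]
        refine mul_le_mul_left ?_ _
        have e3 : heatKernel τ (x - y) - (h ^ 3)⁻¹ * ∫ z in latticeCube h y, heatKernel τ (x - z) =
            (h ^ 3)⁻¹ * ∫ z in latticeCube h y, (heatKernel τ (x - y) - heatKernel τ (x - z)) := by
          have hfin : volume (latticeCube h y) ≠ ∞ := by
            rw [volume_latticeCube hh]; exact ENNReal.ofReal_ne_top
          have hc : Integrable (fun _ : E3 => heatKernel τ (x - y))
              (volume.restrict (latticeCube h y)) :=
            integrableOn_const hfin enorm_ne_top
          rw [integral_sub hc (integrable_heatKernel_sub hτ x).integrableOn, setIntegral_const, Measure.real,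
            volume_latticeCube hh, ENNReal.toReal_ofReal (by positivity), smul_eq_mul, mul_sub,
            ← mul_assoc, inv_mul_cancel₀ (by positivity), one_mul]
        rw [e3, enorm_mul, Real.enorm_of_nonneg (by positivity), heatOscillation]
        refine mul_le_mul_right ((enorm_integral_le_lintegral_enorm _).trans ?_) _
        -- Enlarging the cube to a ball centred at `y` makes the bound depend on `x - y` only, hence
        -- a convolution; the increment is `ζ = y - z`.
        have hsub : (latticeCube h y).indicator (fun z => ‖heatKernel τ (x - y) - heatKernel τ (x - z)‖ₑ)
            ≤ fun z => (Metric.closedBall (0 : E3) (2 * h)).indicator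
              (fun ζ => ‖heatKernel τ (x - y + ζ) - heatKernel τ (x - y)‖ₑ) (y - z) := by
          intro z
          by_cases hz : z ∈ latticeCube h y
          · have hm : y - z ∈ Metric.closedBall (0 : E3) (2 * h) := by
              simpa using norm_sub_le_of_mem_latticeCube hh (mem_latticeCube_comm.1 hz)
            simp only
            rw [indicator_of_mem hz, indicator_of_mem hm, enorm_sub_rev]
            simp
          · rw [indicator_of_notMem hz]; exact zero_le
        rw [← lintegral_indicator (measurableSet_latticeCube h y),
          ← lintegral_indicator measurableSet_closedBall]
        refine (lintegral_mono hsub).trans (le_of_eq ?_)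
        exact lintegral_sub_left_eq_self ((Metric.closedBall (0 : E3) (2 * h)).indicator
              (fun ζ => ‖heatKernel τ (x - y + ζ) - heatKernel τ (x - y)‖ₑ)) y
    _ ≤ _ := hy
    _ ≤ C * ENNReal.ofReal (h * τ ^ (-(1 / 2) : ℝ)) * (1 * eLpNorm w p volume) := by
        gcongr
        exact hC τ h hτ hh
    _ = _ := by rw [one_mul]

theorem eLpNorm_heat_le {τ : ℝ} (hτ : 0 < τ) {p : ℝ≥0∞} (hp : 1 ≤ p) {w : E3 → E3}
    (hw : AEStronglyMeasurable w volume) :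
    eLpNorm (heat τ w) p volume ≤ eLpNorm w p volume := by
  have hy := eLpNorm_conv_mul_le (p := p) (q := ∞) (m := 1) hp le_top (by simp)
    (by simpa using ENNReal.toReal_mono ENNReal.one_ne_top (ENNReal.inv_le_one.2 hp))
    (measurable_heatKernel_slice τ).ennreal_ofReal (g := fun _ => 1) (ω := fun y => ‖w y‖ₑ)
    aemeasurable_const hw.enorm
  simp only [ENNReal.rpow_one, ENNReal.inv_top, ENNReal.toReal_zero, sub_zero, one_mul] at hy
  rw [eLpNorm_enorm, lintegral_heatKernel hτ, one_mul] at hy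
  have h1 : eLpNorm (fun _ : E3 => (1 : ℝ≥0∞)) ∞ volume ≤ 1 := by
    rw [eLpNorm_exponent_top]
    exact eLpNormEssSup_le_of_ae_enorm_bound (by simp)
  refine (eLpNorm_mono_enorm fun x => ?_).trans (hy.trans ((mul_le_mul_left h1 _).trans (one_mul _).le))
  rw [heat]
  refine (enorm_integral_le_lintegral_enorm _).trans (le_of_eq ?_)
  refine lintegral_congr fun y => ?_
  rw [enorm_smul, enorm_heatKernel hτ]


/-! ### Bilinear estimate and persistence of the `L^p` norm -/

theorem inv_toReal_lt_third {p : ℝ≥0∞} (hp : 3 < p) : (p⁻¹).toReal < 1 / 3 := by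
  have h : p⁻¹ < 3⁻¹ := ENNReal.inv_lt_inv.2 hp
  have := ENNReal.toReal_strict_mono (by simp) h
  simpa using this

theorem critExp_pos {p : ℝ≥0∞} (hp : 3 < p) : 0 < critExp p := by
  have := inv_toReal_lt_third hp
  unfold critExp; linarith

theorem critExp_le_half (p : ℝ≥0∞) : critExp p ≤ 1 / 2 := by
  have : 0 ≤ (p⁻¹).toReal := ENNReal.toReal_nonneg
  unfold critExp; linarith

theorem IsDuhamelFlow.aestronglyMeasurable_sub {T : ℝ≥0∞} {u v : ℝ → E3 → E3}
    (hu : IsDuhamelFlow T u) (hv : IsDuhamelFlow T v) {t : ℝ} (ht : 0 < t)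
    (hT : ENNReal.ofReal t < T) : AEStronglyMeasurable ((u - v) t) volume :=
  (hu.slice t ht hT).sub (hv.slice t ht hT)

theorem ae_shift {P : ℝ → Prop} (h : ∀ᵐ s : ℝ, P s) (t : ℝ) : ∀ᵐ s : ℝ, P (t + s) :=
  (measurePreserving_add_left volume t).quasiMeasurePreserving.ae h

theorem eLpNorm_enorm_add_le {p : ℝ≥0∞} (hp : 1 ≤ p) {f g : E3 → E3}
    (hf : AEStronglyMeasurable f volume) (hg : AEStronglyMeasurable g volume) :
    eLpNorm (fun y => ‖f y‖ₑ + ‖g y‖ₑ) p volume ≤ eLpNorm f p volume + eLpNorm g p volume := by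
  have := eLpNorm_add_le (f := fun y => ‖f y‖ₑ) (g := fun y => ‖g y‖ₑ) (μ := volume)
    hf.enorm.aestronglyMeasurable hg.enorm.aestronglyMeasurable hp
  rwa [eLpNorm_enorm, eLpNorm_enorm] at this

/-- The bilinear estimate in `L^q × L^p → L^p` for the difference of two flows. -/
theorem exists_bilinear_estimate {q : ℝ≥0∞} (hq : 3 < q) :
    ∃ C : ℝ, 0 < C ∧ ∀ (p : ℝ≥0∞), 1 ≤ p → (p⁻¹).toReal + (q⁻¹).toReal ≤ 1 →
      ∀ (T : ℝ≥0∞) (u v : ℝ → E3 → E3), IsDuhamelFlow T u → IsDuhamelFlow T v →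
      ∀ t τ A D : ℝ, 0 < t → 0 < τ → ENNReal.ofReal (t + τ) < T → 0 < A → 0 < D →
      (∀ s ∈ Ioo t (t + τ), eLpNorm (u s) q volume ≤ ENNReal.ofReal A) →
      (∀ s ∈ Ioo t (t + τ), eLpNorm (v s) q volume ≤ ENNReal.ofReal A) →
      (∀ s ∈ Ioo t (t + τ), eLpNorm ((u - v) s) p volume ≤ ENNReal.ofReal D) →
      eLpNorm (fun x => (u - v) (t + τ) x - heat τ ((u - v) t) x) p volume ≤
        ENNReal.ofReal (C * τ ^ critExp q * (2 * A * D)) := by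
  have hk := kC_pos
  have hc := critExp_pos hq
  obtain ⟨C, hC⟩ := exists_eLpNorm_kmaj_conv_le (lt_trans (by norm_num) hq : 1 < q)
  have hC1 : (0 : ℝ) < C + 1 := by positivity
  -- The factor `1 / critExp q` is the time integral of `(τ-s)^{critExp q - 1}`, finite because `q >
  -- 3`; `C + 1` replaces `C` to secure positivity.
  refine ⟨36 * kC * ((C + 1) / critExp q), by positivity,
    fun p hp hpq T u v hu hv t τ A D ht hτ hT hA hD hua hva hwD => ?_⟩
  obtain ⟨f, hfm, hf, hduh⟩ := hu.exists_interaction hv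
  have he : -(1 / 2) - 3 / 2 * (q⁻¹).toReal = critExp q - 1 := by unfold critExp; ring
  have hpot := eLpNorm_duhamelPotential_le hp hfm (t := t) (τ := τ)
    (b := fun s => (C + 1) * (2 * A * D) * (τ - s) ^ (critExp q - 1)) (by fun_prop)
    (fun s hs => by have : 0 < τ - s := by linarith [hs.2]
                    positivity) (by
    filter_upwards [ae_shift hf t] with s hs hm
    have hts : t + s ∈ Ioo t (t + τ) := ⟨by linarith [hm.1], by linarith [hm.2]⟩
    have h0 : 0 < t + s := by linarith [hm.1]
    have hTs : ENNReal.ofReal (t + s) < T :=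
      lt_of_le_of_lt (ENNReal.ofReal_le_ofReal hts.2.le) hT
    have hσ : 0 < τ - s := by linarith [hm.2]
    have hus := hu.slice _ h0 hTs
    have hvs := hv.slice _ h0 hTs
    have hws := hu.aestronglyMeasurable_sub hv h0 hTs
    have e : (fun x => ∫⁻ y, kmaj (τ - s) (x - y) * f (t + s, y)) = fun x => ∫⁻ y,
        kmaj (τ - s) (x - y) * ((‖u (t + s) y‖ₑ + ‖v (t + s) y‖ₑ) * ‖(u - v) (t + s) y‖ₑ) := by
      funext x
      refine lintegral_congr_ae ?_
      filter_upwards [hs h0 hTs] with y hy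
      rw [hy]
    rw [e]
    refine (hC p hp hpq (τ - s) hσ _ _ (hus.enorm.add hvs.enorm) hws.enorm).trans ?_
    rw [eLpNorm_enorm, he]
    calc _ ≤ ENNReal.ofReal (C + 1) * ENNReal.ofReal ((τ - s) ^ (critExp q - 1)) *
          ((ENNReal.ofReal A + ENNReal.ofReal A) * ENNReal.ofReal D) := by
          gcongr
          · rw [← ENNReal.ofReal_coe_nnreal]
            exact ENNReal.ofReal_le_ofReal (by linarith)
          · exact (eLpNorm_enorm_add_le (le_trans (by norm_num) hq.le) hus hvs).trans
              (add_le_add (hua _ hts) (hva _ hts))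
          · exact hwD _ hts
      _ = _ := by
          rw [← ENNReal.ofReal_add hA.le hA.le, ← ENNReal.ofReal_mul (by positivity),
            ← ENNReal.ofReal_mul (by positivity), ← ENNReal.ofReal_mul (by positivity)]
          congr 1; ring)
  have hint : ∫⁻ s in Ioo 0 τ, ENNReal.ofReal ((C + 1) * (2 * A * D) * (τ - s) ^ (critExp q - 1)) =
      ENNReal.ofReal ((C + 1) * (2 * A * D) * (τ ^ critExp q / critExp q)) := by
    simp_rw [ENNReal.ofReal_mul (show (0 : ℝ) ≤ (C + 1) * (2 * A * D) by positivity)]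
    rw [lintegral_const_mul _ (by fun_prop),
      lintegral_Ioo_reflect (fun s => ENNReal.ofReal (s ^ (critExp q - 1))),
      lintegral_rpow_Ioo hτ.le (by linarith), sub_add_cancel]
  rw [hint] at hpot
  calc _ ≤ ENNReal.ofReal (36 * kC) * eLpNorm (duhamelPotential f t τ) p volume :=
        eLpNorm_le_const_mul_of_ae_enorm_le hp (measurable_duhamelPotential hfm t τ).aemeasurable
          ((hduh t τ ht hτ hT).mono fun x hx => hx.2)
    _ ≤ ENNReal.ofReal (36 * kC) *
        ENNReal.ofReal ((C + 1) * (2 * A * D) * (τ ^ critExp q / critExp q)) := by gcongr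
    _ = _ := by
        rw [← ENNReal.ofReal_mul (by positivity)]
        congr 1; ring

theorem aestronglyMeasurable_heat {τ : ℝ} {w : E3 → E3} (hw : AEStronglyMeasurable w volume) :
    AEStronglyMeasurable (heat τ w) volume := by
  have hG : Measurable fun z : E3 × E3 => heatKernel τ (z.1 - z.2) :=
    (measurable_heatKernel_slice τ).comp (measurable_fst.sub measurable_snd)
  exact (hG.aestronglyMeasurable.smul hw.comp_snd :
    AEStronglyMeasurable (fun z : E3 × E3 => heatKernel τ (z.1 - z.2) • w z.2)
      (volume.prod volume)).integral_prod_right'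

/-- Local persistence of the `L^p` norm. -/
theorem exists_persistence {p : ℝ≥0∞} (hp : 3 < p) {C : ℝ} (hC : 0 < C)
    (hbil : ∀ (T : ℝ≥0∞) (u v : ℝ → E3 → E3), IsDuhamelFlow T u → IsDuhamelFlow T v →
      ∀ t τ A D : ℝ, 0 < t → 0 < τ → ENNReal.ofReal (t + τ) < T → 0 < A → 0 < D →
      (∀ s ∈ Ioo t (t + τ), eLpNorm (u s) p volume ≤ ENNReal.ofReal A) →
      (∀ s ∈ Ioo t (t + τ), eLpNorm (v s) p volume ≤ ENNReal.ofReal A) →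
      (∀ s ∈ Ioo t (t + τ), eLpNorm ((u - v) s) p volume ≤ ENNReal.ofReal D) →
      eLpNorm (fun x => (u - v) (t + τ) x - heat τ ((u - v) t) x) p volume ≤
        ENNReal.ofReal (C * τ ^ critExp p * (2 * A * D)))
    {u : ℝ → E3 → E3} (hu : IsDuhamelFlow ∞ u) (hloc : LocallyBoundedLp p u)
    {t τ a : ℝ} (ht : 0 < t) (ha : 0 < a)
    (hta : eLpNorm (u t) p volume ≤ ENNReal.ofReal a) (hsmall : 16 * C * τ ^ critExp p * a ≤ 1) :
    ∀ s, 0 ≤ s → s ≤ τ → eLpNorm (u (t + s)) p volume ≤ ENNReal.ofReal (2 * a) := by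
  have hp1 : 1 ≤ p := le_trans (by norm_num) hp.le
  have hc := critExp_pos hp
  -- The bilinear estimate against the zero flow, plus contractivity of the heat semigroup.
  have step : ∀ t σ A b : ℝ, 0 < t → 0 < σ → 0 < A → 0 ≤ b →
      (∀ s ∈ Ioo t (t + σ), eLpNorm (u s) p volume ≤ ENNReal.ofReal A) →
      eLpNorm (u t) p volume ≤ ENNReal.ofReal b →
      eLpNorm (u (t + σ)) p volume ≤ ENNReal.ofReal (b + C * σ ^ critExp p * (2 * A * A)) := by
    intro t σ A b ht hσ hA hb hs hub
    have h := hbil ∞ u 0 hu (isDuhamelFlow_zero ∞) t σ A A ht hσ ENNReal.ofReal_lt_top hA hA hs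
      (fun s _ => by simp) (fun s hs' => by simpa using hs s hs')
    simp only [sub_zero] at h
    have hm := hu.slice (t + σ) (by linarith) ENNReal.ofReal_lt_top
    have hm2 := aestronglyMeasurable_heat (τ := σ) (hu.slice t ht ENNReal.ofReal_lt_top)
    calc eLpNorm (u (t + σ)) p volume
        = eLpNorm ((heat σ (u t)) + fun x => u (t + σ) x - heat σ (u t) x) p volume := by
          congr 1; funext x; simp
      _ ≤ eLpNorm (heat σ (u t)) p volume +
          eLpNorm (fun x => u (t + σ) x - heat σ (u t) x) p volume :=
          eLpNorm_add_le hm2 (hm.sub hm2) hp1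
      _ ≤ ENNReal.ofReal b + ENNReal.ofReal (C * σ ^ critExp p * (2 * A * A)) :=
          add_le_add ((eLpNorm_heat_le hσ hp1 (hu.slice t ht ENNReal.ofReal_lt_top)).trans hub) h
      _ = _ := (ENNReal.ofReal_add hb (by positivity)).symm
  obtain ⟨L₀, hL₀⟩ := hloc t (t + τ) ht
  set L : ℝ := L₀ + 1 with hL
  have hLpos : 0 < L := by positivity
  have hLb : ∀ s ∈ Icc t (t + τ), eLpNorm (u s) p volume ≤ ENNReal.ofReal L := fun s hs => by
    refine (hL₀ s hs).trans ?_
    rw [← ENNReal.ofReal_coe_nnreal]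
    exact ENNReal.ofReal_le_ofReal (by linarith)
  -- The qualitative bound `L` determines only the step length `η`, and so never enters the
  -- conclusion.
  obtain ⟨η, hη, hηs⟩ : ∃ η : ℝ, 0 < η ∧ C * η ^ critExp p * (2 * L * L) ≤ a / 2 := by
    refine ⟨(a / 2 / (C * (2 * L * L))) ^ (critExp p)⁻¹, by positivity, ?_⟩
    rw [← Real.rpow_mul (by positivity), inv_mul_cancel₀ hc.ne', Real.rpow_one]
    apply le_of_eq; field_simp
  -- A continuation argument that needs no continuity in time. The bound `2a` on `[0,kη]` improves
  -- to `3a/2` at `kη` by smallness, since `8 C τ^c a² ≤ a/2`; the rough bound `L` then loses at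
  -- most `a/2` over the next step of length `η`.
  have main : ∀ k : ℕ, ∀ s, 0 ≤ s → s ≤ k * η → s ≤ τ →
      eLpNorm (u (t + s)) p volume ≤ ENNReal.ofReal (2 * a) := by
    intro k
    induction k with
    | zero =>
      intro s h0 h1 _
      have : s = 0 := le_antisymm (by simpa using h1) h0
      rw [this, add_zero]
      exact hta.trans (ENNReal.ofReal_le_ofReal (by linarith))
    | succ k ih =>
      intro s h0 h1 h2
      rcases le_or_gt s (k * η) with h | h
      · exact ih s h0 h h2
      have hr0 : 0 ≤ (k : ℝ) * η := by positivity
      have hr : eLpNorm (u (t + k * η)) p volume ≤ ENNReal.ofReal (3 / 2 * a) := by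
        rcases hr0.eq_or_lt with h3 | h3
        · rw [← h3, add_zero]; exact hta.trans (ENNReal.ofReal_le_ofReal (by linarith))
        · refine (step t (k * η) (2 * a) a ht h3 (by linarith) ha.le (fun r hr => ?_) hta).trans
            (ENNReal.ofReal_le_ofReal ?_)
          · have := ih (r - t) (by linarith [hr.1]) (by linarith [hr.2]) (by linarith [hr.2])
            simpa using this
          · have : ((k : ℝ) * η) ^ critExp p ≤ τ ^ critExp p :=
              Real.rpow_le_rpow hr0 (by linarith) hc.le
            have h4 : C * ((k : ℝ) * η) ^ critExp p * (2 * (2 * a) * (2 * a)) ≤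
                C * τ ^ critExp p * (2 * (2 * a) * (2 * a)) := by gcongr
            nlinarith
      have h5 := step (t + k * η) (s - k * η) L (3 / 2 * a) (by linarith) (by linarith) hLpos
        (by linarith) (fun r hr => hLb r ⟨by linarith [hr.1], by linarith [hr.2]⟩) hr
      have e : t + k * η + (s - k * η) = t + s := by ring
      rw [e] at h5
      refine h5.trans (ENNReal.ofReal_le_ofReal ?_)
      have : (s - k * η) ^ critExp p ≤ η ^ critExp p := by
        refine Real.rpow_le_rpow (by linarith) ?_ hc.le
        push_cast at h1; linarith
      have h6 : C * (s - k * η) ^ critExp p * (2 * L * L) ≤ C * η ^ critExp p * (2 * L * L) := by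
        gcongr
      linarith
  intro s h0 h1
  obtain ⟨k, hk⟩ := exists_nat_ge (s / η)
  exact main k s h0 (by rwa [div_le_iff₀ hη] at hk) h1


/-! ### Activity of the large scales -/

/-- With `c = critExp p`, the exponent `2p/(3-p)` is `-1/c` and `p/(3-p)` is `-1/(2c)`. -/
theorem three_mul_inv_toReal_sub_one (p : ℝ≥0∞) :
    3 * (p⁻¹).toReal - 1 = -(2 * critExp p) := by unfold critExp; ring

/-- Lower bound for the cube averages in terms of one Duhamel step of length `τ`. -/
theorem eLpNorm_le_of_heat_step {p : ℝ≥0∞} (hp : 1 ≤ p) {C₃ : ℝ≥0}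
    (hC₃ : ∀ τ h : ℝ, 0 < τ → 0 < h → ∀ p : ℝ≥0∞, 1 ≤ p → ∀ w : E3 → E3, MemLp w p volume →
      (∀ᵐ x, Integrable (fun y => heatKernel τ (x - y) • w y)) →
      eLpNorm (fun x => heat τ w x - heat τ (cubeAverage h w) x) p volume ≤
        C₃ * ENNReal.ofReal (h * τ ^ (-(1 / 2) : ℝ)) * eLpNorm w p volume)
    {τ h : ℝ} (hτ : 0 < τ) (hh : 0 < h) {w w' : E3 → E3} (hw : MemLp w p volume)
    (hw' : AEStronglyMeasurable w' volume)
    (hint : ∀ᵐ x, Integrable (fun y => heatKernel τ (x - y) • w y)) :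
    eLpNorm w' p volume ≤ eLpNorm (fun x => w' x - heat τ w x) p volume +
      C₃ * ENNReal.ofReal (h * τ ^ (-(1 / 2) : ℝ)) * eLpNorm w p volume +
      eLpNorm (cubeAverage h w) p volume := by
  have hJ := (stronglyMeasurable_cubeAverage h w).aestronglyMeasurable (μ := volume)
  have h1 := aestronglyMeasurable_heat (τ := τ) hw.1
  have h2 := aestronglyMeasurable_heat (τ := τ) hJ
  calc eLpNorm w' p volume
      = eLpNorm (((fun x => w' x - heat τ w x) + fun x => heat τ w x - heat τ (cubeAverage h w) x) +
          heat τ (cubeAverage h w)) p volume := by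
        congr 1; funext x; simp
    _ ≤ _ := (eLpNorm_add_le ((hw'.sub h1).add (h1.sub h2)) h2 hp).trans (add_le_add
        ((eLpNorm_add_le (hw'.sub h1) (h1.sub h2) hp).trans
          (add_le_add le_rfl (hC₃ τ h hτ hh p hp w hw hint))) (eLpNorm_heat_le hτ hp hJ))

/-- Of the lower bound `c₂/H` on the norm at time `t + τ`, the nonlinear term and the heat flow of
the fluctuation can each account for a quarter. The averages keep half, `c₂/(2H)`, which is more
than `γM/2 = c₂/(8H)`. -/
theorem exists_large_scales_active {p : ℝ≥0∞} (hp : 3 < p) {ct CB : ℝ} (hct : 0 < ct)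
    (hCB : 0 < CB) :
    ∃ K : ℝ, 0 < K ∧ ∀ (u v : ℝ → E3 → E3) (c₂ : ℝ),
      IsDuhamelFlow ∞ u → IsDuhamelFlow ∞ v → LocallyBoundedLp p u → LocallyBoundedLp p v →
      0 < c₂ → CriticalLowerBound p c₂ (u - v) →
      ∀ t, 0 < t → ∀ γ h : ℝ, γ = gammaFrac p ct c₂ (M0 p u v t) t →
        1 / h = K * invScale p ct CB c₂ (M0 p u v t) t →
        ENNReal.ofReal (γ / 2) * eLpNorm ((u - v) t) p volume
          ≤ eLpNorm (cubeAverage h ((u - v) t)) p volume := by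
  have hp1 : 1 ≤ p := le_trans (by norm_num) hp.le
  have hc := critExp_pos hp
  have hp3 := inv_toReal_lt_third hp
  obtain ⟨C₁, hC₁, hbil⟩ := exists_bilinear_estimate hp
  have hbil' := hbil p hp1 (by linarith)
  obtain ⟨C₃, hC₃⟩ := exists_eLpNorm_heat_sub_cubeAverage_le
  have hC₃' : ∀ τ h : ℝ, 0 < τ → 0 < h → ∀ p : ℝ≥0∞, 1 ≤ p → ∀ w : E3 → E3, MemLp w p volume →
      (∀ᵐ x, Integrable (fun y => heatKernel τ (x - y) • w y)) →
      eLpNorm (fun x => heat τ w x - heat τ (cubeAverage h w) x) p volume ≤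
        (C₃ + 1 : ℝ≥0) * ENNReal.ofReal (h * τ ^ (-(1 / 2) : ℝ)) * eLpNorm w p volume := by
    intro τ h hτ hh p hp w hw hi
    refine (hC₃ τ h hτ hh p hp w hw hi).trans ?_
    gcongr
    simp
  set c := critExp p with hcd
  -- The first entry lets the actual bilinear constant `C₁` be absorbed into the arbitrary `CB`. The
  -- second keeps the step within `4 ct M^{-1/c}`, so that `(t+τ)^c ≤ H`.
  set κ : ℝ := min ((CB / (4 * C₁)) ^ c⁻¹) (4 * ct * (4 * CB) ^ c⁻¹) with hκd
  have hκ : 0 < κ := lt_min (by positivity) (by positivity)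
  have hκ1 : 4 * C₁ * κ ^ c ≤ CB := by
    have : κ ^ c ≤ ((CB / (4 * C₁)) ^ c⁻¹) ^ c := Real.rpow_le_rpow hκ.le (min_le_left _ _) hc.le
    rw [← Real.rpow_mul (by positivity), inv_mul_cancel₀ hc.ne', Real.rpow_one,
      le_div_iff₀ (by positivity)] at this
    linarith
  have hκ2 : κ ≤ 4 * ct * (4 * CB) ^ c⁻¹ := min_le_right _ _
  -- Chosen so that `(C₃+1) h τ^{-1/2} M` equals `c₂/(4H)` exactly.
  refine ⟨(C₃ + 1) * κ ^ (-(1 / 2) : ℝ), by positivity, ?_⟩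
  intro u v c₂ hu hv hlu hlv hc₂ hlow t ht γ h hγ hh
  have hfin : ∀ {u : ℝ → E3 → E3}, LocallyBoundedLp p u → eLpNorm (u t) p volume < ∞ := by
    intro u hl
    obtain ⟨C, hC⟩ := hl t t ht
    exact (hC t ⟨le_rfl, le_rfl⟩).trans_lt ENNReal.coe_lt_top
  have hut := hu.slice t ht ENNReal.ofReal_lt_top
  have hvt := hv.slice t ht ENNReal.ofReal_lt_top
  set M := M0 p u v t with hM
  have hub : eLpNorm (u t) p volume ≤ ENNReal.ofReal (M / 2) := by
    rw [← ENNReal.ofReal_toReal (hfin hlu).ne]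
    refine ENNReal.ofReal_le_ofReal ?_
    rw [hM, M0]
    have := le_max_left (eLpNorm (u t) p volume).toReal (eLpNorm (v t) p volume).toReal
    linarith
  have hvb : eLpNorm (v t) p volume ≤ ENNReal.ofReal (M / 2) := by
    rw [← ENNReal.ofReal_toReal (hfin hlv).ne]
    refine ENNReal.ofReal_le_ofReal ?_
    rw [hM, M0]
    have := le_max_right (eLpNorm (u t) p volume).toReal (eLpNorm (v t) p volume).toReal
    linarith
  have hM0 : 0 ≤ M := by
    rw [hM, M0]
    have := le_max_left (eLpNorm (u t) p volume).toReal (eLpNorm (v t) p volume).toReal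
    have : 0 ≤ (eLpNorm (u t) p volume).toReal := ENNReal.toReal_nonneg
    linarith
  have hwb : eLpNorm ((u - v) t) p volume ≤ ENNReal.ofReal M := by
    refine (eLpNorm_sub_le hut hvt hp1).trans ((add_le_add hub hvb).trans ?_)
    rw [← ENNReal.ofReal_add (by linarith) (by linarith)]
    exact ENNReal.ofReal_le_ofReal (by linarith)
  -- The lower bound at time `t` itself forces `M > 0`, and through `t^c ≤ H` it gives `D ≤ 1/(4 CB
  -- M)` below.
  have hc₂M : c₂ ≤ M * t ^ c := by
    have h1 := (hlow t ht).trans (mul_le_mul_left hwb _)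
    rw [← ENNReal.ofReal_mul hM0] at h1
    exact (ENNReal.ofReal_le_ofReal_iff (by positivity)).1 h1
  have hMpos : 0 < M := by
    rcases hM0.eq_or_lt with h0 | h0
    · rw [← h0, zero_mul] at hc₂M; linarith
    · exact h0
  set H := horizon p ct M t with hH
  have hHe : H = (4 * ct * M ^ (-c⁻¹) + t) ^ c := by
    rw [hH, horizon, three_mul_inv_toReal_sub_one]
    rw [← hcd]
    congr 4
    field_simp
  have hHpos : 0 < H := by rw [hHe]; positivity
  have htH : t ^ c ≤ H := by
    rw [hHe]
    exact Real.rpow_le_rpow ht.le (by have : 0 < 4 * ct * M ^ (-c⁻¹) := by positivity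
                                      linarith) hc.le
  have hc₂H : c₂ ≤ M * H := hc₂M.trans (by gcongr)
  set D : ℝ := c₂ / (4 * M ^ 2 * CB * H) with hD
  have hDpos : 0 < D := by positivity
  have hDle : D ≤ (4 * CB * M)⁻¹ := by
    rw [hD, div_le_iff₀ (by positivity)]
    calc c₂ ≤ M * H := hc₂H
      _ = _ := by field_simp
  -- The largest step, up to `κ`, for which the nonlinear term `4 C₁ τ^c M²` stays below `c₂/(4H)`.
  set τ : ℝ := κ * D ^ c⁻¹ with hτd
  have hτ : 0 < τ := by positivity
  have hτc : τ ^ c = κ ^ c * D := by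
    rw [hτd, Real.mul_rpow hκ.le (by positivity), ← Real.rpow_mul hDpos.le, inv_mul_cancel₀ hc.ne',
      Real.rpow_one]
  have hτM : τ ≤ 4 * ct * M ^ (-c⁻¹) := by
    calc τ ≤ 4 * ct * (4 * CB) ^ c⁻¹ * ((4 * CB * M)⁻¹) ^ c⁻¹ := by
          rw [hτd]; gcongr
      _ = _ := by
          rw [Real.inv_rpow (by positivity), Real.mul_rpow (by positivity) hMpos.le, Real.rpow_neg hMpos.le]
          field_simp
  have htτ : (t + τ) ^ c ≤ H := by
    rw [hHe]; exact Real.rpow_le_rpow (by positivity) (by linarith) hc.le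
  have hsmall : 16 * C₁ * τ ^ c * (M / 2) ≤ 1 := by
    rw [hτc]
    calc 16 * C₁ * (κ ^ c * D) * (M / 2) = (4 * C₁ * κ ^ c) * (2 * D * M) := by ring
      _ ≤ CB * (2 * (4 * CB * M)⁻¹ * M) := by gcongr
      _ = 1 / 2 := by field_simp; norm_num
      _ ≤ 1 := by norm_num
  have hpu := exists_persistence hp hC₁ hbil' hu hlu ht (by linarith : 0 < M / 2) hub hsmall
  have hpv := exists_persistence hp hC₁ hbil' hv hlv ht (by linarith : 0 < M / 2) hvb hsmall
  have e2 : 2 * (M / 2) = M := by ring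
  rw [e2] at hpu hpv
  have hpu' : ∀ s ∈ Ioo t (t + τ), eLpNorm (u s) p volume ≤ ENNReal.ofReal M := fun s hs => by
    simpa using hpu (s - t) (by linarith [hs.1]) (by linarith [hs.2])
  have hpv' : ∀ s ∈ Ioo t (t + τ), eLpNorm (v s) p volume ≤ ENNReal.ofReal M := fun s hs => by
    simpa using hpv (s - t) (by linarith [hs.1]) (by linarith [hs.2])
  have hnl := hbil' ∞ u v hu hv t τ M (2 * M) ht hτ ENNReal.ofReal_lt_top hMpos (by positivity)
    hpu' hpv' (fun s hs => by
      have hs0 : 0 < s := ht.trans hs.1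
      refine (eLpNorm_sub_le (hu.slice s hs0 ENNReal.ofReal_lt_top)
        (hv.slice s hs0 ENNReal.ofReal_lt_top) hp1).trans
        ((add_le_add (hpu' s hs) (hpv' s hs)).trans ?_)
      rw [← ENNReal.ofReal_add hM0 hM0, two_mul])
  have hnl' : eLpNorm (fun x => (u - v) (t + τ) x - heat τ ((u - v) t) x) p volume ≤
      ENNReal.ofReal (c₂ / (4 * H)) := by
    refine hnl.trans (ENNReal.ofReal_le_ofReal ?_)
    rw [hτc]
    calc C₁ * (κ ^ c * D) * (2 * M * (2 * M)) = (4 * C₁ * κ ^ c) * (D * M ^ 2) := by ring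
      _ ≤ CB * (D * M ^ 2) := by gcongr
      _ = c₂ / (4 * H) := by rw [hD]; field_simp
  have hinv : invScale p ct CB c₂ M t = 4 * M * H / c₂ * D ^ (-(2 * c)⁻¹) := by
    rw [invScale, three_mul_inv_toReal_sub_one, ← hH, ← hD, ← hcd, one_div, inv_neg]
  rw [hinv] at hh
  -- The prescribed value of `1 / h` is positive, which excludes `h ≤ 0`, including `1 / 0 = 0`.
  have hhpos : 0 < h := by
    rw [← one_div_pos, hh]; positivity
  have hhe : h * τ ^ (-(1 / 2) : ℝ) * M * (C₃ + 1) = c₂ / (4 * H) := by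
    have e3 : τ ^ (-(1 / 2) : ℝ) = κ ^ (-(1 / 2) : ℝ) * D ^ (-(2 * c)⁻¹) := by
      rw [hτd, Real.mul_rpow hκ.le (by positivity), ← Real.rpow_mul hDpos.le]
      congr 2; field_simp
    rw [e3]
    have h1 : h * ((C₃ + 1) * κ ^ (-(1 / 2) : ℝ) * (4 * M * H / c₂ * D ^ (-(2 * c)⁻¹))) = 1 := by
      rw [← hh]; field_simp
    have h2 : h * (κ ^ (-(1 / 2) : ℝ) * D ^ (-(2 * c)⁻¹)) * M * (C₃ + 1) =
        h * ((C₃ + 1) * κ ^ (-(1 / 2) : ℝ) * (4 * M * H / c₂ * D ^ (-(2 * c)⁻¹))) * (c₂ / (4 * H)) := by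
      field_simp
    rw [h2, h1, one_mul]
  have hwm : MemLp ((u - v) t) p volume :=
    ⟨hu.aestronglyMeasurable_sub hv ht ENNReal.ofReal_lt_top, hwb.trans_lt ENNReal.ofReal_lt_top⟩
  have hwint : ∀ᵐ x, Integrable fun y => heatKernel τ (x - y) • (u - v) t y := by
    obtain ⟨f, -, -, hf⟩ := hu.exists_interaction hv
    exact (hf t τ ht hτ ENNReal.ofReal_lt_top).mono fun x hx => hx.1
  have hstep := eLpNorm_le_of_heat_step hp1 hC₃' hτ hhpos hwm
    (hu.aestronglyMeasurable_sub hv (by linarith : 0 < t + τ) ENNReal.ofReal_lt_top)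
    hwint
  have hmid : ((C₃ + 1 : ℝ≥0) : ℝ≥0∞) * ENNReal.ofReal (h * τ ^ (-(1 / 2) : ℝ)) *
      eLpNorm ((u - v) t) p volume ≤ ENNReal.ofReal (c₂ / (4 * H)) := by
    rw [← hhe, ← ENNReal.ofReal_coe_nnreal, ← ENNReal.ofReal_mul (by positivity)]
    refine (mul_le_mul_right hwb _).trans ?_
    rw [← ENNReal.ofReal_mul (by positivity)]
    refine ENNReal.ofReal_le_ofReal (le_of_eq ?_)
    push_cast; ring
  rcases eq_or_ne (eLpNorm (cubeAverage h ((u - v) t)) p volume) ∞ with hJ | hJ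
  · rw [hJ]; exact le_top
  rw [← ENNReal.ofReal_toReal hJ] at hstep ⊢
  set j := (eLpNorm (cubeAverage h ((u - v) t)) p volume).toReal
  have hj : 0 ≤ j := ENNReal.toReal_nonneg
  have hfinal : c₂ ≤ (c₂ / (4 * H) + c₂ / (4 * H) + j) * H := by
    have h1 := hlow (t + τ) (by linarith)
    have h2 : eLpNorm ((u - v) (t + τ)) p volume ≤
        ENNReal.ofReal (c₂ / (4 * H) + c₂ / (4 * H) + j) := by
      rw [ENNReal.ofReal_add (by positivity) hj, ENNReal.ofReal_add (by positivity) (by positivity)]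
      exact hstep.trans (add_le_add (add_le_add hnl' hmid) le_rfl)
    have h3 := h1.trans (mul_le_mul' h2 (ENNReal.ofReal_le_ofReal htτ))
    rw [← ENNReal.ofReal_mul (by positivity)] at h3
    exact (ENNReal.ofReal_le_ofReal_iff (by positivity)).1 h3
  have hjl : c₂ / (2 * H) ≤ j := by
    rw [div_le_iff₀ (by positivity)]
    have : (c₂ / (4 * H) + c₂ / (4 * H) + j) * H = c₂ / 2 + j * H := by field_simp; ring
    rw [this] at hfinal
    linarith
  have hγ' : 0 ≤ γ := by rw [hγ, gammaFrac, ← hH]; positivity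
  refine (mul_le_mul_right hwb _).trans ?_
  rw [← ENNReal.ofReal_mul (by positivity)]
  refine ENNReal.ofReal_le_ofReal (le_trans ?_ hjl)
  rw [hγ, gammaFrac, ← hH]
  rw [div_div, div_mul_eq_mul_div, div_le_div_iff₀ (by positivity) (by positivity)]
  have : 0 < c₂ * M * H := by positivity
  nlinarith


/-! ### Passage to the initial time in Duhamel's formula -/

/-- On a compact interval of times, the first factor is largest at the right end and the second at
the left end; this gives one dominating function for all the kernels involved. -/
theorem heatKernel_le_kmaj {τ : ℝ} (hτ : 0 < τ) (z : E3) :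
    heatKernel τ z ≤ kC * √τ * ((τ + ‖z‖ ^ 2) ^ 2)⁻¹ := by
  have hk := kC_pos
  have h := heatKernel_le_similarity hτ z
  rw [rpow_neg_three_halves hτ] at h
  refine h.trans ?_
  have hs := Real.sqrt_pos.2 hτ
  have hsq : τ = √τ ^ 2 := (Real.sq_sqrt hτ.le).symm
  have hz : ‖z‖ ^ 2 = τ * (‖z‖ ^ 2 / τ) := by field_simp
  set a := ‖z‖ ^ 2 / τ
  have ha : 0 ≤ a := by positivity
  have e : τ + ‖z‖ ^ 2 = √τ ^ 2 * (1 + a) := by rw [hz, ← hsq]; ring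
  rw [e]
  calc (√τ)⁻¹ ^ 3 * (kC / (1 + a) ^ 5) ≤ (√τ)⁻¹ ^ 3 * (kC / (1 + a) ^ 2) := by
        gcongr
        · linarith
        · norm_num
    _ = _ := by field_simp

/-- Near the origin `1/|y|` is integrable in dimension three; away from it the majorant is
integrable by itself. -/
theorem integrable_kmaj_div_norm {σ : ℝ} (hσ : 0 < σ) (x : E3) :
    Integrable fun y : E3 => ((σ + ‖x - y‖ ^ 2) ^ 2)⁻¹ * ‖y‖⁻¹ := by
  have hm : AEStronglyMeasurable (fun y : E3 => ((σ + ‖x - y‖ ^ 2) ^ 2)⁻¹ * ‖y‖⁻¹) volume :=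
    Measurable.aestronglyMeasurable (by fun_prop)
  have hi : Integrable fun y : E3 => ((σ + ‖x - y‖ ^ 2) ^ 2)⁻¹ := by
    obtain ⟨C, hC⟩ := exists_lintegral_kmaj_le
    refine ⟨Measurable.aestronglyMeasurable (by fun_prop), ?_⟩
    rw [hasFiniteIntegral_iff_enorm]
    have : ∀ y : E3, ‖((σ + ‖x - y‖ ^ 2) ^ 2)⁻¹‖ₑ = kmaj σ (x - y) := fun y =>
      Real.enorm_of_nonneg (by positivity)
    simp_rw [this]
    rw [lintegral_sub_left_eq_self (fun y => kmaj σ y) x]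
    exact (hC σ hσ).trans_lt (ENNReal.mul_lt_top ENNReal.coe_lt_top ENNReal.ofReal_lt_top)
  have h1 : IntegrableOn (fun y : E3 => ‖y‖⁻¹) (Metric.ball 0 1) := by
    refine (integrableOn_fun_norm_addHaar (volume : Measure E3) (f := fun r : ℝ => r⁻¹)).2 ?_
    have : IntegrableOn (fun r : ℝ => r) (Ioo 0 1) :=
      (continuous_id.integrableOn_Icc (a := (0 : ℝ)) (b := 1)).mono_set Ioo_subset_Icc_self
    refine this.congr_fun (fun r hr => ?_) measurableSet_Ioo
    have := hr.1.ne'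
    simp
    field_simp
  have h2 : IntegrableOn (fun y : E3 => ((σ + ‖x - y‖ ^ 2) ^ 2)⁻¹ * ‖y‖⁻¹) (Metric.ball 0 1) := by
    refine Integrable.mono' (h1.const_mul ((σ ^ 2)⁻¹)) hm.restrict (Eventually.of_forall fun y => ?_)
    rw [Real.norm_of_nonneg (by positivity)]
    gcongr
    linarith [sq_nonneg ‖x - y‖]
  have h3 : IntegrableOn (fun y : E3 => ((σ + ‖x - y‖ ^ 2) ^ 2)⁻¹ * ‖y‖⁻¹) (Metric.ball 0 1)ᶜ := by
    refine Integrable.mono' hi.integrableOn hm.restrict ?_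
    filter_upwards [ae_restrict_mem measurableSet_ball.compl] with y hy
    rw [Real.norm_of_nonneg (by positivity)]
    have : 1 ≤ ‖y‖ := by simpa using hy
    exact mul_le_of_le_one_right (by positivity) (inv_le_one_of_one_le₀ this)
  have := h2.union h3
  rwa [union_compl_self, integrableOn_univ] at this

theorem contDiff_heatKernel_sub (t : ℝ) (x : E3) (n : ℕ∞) :
    ContDiff ℝ n fun y => heatKernel t (x - y) := by
  have h : ContDiff ℝ n fun y : E3 => -‖x - y‖ ^ 2 / (4 * t) :=
    (((contDiff_const.sub contDiff_id).norm_sq ℝ).neg).div_const _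
  exact contDiff_const.mul h.exp

/-- Truncation of the heat kernel to a test function. -/
def truncatedHeat (t : ℝ) (x : E3) (χ : ContDiffBump (0 : E3)) :
    𝓓((⊤ : TopologicalSpace.Opens E3), ℝ) where
  toFun y := χ y * heatKernel t (x - y)
  contDiff' := χ.contDiff.mul (contDiff_heatKernel_sub t x _)
  hasCompactSupport' := χ.hasCompactSupport.mul_right
  tsupport_subset' := by simp

theorem continuousAt_heatKernel_time {t : ℝ} (ht : 0 < t) (z : E3) :
    ContinuousAt (fun τ => heatKernel τ z) t := by
  unfold heatKernel
  have h1 : ContinuousAt (fun τ : ℝ => (4 * Real.pi * τ) ^ (-(3 / 2) : ℝ)) t :=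
    ContinuousAt.rpow_const (by fun_prop) (Or.inl (by positivity))
  have h2 : ContinuousAt (fun τ : ℝ => -‖z‖ ^ 2 / (4 * τ)) t :=
    ContinuousAt.div (by fun_prop) (by fun_prop) (by positivity)
  exact h1.mul h2.rexp

/-- Fields that vanish in the limit in the sense of distributions, with a uniform bound `c₁/|y|`,
vanish in the limit after application of the heat semigroup. -/
theorem tendsto_heat_of_tendsto_distribution {c₁ : ℝ} (hc₁ : 0 < c₁) {w : ℕ → E3 → E3}
    (hw : ∀ n, AEStronglyMeasurable (w n) volume) (hb : ∀ n, ∀ᵐ y, ‖w n y‖ ≤ c₁ * ‖y‖⁻¹)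
    (hφ : ∀ φ : 𝓓((⊤ : TopologicalSpace.Opens E3), ℝ),
      Tendsto (fun n => ∫ y, φ y • w n y) atTop (𝓝 0))
    {τ : ℕ → ℝ} {t : ℝ} (ht : 0 < t) (hτ : Tendsto τ atTop (𝓝 t)) (x : E3) :
    Tendsto (fun n => heat (τ n) (w n) x) atTop (𝓝 0) := by
  have hk := kC_pos
  have hGm : ∀ s, Measurable fun y => heatKernel s (x - y) := fun s =>
    (measurable_heatKernel_slice s).comp (measurable_const.sub measurable_id)
  have hGb : ∀ s ∈ Icc (t / 2) (2 * t), ∀ y, heatKernel s (x - y) ≤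
      kC * √(2 * t) * ((t / 2 + ‖x - y‖ ^ 2) ^ 2)⁻¹ := by
    intro s hs y
    have hs0 : 0 < s := by linarith [hs.1]
    refine (heatKernel_le_kmaj hs0 _).trans ?_
    gcongr
    · exact hs.2
    · exact hs.1
  set m : E3 → ℝ := fun y => c₁ * (kC * √(2 * t)) * (((t / 2 + ‖x - y‖ ^ 2) ^ 2)⁻¹ * ‖y‖⁻¹) with hm
  have hmi : Integrable m := (integrable_kmaj_div_norm (by positivity) x).const_mul _
  have hgm : ∀ s ∈ Icc (t / 2) (2 * t), ∀ y, heatKernel s (x - y) * (c₁ * ‖y‖⁻¹) ≤ m y := by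
    intro s hs y
    calc _ ≤ (kC * √(2 * t) * ((t / 2 + ‖x - y‖ ^ 2) ^ 2)⁻¹) * (c₁ * ‖y‖⁻¹) := by
          gcongr; exact hGb s hs y
      _ = m y := by rw [hm]; ring
  have htI : t ∈ Icc (t / 2) (2 * t) := ⟨by linarith, by linarith⟩
  have hτI : ∀ᶠ n in atTop, τ n ∈ Icc (t / 2) (2 * t) :=
    hτ.eventually (Icc_mem_nhds (by linarith) (by linarith))
  have hgi : ∀ s ∈ Icc (t / 2) (2 * t), Integrable fun y => heatKernel s (x - y) * (c₁ * ‖y‖⁻¹) := by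
    intro s hs
    refine hmi.mono' ((hGm s).mul (by fun_prop)).aestronglyMeasurable (Eventually.of_forall fun y => ?_)
    rw [Real.norm_of_nonneg (mul_nonneg (heatKernel_nonneg (by linarith [hs.1]) _) (by positivity))]
    exact hgm s hs y
  -- Two replacements in the weighted space `L¹(c₁|y|⁻¹ dy)`: the kernel at time `τ n` by the one at
  -- time `t`, then that one by a compactly supported truncation. Both errors are uniform over the
  -- fields considered.
  have hA : Tendsto (fun n => ∫ y, |heatKernel (τ n) (x - y) - heatKernel t (x - y)| * (c₁ * ‖y‖⁻¹))
      atTop (𝓝 0) := by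
    rw [← integral_zero E3 ℝ (μ := volume)]
    refine tendsto_integral_filter_of_dominated_convergence (fun y => 2 * m y)
      (Eventually.of_forall fun n => Measurable.aestronglyMeasurable ?_) ?_ (hmi.const_mul 2)
      (Eventually.of_forall fun y => ?_)
    · exact (((hGm (τ n)).sub (hGm t)).abs).mul (by fun_prop)
    · filter_upwards [hτI] with n hn
      refine Eventually.of_forall fun y => ?_
      rw [Real.norm_of_nonneg (by positivity)]
      have h1 := hgm _ hn y
      have h2 := hgm _ htI y
      have h3 := heatKernel_nonneg (by linarith [hn.1] : 0 ≤ τ n) (x - y)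
      have h4 := heatKernel_nonneg ht.le (x - y)
      have h5 : |heatKernel (τ n) (x - y) - heatKernel t (x - y)| ≤
          heatKernel (τ n) (x - y) + heatKernel t (x - y) := by
        rw [abs_le]; constructor <;> linarith
      calc _ ≤ (heatKernel (τ n) (x - y) + heatKernel t (x - y)) * (c₁ * ‖y‖⁻¹) := by gcongr
        _ ≤ _ := by linarith
    · have h1 : Tendsto (fun n => heatKernel (τ n) (x - y)) atTop (𝓝 (heatKernel t (x - y))) :=
        (continuousAt_heatKernel_time ht (x - y)).tendsto.comp hτ
      have h2 := ((h1.sub_const (heatKernel t (x - y))).abs).mul_const (c₁ * ‖y‖⁻¹)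
      simpa using h2
  set χ : ℕ → ContDiffBump (0 : E3) := fun k => ⟨k + 1, k + 2, by positivity, by linarith⟩ with hχ
  have hB : Tendsto (fun k => ∫ y, |heatKernel t (x - y) - truncatedHeat t x (χ k) y| * (c₁ * ‖y‖⁻¹))
      atTop (𝓝 0) := by
    rw [← integral_zero E3 ℝ (μ := volume)]
    refine tendsto_integral_of_dominated_convergence m (fun k => Measurable.aestronglyMeasurable ?_)
      hmi (fun k => Eventually.of_forall fun y => ?_) (Eventually.of_forall fun y => ?_)
    · exact (((hGm t).sub ((χ k).continuous.measurable.mul (hGm t))).abs).mul (by fun_prop)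
    · rw [Real.norm_of_nonneg (by positivity)]
      refine le_trans ?_ (hgm t htI y)
      have h4 := heatKernel_nonneg ht.le (x - y)
      have h5 : |heatKernel t (x - y) - truncatedHeat t x (χ k) y| ≤ heatKernel t (x - y) := by
        change |heatKernel t (x - y) - χ k y * heatKernel t (x - y)| ≤ _
        have h6 := (χ k).nonneg (x := y)
        have h7 := (χ k).le_one (x := y)
        rw [abs_le]; constructor <;> nlinarith
      gcongr
    · refine tendsto_const_nhds.congr' ?_
      obtain ⟨K, hK⟩ := exists_nat_ge ‖y‖
      filter_upwards [eventually_ge_atTop K] with k hk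
      have : χ k y = 1 := by
        refine (χ k).one_of_mem_closedBall ?_
        rw [mem_closedBall_zero_iff]
        change ‖y‖ ≤ (k : ℝ) + 1
        have : (K : ℝ) ≤ k := by exact_mod_cast hk
        linarith
      change 0 = |heatKernel t (x - y) - χ k y * heatKernel t (x - y)| * (c₁ * ‖y‖⁻¹)
      rw [this]; simp
  rw [Metric.tendsto_atTop]
  intro ε hε
  obtain ⟨k, hk⟩ := (hB.eventually (gt_mem_nhds (by positivity : 0 < ε / 3))).exists
  have h1 := hA.eventually (gt_mem_nhds (by positivity : 0 < ε / 3))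
  have h2 := (hφ (truncatedHeat t x (χ k))).norm.eventually
    (gt_mem_nhds (by simpa using (by positivity : 0 < ε / 3) : ‖(0 : E3)‖ < ε / 3))
  obtain ⟨N, hN⟩ := eventually_atTop.1 (hτI.and (h1.and h2))
  refine ⟨N, fun n hn => ?_⟩
  obtain ⟨hnI, hn1, hn2⟩ := hN n hn
  rw [dist_zero_right]
  set φ := truncatedHeat t x (χ k) with hφd
  have hφm : Measurable fun y => φ y := (χ k).continuous.measurable.mul (hGm t)
  have hφle : ∀ y, ‖φ y‖ ≤ heatKernel t (x - y) := fun y => by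
    change ‖χ k y * heatKernel t (x - y)‖ ≤ _
    rw [norm_mul, Real.norm_of_nonneg (χ k).nonneg, Real.norm_of_nonneg (heatKernel_nonneg ht.le _)]
    exact mul_le_of_le_one_left (heatKernel_nonneg ht.le _) (χ k).le_one
  have iφ : Integrable fun y => φ y • w n y := by
    refine (hgi t htI).mono' (hφm.aestronglyMeasurable.smul (hw n)) ?_
    filter_upwards [hb n] with y hy
    rw [norm_smul]
    exact mul_le_mul (hφle y) hy (norm_nonneg _) (heatKernel_nonneg ht.le _)
  have iτ : Integrable fun y => heatKernel (τ n) (x - y) • w n y := by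
    refine (hgi _ hnI).mono' ((hGm _).aestronglyMeasurable.smul (hw n)) ?_
    have h3 : ∀ y, 0 ≤ heatKernel (τ n) (x - y) := fun y =>
      heatKernel_nonneg (by linarith [hnI.1] : 0 ≤ τ n) (x - y)
    filter_upwards [hb n] with y hy
    rw [norm_smul, Real.norm_of_nonneg (h3 y)]
    exact mul_le_mul_of_nonneg_left hy (h3 y)
  have hIA : Integrable fun y => |heatKernel (τ n) (x - y) - heatKernel t (x - y)| * (c₁ * ‖y‖⁻¹) := by
    refine ((hgi _ hnI).sub (hgi t htI)).abs.congr (Eventually.of_forall fun y => ?_)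
    simp only [Pi.sub_apply]
    rw [← sub_mul, abs_mul, abs_of_nonneg (by positivity : 0 ≤ c₁ * ‖y‖⁻¹)]
  have hIB : Integrable fun y => |heatKernel t (x - y) - φ y| * (c₁ * ‖y‖⁻¹) := by
    have : Integrable fun y => φ y * (c₁ * ‖y‖⁻¹) := by
      refine (hgi t htI).mono' (hφm.mul (by fun_prop)).aestronglyMeasurable
        (Eventually.of_forall fun y => ?_)
      rw [norm_mul, Real.norm_of_nonneg (by positivity : 0 ≤ c₁ * ‖y‖⁻¹)]
      gcongr
      exact hφle y
    refine ((hgi t htI).sub this).abs.congr (Eventually.of_forall fun y => ?_)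
    simp only [Pi.sub_apply]
    rw [← sub_mul, abs_mul, abs_of_nonneg (by positivity : 0 ≤ c₁ * ‖y‖⁻¹)]
  have e : heat (τ n) (w n) x = (∫ y, φ y • w n y) +
      ∫ y, (heatKernel (τ n) (x - y) • w n y - φ y • w n y) := by
    rw [integral_sub iτ iφ, heat]; abel
  have hlast : ‖∫ y, (heatKernel (τ n) (x - y) • w n y - φ y • w n y)‖ ≤
      ∫ y, (|heatKernel (τ n) (x - y) - heatKernel t (x - y)| * (c₁ * ‖y‖⁻¹) +
        |heatKernel t (x - y) - φ y| * (c₁ * ‖y‖⁻¹)) := by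
    refine norm_integral_le_of_norm_le (hIA.add hIB) ?_
    filter_upwards [hb n] with y hy
    rw [← sub_smul, norm_smul, Real.norm_eq_abs, ← add_mul]
    exact mul_le_mul (abs_sub_le _ _ _) hy (norm_nonneg _) (by positivity)
  rw [integral_add hIA hIB] at hlast
  rw [e]
  refine (norm_add_le _ _).trans_lt ?_
  linarith


theorem CenteredTypeI.norm_difference_le {T : ℝ≥0∞} {c₁ : ℝ} {u v : ℝ → E3 → E3}
    (h : CenteredTypeI T c₁ u v) {t : ℝ} (ht : 0 < t) (hT : ENNReal.ofReal t < T) :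
    ∀ᵐ x, ‖(u - v) t x‖ ≤ c₁ / (‖x‖ + √t) := by
  filter_upwards [h t ht hT] with x hx
  exact (norm_sub_le _ _).trans hx

theorem duhamelPotential_le_of_shift {f : ℝ × E3 → ℝ≥0∞} {t₀ t : ℝ} (h0 : 0 ≤ t₀) (x : E3) :
    duhamelPotential f t₀ (t - t₀) x ≤ duhamelPotential f 0 t x := by
  have h := (measurePreserving_add_left (volume : Measure ℝ) t₀).setLIntegral_comp_preimage_emb
    (MeasurableEquiv.addLeft t₀).measurableEmbedding
    (fun s => ∫⁻ y, kmaj (t - s) (x - y) * f (s, y)) (Ioo t₀ t)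
  have hs : (fun s => t₀ + s) ⁻¹' Ioo t₀ t = Ioo 0 (t - t₀) := by
    ext s; simp [lt_sub_iff_add_lt']
  rw [hs] at h
  simp only [duhamelPotential, zero_add]
  have e : ∀ s, t - t₀ - s = t - (t₀ + s) := fun s => by ring
  simp_rw [e]
  rw [h]
  exact lintegral_mono_set (Ioo_subset_Ioo_left h0)

/-- Two mild solutions with the same data and a centered Type I bound: the difference is dominated
by a Duhamel potential starting at the initial time. -/
theorem enorm_sub_le_duhamelPotential {T : ℝ≥0∞} {c₁ : ℝ} (hc₁ : 0 < c₁)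
    {U₀ : 𝓓((⊤ : TopologicalSpace.Opens E3), ℝ) → E3} {u v : ℝ → E3 → E3}
    (hu : IsMildSolution T U₀ u) (hv : IsMildSolution T U₀ v) (hI : CenteredTypeI T c₁ u v)
    {f : ℝ × E3 → ℝ≥0∞}
    (hf : ∀ t τ, 0 < t → 0 < τ → ENNReal.ofReal (t + τ) < T → ∀ᵐ x,
        Integrable (fun y => heatKernel τ (x - y) • (u - v) t y) ∧
        ‖(u - v) (t + τ) x - heat τ ((u - v) t) x‖ₑ ≤
          ENNReal.ofReal (36 * kC) * duhamelPotential f t τ x)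
    {t : ℝ} (ht : 0 < t) (hT : ENNReal.ofReal t < T) :
    ∀ᵐ x, ‖(u - v) t x‖ₑ ≤ ENNReal.ofReal (36 * kC) * duhamelPotential f 0 t x := by
  -- A sequence of starting times, so that the exceptional null sets can be united; the shift by two
  -- keeps `r n < t` already at `n = 0`.
  set r : ℕ → ℝ := fun n => t / (n + 2) with hr
  have hr0 : ∀ n, 0 < r n := fun n => by positivity
  have hrt : ∀ n, r n < t := fun n => by
    rw [hr]
    exact div_lt_self ht (by have : (0 : ℝ) ≤ n := n.cast_nonneg
                             linarith)
  have hlim : Tendsto r atTop (𝓝 0) :=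
    Tendsto.div_atTop tendsto_const_nhds
      (tendsto_atTop_add_const_right _ _ tendsto_natCast_atTop_atTop)
  have hTr : ∀ n, ENNReal.ofReal (r n) < T := fun n =>
    (ENNReal.ofReal_le_ofReal (hrt n).le).trans_lt hT
  have hlimw : Tendsto r atTop (𝓝[>] 0) :=
    tendsto_nhdsWithin_iff.2 ⟨hlim, Eventually.of_forall hr0⟩
  have hφ : ∀ φ : 𝓓((⊤ : TopologicalSpace.Opens E3), ℝ),
      Tendsto (fun n => ∫ y, φ y • (u - v) (r n) y) atTop (𝓝 0) := by
    intro φ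
    have h := ((hu.initial φ).comp hlimw).sub ((hv.initial φ).comp hlimw)
    rw [sub_self] at h
    refine h.congr fun n => ?_
    have hφc : Continuous φ := φ.contDiff.continuous
    have i1 := (hu.locallyIntegrable _ (hr0 n) (hTr n)).integrable_smul_left_of_hasCompactSupport
      hφc φ.hasCompactSupport
    have i2 := (hv.locallyIntegrable _ (hr0 n) (hTr n)).integrable_smul_left_of_hasCompactSupport
      hφc φ.hasCompactSupport
    simp only [Function.comp]
    rw [← integral_sub i1 i2]
    simp [smul_sub]
  have hb : ∀ n, ∀ᵐ y, ‖(u - v) (r n) y‖ ≤ c₁ * ‖y‖⁻¹ := fun n => by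
    have hne : ∀ᵐ y : E3, y ≠ 0 := by
      rw [ae_iff]; simp
    filter_upwards [hI.norm_difference_le (hr0 n) (hTr n), hne] with y hy hy0
    refine hy.trans ?_
    have : 0 < ‖y‖ := norm_pos_iff.2 hy0
    rw [div_eq_mul_inv]
    gcongr
    linarith [Real.sqrt_nonneg (r n)]
  have hτ : Tendsto (fun n => t - r n) atTop (𝓝 t) := by simpa using hlim.const_sub t
  have hheat := tendsto_heat_of_tendsto_distribution hc₁
    (w := fun n => (u - v) (r n))
    (fun n => hu.isDuhamelFlow.aestronglyMeasurable_sub hv.isDuhamelFlow (hr0 n) (hTr n))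
    hb hφ ht hτ
  have hall : ∀ᵐ x, ∀ n, ‖(u - v) t x - heat (t - r n) ((u - v) (r n)) x‖ₑ ≤
      ENNReal.ofReal (36 * kC) * duhamelPotential f 0 t x := by
    rw [ae_all_iff]
    intro n
    have := hf (r n) (t - r n) (hr0 n) (by linarith [hrt n]) (by rwa [add_sub_cancel])
    rw [add_sub_cancel] at this
    filter_upwards [this] with x hx
    exact hx.2.trans (mul_le_mul_right (duhamelPotential_le_of_shift (hr0 n).le x) _)
  filter_upwards [hall] with x hx
  have h1 : Tendsto (fun n => ‖(u - v) t x - heat (t - r n) ((u - v) (r n)) x‖ₑ) atTop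
      (𝓝 ‖(u - v) t x - 0‖ₑ) :=
    (continuous_enorm.tendsto _).comp ((hheat x).const_sub ((u - v) t x))
  rw [sub_zero] at h1
  exact le_of_tendsto' h1 hx

/-! ### Norms of the Type I weight and the `L²` bound on the difference -/

/-- The weight `(|y| + √s)⁻¹`. -/
def centeredWeight (s : ℝ) (y : E3) : ℝ := (‖y‖ + √s)⁻¹

theorem measurable_centeredWeight (s : ℝ) : Measurable (centeredWeight s) := by
  unfold centeredWeight; fun_prop

theorem centeredWeight_nonneg (s : ℝ) (y : E3) : 0 ≤ centeredWeight s y := by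
  unfold centeredWeight; positivity

theorem exists_lintegral_centeredWeight_rpow_le {a : ℝ} (ha : 3 < a) :
    ∃ C : ℝ, 0 < C ∧ ∀ s : ℝ, 0 < s → ∫⁻ y, ENNReal.ofReal (centeredWeight s y ^ a) ≤
      ENNReal.ofReal (C * s ^ (3 / 2 - a / 2)) := by
  have hfin := finite_integral_one_add_norm (E := E3) (μ := volume) (r := a) (by simpa using ha)
  refine ⟨(∫⁻ x : E3, ENNReal.ofReal ((1 + ‖x‖) ^ (-a))).toReal + 1, by positivity, fun s hs => ?_⟩
  have hs' := Real.sqrt_pos.2 hs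
  rw [lintegral_scale _ hs']
  have key : ∀ x : E3, ENNReal.ofReal (centeredWeight s (√s • x) ^ a) =
      ENNReal.ofReal (√s ^ (-a)) * ENNReal.ofReal ((1 + ‖x‖) ^ (-a)) := by
    intro x
    rw [← ENNReal.ofReal_mul (by positivity), ← Real.mul_rpow hs'.le (by positivity),
      centeredWeight, norm_smul, Real.norm_of_nonneg hs'.le, Real.rpow_neg (by positivity),
      Real.inv_rpow (by positivity)]
    congr 3; ring
  simp_rw [key]
  rw [lintegral_const_mul _ (by fun_prop), ← mul_assoc, ← ENNReal.ofReal_mul (by positivity),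
    ← ENNReal.ofReal_toReal hfin.ne, ← ENNReal.ofReal_mul (by positivity)]
  refine ENNReal.ofReal_le_ofReal ?_
  rw [ENNReal.toReal_ofReal ENNReal.toReal_nonneg, mul_comm]
  have e : √s ^ 3 * √s ^ (-a) = s ^ (3 / 2 - a / 2) := by
    rw [Real.sqrt_eq_rpow, ← Real.rpow_natCast, ← Real.rpow_mul hs.le, ← Real.rpow_mul hs.le,
      ← Real.rpow_add hs]
    congr 1; push_cast; ring
  rw [e]
  gcongr
  linarith

/-- Parabolic scaling fixes the rate, and `p > 3` is integrability at infinity. The rate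
`s^{-critExp p}` is the one that the uniqueness iteration reproduces. -/
theorem exists_eLpNorm_centeredWeight_le {p : ℝ≥0∞} (hp : 3 < p) :
    ∃ B : ℝ, 0 < B ∧ ∀ s : ℝ, 0 < s →
      eLpNorm (centeredWeight s) p volume ≤ ENNReal.ofReal (B * s ^ (-critExp p)) := by
  have hp1 : 1 ≤ p := le_trans (by norm_num) hp.le
  by_cases hpt : p = ∞
  · subst hpt
    refine ⟨1, one_pos, fun s hs => ?_⟩
    rw [eLpNorm_exponent_top]
    refine eLpNormEssSup_le_of_ae_bound (Eventually.of_forall fun y => ?_)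
    rw [Real.norm_of_nonneg (centeredWeight_nonneg s y), centeredWeight, critExp, one_mul]
    simp only [ENNReal.inv_top, ENNReal.toReal_zero, mul_zero, sub_zero]
    rw [Real.rpow_neg hs.le, ← Real.sqrt_eq_rpow]
    have := Real.sqrt_pos.2 hs
    gcongr
    linarith [norm_nonneg y]
  · have hr : 3 < p.toReal := by
      have := ENNReal.toReal_strict_mono hpt hp
      simpa using this
    obtain ⟨C, hC, h⟩ := exists_lintegral_centeredWeight_rpow_le hr
    refine ⟨C ^ (p⁻¹).toReal, by positivity, fun s hs => ?_⟩
    rw [← eLpNorm_enorm]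
    have hm : Measurable fun y => ENNReal.ofReal (centeredWeight s y ^ p.toReal) :=
      ((measurable_centeredWeight s).pow_const _).ennreal_ofReal
    refine (eLpNorm_le_of_ae_le_const_mul_rpow hp1 (C := 1) hm.aemeasurable
      (Eventually.of_forall fun y => ?_)).trans ?_
    · have h0 := centeredWeight_nonneg s y
      rw [one_mul, ENNReal.ofReal_rpow_of_nonneg (by positivity) ENNReal.toReal_nonneg,
        ← Real.rpow_mul h0, ENNReal.toReal_inv, mul_inv_cancel₀ (by linarith), Real.rpow_one,
        Real.enorm_of_nonneg h0]
    · rw [one_mul]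
      refine (ENNReal.rpow_le_rpow (h s hs) ENNReal.toReal_nonneg).trans ?_
      rw [ENNReal.ofReal_rpow_of_nonneg (by positivity) ENNReal.toReal_nonneg,
        Real.mul_rpow hC.le (by positivity), ← Real.rpow_mul hs.le]
      refine le_of_eq ?_
      congr 3
      rw [critExp, ENNReal.toReal_inv]
      field_simp; ring

/-- The `L²` size of the difference of two flows with the same data. -/
theorem exists_eLpNorm_two_le {c₁ : ℝ} (hc₁ : 0 < c₁) :
    ∃ C : ℝ, 0 < C ∧ ∀ (T : ℝ≥0∞) (U₀ : 𝓓((⊤ : TopologicalSpace.Opens E3), ℝ) → E3)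
      (u v : ℝ → E3 → E3), IsMildSolution T U₀ u → IsMildSolution T U₀ v →
      CenteredTypeI T c₁ u v → ∀ t, 0 < t → ENNReal.ofReal t < T →
      eLpNorm ((u - v) t) 2 volume ≤ ENNReal.ofReal (C * t ^ (1 / 4 : ℝ)) := by
  have hk := kC_pos
  obtain ⟨C₀, hC₀⟩ := exists_eLpNorm_kmaj_conv_le (q := ∞) (by simp)
  obtain ⟨B, hB, hBs⟩ := exists_lintegral_centeredWeight_rpow_le (a := 4) (by norm_num)
  set E : ℝ := (C₀ + 1) * (c₁ ^ 2 * B ^ (1 / 2 : ℝ)) with hE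
  have hEpos : 0 < E := by positivity
  refine ⟨36 * kC * (E * (2 * (1 / (-(1 / 2) + 1) + 1 / (-(1 / 4) + 1)))), by norm_num; positivity,
    fun T U₀ u v hu hv hI t ht hT => ?_⟩
  obtain ⟨f, hfm, hf, hduh⟩ := hu.isDuhamelFlow.exists_interaction hv.isDuhamelFlow
  have hpt := enorm_sub_le_duhamelPotential hc₁ hu hv hI hduh ht hT
  have hpot := eLpNorm_duhamelPotential_le (p := 2) (by norm_num) hfm (t := 0) (τ := t)
    (b := fun s => E * ((t - s) ^ (-(1 / 2) : ℝ) * s ^ (-(1 / 4) : ℝ))) (by fun_prop)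
    (fun s hs => by have : 0 < t - s := by linarith [hs.2]
                    have := hs.1
                    positivity) (by
    filter_upwards [hf] with s hs hm
    simp only [zero_add]
    have hTs : ENNReal.ofReal s < T := lt_of_le_of_lt (ENNReal.ofReal_le_ofReal hm.2.le) hT
    have hσ : 0 < t - s := by linarith [hm.2]
    have h0 := hm.1
    have hfs : Measurable fun y => f (s, y) := hfm.comp measurable_prodMk_left
    -- The interaction is at most `c₁²` times the squared weight, and the integral of the fourth
    -- power of the weight is of order `s^{-1/2}`.
    have hfn : eLpNorm (fun y => f (s, y)) 2 volume ≤
        ENNReal.ofReal (c₁ ^ 2 * B ^ (1 / 2 : ℝ) * s ^ (-(1 / 4) : ℝ)) := by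
      have hm4 : Measurable fun y => ENNReal.ofReal (centeredWeight s y ^ (4 : ℝ)) :=
        ((measurable_centeredWeight s).pow_const _).ennreal_ofReal
      refine (eLpNorm_le_of_ae_le_const_mul_rpow (by norm_num) (C := ENNReal.ofReal (c₁ ^ 2))
        hm4.aemeasurable ?_).trans ?_
      · filter_upwards [hs h0 hTs, hI s h0 hTs] with y hy hIy
        have hw := centeredWeight_nonneg s y
        rw [hy, ENNReal.toReal_inv, ENNReal.ofReal_rpow_of_nonneg (by positivity) (by positivity),
          ← ENNReal.ofReal_mul (by positivity), ← Real.rpow_mul hw, ← ofReal_norm (u s y),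
          ← ofReal_norm (v s y), ← ofReal_norm ((u - v) s y),
          ← ENNReal.ofReal_add (norm_nonneg _) (norm_nonneg _), ← ENNReal.ofReal_mul (by positivity)]
        refine ENNReal.ofReal_le_ofReal ?_
        have e : (4 : ℝ) * (ENNReal.toReal 2)⁻¹ = (2 : ℕ) := by norm_num
        rw [e, Real.rpow_natCast, ← mul_pow, sq]
        have h2 : c₁ / (‖y‖ + √s) = c₁ * centeredWeight s y := div_eq_mul_inv _ _
        rw [h2] at hIy
        exact mul_le_mul hIy ((norm_sub_le _ _).trans hIy) (norm_nonneg _) (by positivity)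
      · refine (mul_le_mul_right (ENNReal.rpow_le_rpow (hBs s h0) ENNReal.toReal_nonneg) _).trans ?_
        rw [ENNReal.ofReal_rpow_of_nonneg (by positivity) ENNReal.toReal_nonneg,
          ← ENNReal.ofReal_mul (by positivity), Real.mul_rpow hB.le (by positivity),
          ← Real.rpow_mul h0.le]
        refine ENNReal.ofReal_le_ofReal (le_of_eq ?_)
        norm_num
        ring
    have h1 : eLpNorm (fun _ : E3 => (1 : ℝ≥0∞)) ∞ volume ≤ 1 := by
      rw [eLpNorm_exponent_top]
      exact eLpNormEssSup_le_of_ae_enorm_bound (by simp)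
    have hy := hC₀ 2 (by norm_num) (by norm_num) (t - s) hσ (fun _ => 1) (fun y => f (s, y))
      aemeasurable_const hfs.aemeasurable
    simp only [one_mul, ENNReal.inv_top, ENNReal.toReal_zero, mul_zero, sub_zero] at hy
    refine hy.trans ?_
    calc _ ≤ ENNReal.ofReal (C₀ + 1) * ENNReal.ofReal ((t - s) ^ (-(1 / 2) : ℝ)) *
          (1 * ENNReal.ofReal (c₁ ^ 2 * B ^ (1 / 2 : ℝ) * s ^ (-(1 / 4) : ℝ))) := by
          gcongr
          rw [← ENNReal.ofReal_coe_nnreal]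
          exact ENNReal.ofReal_le_ofReal (by linarith)
      _ = _ := by
          rw [one_mul, ← ENNReal.ofReal_mul (by positivity), ← ENNReal.ofReal_mul (by positivity), hE]
          congr 1; ring)
  -- The mass of the kernel majorant gives `(t-s)^{-1/2}`; the total power is `-1/2 - 1/4 + 1 =
  -- 1/4`.
  have hint : ∫⁻ s in Ioo 0 t, ENNReal.ofReal (E * ((t - s) ^ (-(1 / 2) : ℝ) * s ^ (-(1 / 4) : ℝ))) ≤
      ENNReal.ofReal E * ENNReal.ofReal (2 * (1 / (-(1 / 2) + 1) + 1 / (-(1 / 4) + 1)) *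
        t ^ (-(1 / 2) + -(1 / 4) + 1 : ℝ)) := by
    simp_rw [ENNReal.ofReal_mul hEpos.le]
    rw [lintegral_const_mul _ (by fun_prop)]
    refine mul_le_mul_right ?_ _
    exact lintegral_beta_le ht (by norm_num) (by norm_num) (by norm_num) (by norm_num)
  refine (eLpNorm_le_const_mul_of_ae_enorm_le (by norm_num)
    (measurable_duhamelPotential hfm 0 t).aemeasurable hpt).trans ?_
  refine (mul_le_mul_right (hpot.trans hint) _).trans ?_
  rw [← ENNReal.ofReal_mul hEpos.le, ← ENNReal.ofReal_mul (by positivity)]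
  refine ENNReal.ofReal_le_ofReal (le_of_eq ?_)
  norm_num
  ring


/-! ### Smallness inside and outside the parabolic ball -/

theorem hBar_pos {c₁ ε : ℝ} (hε : 0 < ε) (hεc : ε < c₁) (p : ℝ≥0∞) (w : ℝ → E3 → E3) {t : ℝ}
    (ht : 0 < t) : 0 < hBar c₁ ε p w t := by
  have h1 : 0 < c₁ - ε := by linarith
  have h2 := Real.sqrt_pos.2 ht
  exact lt_max_of_lt_left (by positivity)

/-- Only the second entry of the maximum matters here: its power `2/3` is undone by the factor
`h^{-3/2}` that Cauchy–Schwarz on a cube produces. -/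
theorem hBar_rpow_le {c₁ ε : ℝ} (hε : 0 < ε) {p : ℝ≥0∞} {w : ℝ → E3 → E3} {t : ℝ}
    (ht : 0 < t) (hw : 0 < (eLpNorm (w t) p volume).toReal) :
    hBar c₁ ε p w t ^ (-(3 / 2) : ℝ) ≤
      ε * (eLpNorm (w t) p volume).toReal * t ^ (critExp p - 3 / 4) := by
  set W := (eLpNorm (w t) p volume).toReal
  set X : ℝ := t ^ (3 / 4 : ℝ) * (t ^ (3 / 2 * (p⁻¹).toReal - 1 / 2) / (ε * W)) with hX
  have hXpos : 0 < X := by positivity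
  have h1 : X ^ (2 / 3 : ℝ) ≤ hBar c₁ ε p w t := le_max_right _ _
  refine (Real.rpow_le_rpow_of_nonpos (by positivity) h1 (by norm_num)).trans ?_
  rw [← Real.rpow_mul hXpos.le]
  norm_num
  rw [Real.rpow_neg_one, hX]
  have e : t ^ (critExp p - 3 / 4) = (t ^ (3 / 4 : ℝ) * t ^ (3 / 2 * (p⁻¹).toReal - 1 / 2))⁻¹ := by
    rw [← Real.rpow_add ht, ← Real.rpow_neg ht.le]
    congr 1; unfold critExp; ring
  rw [e]
  refine le_of_eq ?_
  field_simp

/-- Control of the difference in the inner ball from the closeness to its cube averages. -/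
theorem exists_eLpNorm_ball_le {p : ℝ≥0∞} (hp : 3 < p) {c₁ : ℝ} (hc₁ : 0 < c₁) :
    ∃ C : ℝ, 0 < C ∧ ∀ ε : ℝ, 0 < ε → ε < c₁ → ∀ (T : ℝ≥0∞)
      (U₀ : 𝓓((⊤ : TopologicalSpace.Opens E3), ℝ) → E3) (u v : ℝ → E3 → E3),
      IsMildSolution T U₀ u → IsMildSolution T U₀ v → CenteredTypeI T c₁ u v →
      ∀ t, 0 < t → ENNReal.ofReal t < T → eLpNorm ((u - v) t) p volume ≠ ∞ →
      eLpNorm ((u - v) t - cubeAverage (hBar c₁ ε p (u - v) t) ((u - v) t)) p volume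
        ≤ ENNReal.ofReal ε * eLpNorm ((u - v) t) p volume →
      eLpNorm ((u - v) t) p (volume.restrict (Metric.ball 0 ((c₁ - ε) / ε * √t))) ≤
        ENNReal.ofReal (ε + C * ε ^ (1 - 3 * (p⁻¹).toReal)) * eLpNorm ((u - v) t) p volume := by
  have hp1 : 1 ≤ p := le_trans (by norm_num) hp.le
  set b := (p⁻¹).toReal with hb
  have hb0 : 0 ≤ b := ENNReal.toReal_nonneg
  obtain ⟨C₂, hC₂, h2⟩ := exists_eLpNorm_two_le hc₁
  set V : ℝ := (volume (Metric.ball (0 : E3) 1)).toReal with hV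
  have hVfin : volume (Metric.ball (0 : E3) 1) ≠ ∞ := measure_ball_lt_top.ne
  have hV0 : 0 < V := ENNReal.toReal_pos (Metric.measure_ball_pos _ _ one_pos).ne' hVfin
  refine ⟨V ^ b * c₁ ^ (3 * b) * C₂, by positivity,
    fun ε hε hεc T U₀ u v hu hv hI t ht hT hfin hJ => ?_⟩
  have hwm := hu.isDuhamelFlow.aestronglyMeasurable_sub hv.isDuhamelFlow ht hT
  -- The scale divides by this norm, so the trivial case is removed first.
  rcases eq_or_ne (eLpNorm ((u - v) t) p volume) 0 with h0 | h0
  · refine (eLpNorm_mono_measure _ Measure.restrict_le_self).trans ?_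
    rw [h0]; exact zero_le
  set W := (eLpNorm ((u - v) t) p volume).toReal with hW
  have hWpos : 0 < W := ENNReal.toReal_pos h0 hfin
  have hWe : eLpNorm ((u - v) t) p volume = ENNReal.ofReal W := (ENNReal.ofReal_toReal hfin).symm
  set h := hBar c₁ ε p (u - v) t with hh
  have hhpos : 0 < h := hBar_pos hε hεc p _ ht
  have hJm := (stronglyMeasurable_cubeAverage h ((u - v) t)).aestronglyMeasurable (μ := volume)
  set S := Metric.ball (0 : E3) ((c₁ - ε) / ε * √t) with hS
  have hst := Real.sqrt_pos.2 ht
  have hce : 0 < c₁ - ε := by linarith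
  -- Pointwise bound for the averages: `h^{-3/2}` times the `L²` bound.
  set a : ℝ := ε * W * t ^ (critExp p - 3 / 4) * (C₂ * t ^ (1 / 4 : ℝ)) with ha
  have hapos : 0 < a := by positivity
  have hbd : ∀ x, ‖cubeAverage h ((u - v) t) x‖ ≤ a := by
    intro x
    have h3 := (enorm_cubeAverage_le hhpos hwm x).trans
      (mul_le_mul_right (h2 T U₀ u v hu hv hI t ht hT) _)
    rw [← ENNReal.ofReal_mul (by positivity), ← ofReal_norm] at h3
    have h4 := (ENNReal.ofReal_le_ofReal_iff (by positivity)).1 h3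
    refine h4.trans ?_
    rw [ha]
    gcongr
    exact hBar_rpow_le hε ht hWpos
  have hvol : volume S ≤ ENNReal.ofReal ((c₁ / ε * √t) ^ 3 * V) := by
    rw [hS, Measure.addHaar_ball_of_pos _ _ (by positivity), ENNReal.ofReal_mul (by positivity), hV,
      ENNReal.ofReal_toReal hVfin]
    simp only [finrank_euclideanSpace, Fintype.card_fin]
    gcongr
    linarith
  have hJS : eLpNorm (cubeAverage h ((u - v) t)) p (volume.restrict S) ≤
      ENNReal.ofReal (V ^ b * c₁ ^ (3 * b) * C₂ * ε ^ (1 - 3 * b) * W) := by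
    refine (eLpNorm_le_of_ae_bound (Eventually.of_forall hbd)).trans ?_
    rw [Measure.restrict_apply_univ, ← ENNReal.toReal_inv, ← hb]
    refine (mul_le_mul_left (ENNReal.rpow_le_rpow hvol hb0) _).trans ?_
    rw [ENNReal.ofReal_rpow_of_nonneg (by positivity) hb0, ← ENNReal.ofReal_mul (by positivity)]
    refine ENNReal.ofReal_le_ofReal (le_of_eq ?_)
    have e1 : ((c₁ / ε * √t) ^ 3) ^ b = c₁ ^ (3 * b) * ε ^ (-(3 * b)) * t ^ (3 / 2 * b) := by
      rw [← Real.rpow_natCast, ← Real.rpow_mul (by positivity), Real.mul_rpow (by positivity) hst.le,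
        Real.div_rpow hc₁.le hε.le, Real.sqrt_eq_rpow, ← Real.rpow_mul ht.le, Real.rpow_neg hε.le]
      push_cast
      rw [div_eq_mul_inv]
      congr 2; ring
    have e2 : ε ^ (1 - 3 * b) = ε * ε ^ (-(3 * b)) := by
      rw [sub_eq_add_neg, Real.rpow_add hε, Real.rpow_one]
    -- The volume of the ball, the scale and the `L²` bound balance exactly in time; what survives
    -- is `ε · ε^{-3/p}`, small because `p > 3`.
    have e3 : t ^ (3 / 2 * b) * (t ^ (critExp p - 3 / 4) * t ^ (1 / 4 : ℝ)) = 1 := by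
      have : 3 / 2 * b + (critExp p - 3 / 4 + 1 / 4) = 0 := by unfold critExp; rw [← hb]; ring
      rw [← Real.rpow_add ht, ← Real.rpow_add ht, this, Real.rpow_zero]
    rw [Real.mul_rpow (by positivity) hV0.le, e1, e2, ha]
    calc _ = V ^ b * c₁ ^ (3 * b) * C₂ * (ε * ε ^ (-(3 * b))) * W *
          (t ^ (3 / 2 * b) * (t ^ (critExp p - 3 / 4) * t ^ (1 / 4 : ℝ))) := by ring
      _ = _ := by rw [e3, mul_one]
  calc eLpNorm ((u - v) t) p (volume.restrict S)
      = eLpNorm (((u - v) t - cubeAverage h ((u - v) t)) + cubeAverage h ((u - v) t)) p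
          (volume.restrict S) := by rw [sub_add_cancel]
    _ ≤ eLpNorm ((u - v) t - cubeAverage h ((u - v) t)) p (volume.restrict S) +
          eLpNorm (cubeAverage h ((u - v) t)) p (volume.restrict S) :=
        eLpNorm_add_le (hwm.sub hJm).restrict hJm.restrict hp1
    _ ≤ ENNReal.ofReal ε * ENNReal.ofReal W +
          ENNReal.ofReal (V ^ b * c₁ ^ (3 * b) * C₂ * ε ^ (1 - 3 * b) * W) := by
        rw [← hWe]
        exact add_le_add ((eLpNorm_mono_measure _ Measure.restrict_le_self).trans hJ) hJS
    _ = _ := by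
        rw [hWe, ← ENNReal.ofReal_mul hε.le, ← ENNReal.ofReal_add (by positivity) (by positivity),
          ← ENNReal.ofReal_mul (by positivity)]
        congr 1; ring

/-- Outside the ball the weight is at most `ε/(c₁√s)`. One of its six powers is bounded this way and
yields `ε^{1/6}`; the remaining five still exceed the dimension, so they are integrable over all of
space. -/
theorem exists_eLpNorm_outer_weight_le {c₁ : ℝ} (hc₁ : 0 < c₁) :
    ∃ B : ℝ, 0 < B ∧ ∀ ε s : ℝ, 0 < ε → ε < c₁ → 0 < s →
      eLpNorm ((Metric.ball (0 : E3) ((c₁ - ε) / ε * √s))ᶜ.indicator (centeredWeight s)) 6 volume ≤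
        ENNReal.ofReal (B * ε ^ (1 / 6 : ℝ) * s ^ (-(1 / 4) : ℝ)) := by
  obtain ⟨C, hC, h⟩ := exists_lintegral_centeredWeight_rpow_le (a := 5) (by norm_num)
  refine ⟨(c₁⁻¹) ^ (1 / 6 : ℝ) * C ^ (1 / 6 : ℝ), by positivity, fun ε s hε hεc hs => ?_⟩
  have hss := Real.sqrt_pos.2 hs
  have e6 : ((6 : ℝ≥0∞)⁻¹).toReal = 1 / 6 := by rw [ENNReal.toReal_inv]; norm_num
  have hm : Measurable fun y => ENNReal.ofReal (centeredWeight s y ^ (5 : ℝ)) :=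
    ((measurable_centeredWeight s).pow_const _).ennreal_ofReal
  rw [← eLpNorm_enorm]
  refine (eLpNorm_le_of_ae_le_const_mul_rpow (by norm_num)
    (C := ENNReal.ofReal ((ε / (c₁ * √s)) ^ (1 / 6 : ℝ))) hm.aemeasurable
    (Eventually.of_forall fun y => ?_)).trans ?_
  · by_cases hy : y ∈ (Metric.ball (0 : E3) ((c₁ - ε) / ε * √s))ᶜ
    · have h0 := centeredWeight_nonneg s y
      have hpos : 0 < centeredWeight s y := by unfold centeredWeight; positivity
      rw [indicator_of_mem hy, e6, Real.enorm_of_nonneg h0,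
        ENNReal.ofReal_rpow_of_nonneg (by positivity) (by norm_num),
        ← ENNReal.ofReal_mul (by positivity), ← Real.rpow_mul h0]
      refine ENNReal.ofReal_le_ofReal ?_
      have hle : centeredWeight s y ≤ ε / (c₁ * √s) := by
        have h1 : (c₁ - ε) / ε * √s ≤ ‖y‖ := by simpa using hy
        rw [centeredWeight, inv_le_comm₀ (by positivity) (by positivity), inv_div]
        -- The reason for the radius `((c₁-ε)/ε)√s`: adding `√s` gives exactly `c₁√s/ε`.
        calc c₁ * √s / ε = (c₁ - ε) / ε * √s + √s := by field_simp; ring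
          _ ≤ _ := by linarith
      calc centeredWeight s y
          = centeredWeight s y ^ (1 / 6 : ℝ) * centeredWeight s y ^ (5 * (1 / 6) : ℝ) := by
            rw [← Real.rpow_add hpos]; norm_num
        _ ≤ _ := by gcongr
    · rw [indicator_of_notMem hy, enorm_zero]; exact zero_le
  · rw [e6]
    refine (mul_le_mul_right (ENNReal.rpow_le_rpow (h s hs) (by norm_num)) _).trans ?_
    rw [ENNReal.ofReal_rpow_of_nonneg (by positivity) (by norm_num),
      ← ENNReal.ofReal_mul (by positivity)]
    refine ENNReal.ofReal_le_ofReal (le_of_eq ?_)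
    have e1 : ε / (c₁ * √s) = c₁⁻¹ * ε * s ^ (-(1 / 2) : ℝ) := by
      rw [Real.rpow_neg hs.le, ← Real.sqrt_eq_rpow]; field_simp
    rw [e1, Real.mul_rpow (by positivity) (by positivity), Real.mul_rpow (by positivity) hε.le,
      Real.mul_rpow hC.le (by positivity), ← Real.rpow_mul hs.le, ← Real.rpow_mul hs.le]
    have e2 : s ^ (-(1 / 2) * (1 / 6) : ℝ) * s ^ ((3 / 2 - 5 / 2) * (1 / 6) : ℝ) =
        s ^ (-(1 / 4) : ℝ) := by rw [← Real.rpow_add hs]; norm_num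
    rw [← e2]; ring


/-! ### Vanishing near the initial time and continuation -/

theorem eLpNorm_eq_zero_of_le_div_two_pow {f : E3 → E3} {p : ℝ≥0∞} {D : ℝ}
    (h : ∀ n : ℕ, eLpNorm f p volume ≤ ENNReal.ofReal (D / 2 ^ n)) : eLpNorm f p volume = 0 := by
  have h1 : Tendsto (fun n : ℕ => ENNReal.ofReal (D / 2 ^ n)) atTop (𝓝 (ENNReal.ofReal 0)) :=
    ENNReal.tendsto_ofReal (Tendsto.div_atTop tendsto_const_nhds
      (tendsto_pow_atTop_atTop_of_one_lt one_lt_two))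
  rw [ENNReal.ofReal_zero] at h1
  exact le_antisymm (ge_of_tendsto' h1 h) zero_le

theorem CenteredTypeI.eLpNorm_le {T : ℝ≥0∞} {c₁ : ℝ} (hc₁ : 0 < c₁) {u v : ℝ → E3 → E3}
    (h : CenteredTypeI T c₁ u v) {p : ℝ≥0∞} {B t : ℝ} (ht : 0 < t) (hT : ENNReal.ofReal t < T)
    (hB : eLpNorm (centeredWeight t) p volume ≤ ENNReal.ofReal (B * t ^ (-critExp p))) :
    eLpNorm ((u - v) t) p volume ≤ ENNReal.ofReal (c₁ * B * t ^ (-critExp p)) := by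
  calc _ ≤ eLpNorm (c₁ • centeredWeight t) p volume := by
        refine eLpNorm_mono_ae ?_
        filter_upwards [h.norm_difference_le ht hT] with x hx
        refine hx.trans (le_of_eq ?_)
        have := centeredWeight_nonneg t x
        rw [Pi.smul_apply, smul_eq_mul, Real.norm_of_nonneg (by positivity)]
        rfl
    _ ≤ ENNReal.ofReal c₁ * ENNReal.ofReal (B * t ^ (-critExp p)) := by
        rw [eLpNorm_const_smul, Real.enorm_of_nonneg hc₁.le]
        gcongr
    _ = _ := by rw [← ENNReal.ofReal_mul hc₁.le, mul_assoc]

/-- The interaction of two flows on a time slice, split at the parabolic ball. -/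
theorem exists_slice_estimate {p : ℝ≥0∞} (hp : 3 < p) {c₁ : ℝ} (hc₁ : 0 < c₁) :
    ∃ C : ℝ, 0 < C ∧ ∀ ε : ℝ, 0 < ε → ε < c₁ → ∀ (s σ D κ : ℝ) (U V w : E3 → E3),
      0 < s → 0 < σ → 0 < D → 0 < κ → AEStronglyMeasurable w volume →
      (∀ᵐ y, ‖U y‖ + ‖V y‖ ≤ c₁ / (‖y‖ + √s)) →
      eLpNorm w p volume ≤ ENNReal.ofReal D →
      eLpNorm w p (volume.restrict (Metric.ball 0 ((c₁ - ε) / ε * √s))) ≤ ENNReal.ofReal (κ * D) →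
      eLpNorm (fun x => ∫⁻ y, kmaj σ (x - y) * ((‖U y‖ₑ + ‖V y‖ₑ) * ‖w y‖ₑ)) p volume ≤
        ENNReal.ofReal (C * (κ + ε ^ (1 / 6 : ℝ)) * (σ ^ (-(3 / 4) : ℝ) * s ^ (-(1 / 4) : ℝ) * D)) := by
  have hp1 : 1 ≤ p := le_trans (by norm_num) hp.le
  have hp3 := inv_toReal_lt_third hp
  have e6 : ((6 : ℝ≥0∞)⁻¹).toReal = 1 / 6 := by rw [ENNReal.toReal_inv]; norm_num
  have hc6 : critExp 6 = 1 / 4 := by rw [critExp, e6]; norm_num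
  -- With the weight in `L⁶` the kernel contributes `σ^{-3/4}` and the weight `s^{-1/4}`. Both
  -- singularities are integrable in time, the second even after multiplication by `s^{-c}` with `c
  -- ≤ 1/2`.
  obtain ⟨C₆, hC₆⟩ := exists_eLpNorm_kmaj_conv_le (q := 6) (by norm_num)
  obtain ⟨B₆, hB₆, h6⟩ := exists_eLpNorm_centeredWeight_le (p := 6) (by norm_num)
  obtain ⟨B₅, hB₅, h5⟩ := exists_eLpNorm_outer_weight_le hc₁
  refine ⟨(C₆ + 1) * (c₁ * (B₆ + B₅)), by positivity,
    fun ε hε hεc s σ D κ U V w hs hσ hD hκ hw hUV hwD hwB => ?_⟩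
  set S := Metric.ball (0 : E3) ((c₁ - ε) / ε * √s) with hS
  have hSm : MeasurableSet S := measurableSet_ball
  -- Inside the ball the full weight meets a small `w`; outside it a small weight meets the full
  -- `w`.
  set g₁ : E3 → ℝ := c₁ • centeredWeight s with hg₁
  set g₂ : E3 → ℝ := c₁ • Sᶜ.indicator (centeredWeight s) with hg₂
  have hg₁m : Measurable g₁ := (measurable_centeredWeight s).const_smul c₁
  have hg₂m : Measurable g₂ := ((measurable_centeredWeight s).indicator hSm.compl).const_smul c₁
  have hω₁ : AEStronglyMeasurable (S.indicator w) volume := hw.indicator hSm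
  have hkm : ∀ x, Measurable fun y => kmaj σ (x - y) := fun x =>
    measurable_kmaj.comp (f := fun y => (σ, x - y)) (by fun_prop)
  have hk : ∀ g : E3 → ℝ, ∀ ω : E3 → E3, Measurable g → AEStronglyMeasurable ω volume →
      ∀ G W : ℝ, 0 ≤ G → 0 ≤ W →
      eLpNorm g 6 volume ≤ ENNReal.ofReal G → eLpNorm ω p volume ≤ ENNReal.ofReal W →
      eLpNorm (fun x => ∫⁻ y, kmaj σ (x - y) * (‖g y‖ₑ * ‖ω y‖ₑ)) p volume ≤
        ENNReal.ofReal ((C₆ + 1) * σ ^ (-(3 / 4) : ℝ) * (G * W)) := by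
    intro g ω hg hω G W hG hW hgG hωW
    refine (hC₆ p hp1 (by rw [e6]; linarith) σ hσ _ _ hg.enorm.aemeasurable hω.enorm).trans ?_
    rw [eLpNorm_enorm, eLpNorm_enorm, e6]
    have e : -(1 / 2) - 3 / 2 * (1 / 6) = (-(3 / 4) : ℝ) := by norm_num
    rw [e]
    calc _ ≤ ENNReal.ofReal (C₆ + 1) * ENNReal.ofReal (σ ^ (-(3 / 4) : ℝ)) *
          (ENNReal.ofReal G * ENNReal.ofReal W) := by
          gcongr
          rw [← ENNReal.ofReal_coe_nnreal]
          exact ENNReal.ofReal_le_ofReal (by linarith)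
      _ = _ := by
          rw [← ENNReal.ofReal_mul (by positivity), ← ENNReal.ofReal_mul hG,
            ← ENNReal.ofReal_mul (by positivity)]
  have hn₁ : eLpNorm g₁ 6 volume ≤ ENNReal.ofReal (c₁ * (B₆ * s ^ (-(1 / 4) : ℝ))) := by
    rw [hg₁, eLpNorm_const_smul, Real.enorm_of_nonneg hc₁.le, ENNReal.ofReal_mul hc₁.le]
    gcongr
    have := h6 s hs
    rwa [hc6] at this
  have hn₂ : eLpNorm g₂ 6 volume ≤
      ENNReal.ofReal (c₁ * (B₅ * ε ^ (1 / 6 : ℝ) * s ^ (-(1 / 4) : ℝ))) := by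
    rw [hg₂, eLpNorm_const_smul, Real.enorm_of_nonneg hc₁.le, ENNReal.ofReal_mul hc₁.le]
    gcongr
    exact h5 ε s hε hεc hs
  have hwS : eLpNorm (S.indicator w) p volume ≤ ENNReal.ofReal (κ * D) := by
    rw [eLpNorm_indicator_eq_eLpNorm_restrict hSm]; exact hwB
  have k1 := hk g₁ _ hg₁m hω₁ _ _ (by positivity) (by positivity) hn₁ hwS
  have k2 := hk g₂ _ hg₂m hw _ _ (by positivity) hD.le hn₂ hwD
  have hm₁ : Measurable fun z : E3 × E3 => kmaj σ (z.1 - z.2) :=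
    measurable_kmaj.comp (f := fun z : E3 × E3 => (σ, z.1 - z.2)) (by fun_prop)
  have hF : ∀ g : E3 → ℝ, ∀ ω : E3 → E3, Measurable g → AEStronglyMeasurable ω volume →
      AEStronglyMeasurable (fun x => ∫⁻ y, kmaj σ (x - y) * (‖g y‖ₑ * ‖ω y‖ₑ)) volume := by
    intro g ω hg hω
    obtain ⟨ω', hω', he⟩ := hω
    have : (fun x => ∫⁻ y, kmaj σ (x - y) * (‖g y‖ₑ * ‖ω y‖ₑ)) =
        fun x => ∫⁻ y, kmaj σ (x - y) * (‖g y‖ₑ * ‖ω' y‖ₑ) := by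
      funext x
      refine lintegral_congr_ae ?_
      filter_upwards [he] with y hy
      rw [hy]
    rw [this]
    have hm : Measurable fun z : E3 × E3 => kmaj σ (z.1 - z.2) * (‖g z.2‖ₑ * ‖ω' z.2‖ₑ) :=
      hm₁.mul ((hg.comp measurable_snd).enorm.mul (hω'.measurable.comp measurable_snd).enorm)
    exact hm.lintegral_prod_right'.aestronglyMeasurable
  calc _ ≤ eLpNorm ((fun x => ∫⁻ y, kmaj σ (x - y) * (‖g₁ y‖ₑ * ‖S.indicator w y‖ₑ)) +
        fun x => ∫⁻ y, kmaj σ (x - y) * (‖g₂ y‖ₑ * ‖w y‖ₑ)) p volume := by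
        refine eLpNorm_mono_enorm fun x => ?_
        simp only [enorm_eq_self, Pi.add_apply]
        have hax : AEMeasurable
            (fun y => kmaj σ (x - y) * (‖g₁ y‖ₑ * ‖S.indicator w y‖ₑ)) volume :=
          (hkm x).aemeasurable.mul (hg₁m.enorm.aemeasurable.mul hω₁.enorm)
        rw [← lintegral_add_left' hax]
        refine lintegral_mono_ae ?_
        filter_upwards [hUV] with y hy
        rw [← mul_add]
        refine mul_le_mul_right ?_ _
        have h0 := centeredWeight_nonneg s y
        have hy' : ‖U y‖ₑ + ‖V y‖ₑ ≤ ‖c₁ * centeredWeight s y‖ₑ := by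
          rw [Real.enorm_of_nonneg (by positivity), ← ofReal_norm, ← ofReal_norm,
            ← ENNReal.ofReal_add (norm_nonneg _) (norm_nonneg _)]
          exact ENNReal.ofReal_le_ofReal hy
        by_cases hyS : y ∈ S
        · rw [indicator_of_mem hyS]
          exact (mul_le_mul_left hy' _).trans le_self_add
        · have : g₂ y = c₁ * centeredWeight s y := by
            rw [hg₂, Pi.smul_apply, indicator_of_mem hyS, smul_eq_mul]
          rw [this]
          exact (mul_le_mul_left hy' _).trans le_add_self
    _ ≤ _ := (eLpNorm_add_le (hF _ _ hg₁m hω₁) (hF _ _ hg₂m hw) hp1).trans (add_le_add k1 k2)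
    _ ≤ _ := by
        rw [← ENNReal.ofReal_add (by positivity) (by positivity)]
        refine ENNReal.ofReal_le_ofReal ?_
        -- The cross terms in the expansion of `(B₆ + B₅)(κ + ε^{1/6})`, which are discarded.
        have : 0 ≤ (C₆ + 1) * c₁ * (σ ^ (-(3 / 4) : ℝ) * s ^ (-(1 / 4) : ℝ) * D) *
            (B₅ * κ + B₆ * ε ^ (1 / 6 : ℝ)) := by positivity
        linear_combination this

/-- Vanishing of the difference of two flows up to the time to which the closeness to the cube
averages is assumed. -/
theorem exists_threshold {p : ℝ≥0∞} (hp : 3 < p) {c₁ : ℝ} (hc₁ : 0 < c₁) :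
    ∃ ε : ℝ, 0 < ε ∧ ε < c₁ ∧ ∀ (T : ℝ≥0∞)
      (U₀ : 𝓓((⊤ : TopologicalSpace.Opens E3), ℝ) → E3) (u v : ℝ → E3 → E3),
      IsMildSolution T U₀ u → IsMildSolution T U₀ v → CenteredTypeI T c₁ u v →
      ∀ δ : ℝ, 0 < δ → ENNReal.ofReal δ ≤ T →
      (∀ t ∈ Ioo 0 δ,
        eLpNorm ((u - v) t - cubeAverage (hBar c₁ ε p (u - v) t) ((u - v) t)) p volume
          ≤ ENNReal.ofReal ε * eLpNorm ((u - v) t) p volume) →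
      ∀ t ∈ Ioo 0 δ, eLpNorm ((u - v) t) p volume = 0 := by
  have hk := kC_pos
  have hp1 : 1 ≤ p := le_trans (by norm_num) hp.le
  have hp3 := inv_toReal_lt_third hp
  have hc := critExp_pos hp
  have hch := critExp_le_half p
  set c := critExp p with hcd
  obtain ⟨B, hB, hBw⟩ := exists_eLpNorm_centeredWeight_le hp
  obtain ⟨Cb, hCb, hball⟩ := exists_eLpNorm_ball_le hp hc₁
  obtain ⟨Cs, hCs, hslice⟩ := exists_slice_estimate hp hc₁
  set β : ℝ := 2 * (1 / (-(3 / 4) + 1) + 1 / (-(1 / 4) - c + 1)) with hβ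
  have hβpos : 0 < β := by
    have : 0 < -(1 / 4) - c + 1 := by linarith
    have h4 : (0 : ℝ) < -(3 / 4) + 1 := by norm_num
    rw [hβ]; positivity
  set b := (p⁻¹).toReal with hb
  -- Every power of `ε` has a positive exponent, `1 - 3b` because `p > 3`, so the expression is
  -- continuous at `0` and vanishes there.
  obtain ⟨ε, hε, hεc, hsmall⟩ : ∃ ε : ℝ, 0 < ε ∧ ε < c₁ ∧
      36 * kC * β * (Cs * (ε + Cb * ε ^ (1 - 3 * b) + ε ^ (1 / 6 : ℝ))) ≤ 1 / 2 := by
    have hcont : ContinuousAt (fun ε : ℝ =>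
        36 * kC * β * (Cs * (ε + Cb * ε ^ (1 - 3 * b) + ε ^ (1 / 6 : ℝ)))) 0 := by
      have h1 : ContinuousAt (fun ε : ℝ => ε ^ (1 - 3 * b)) 0 :=
        Real.continuousAt_rpow_const _ _ (Or.inr (by linarith))
      have h2 : ContinuousAt (fun ε : ℝ => ε ^ (1 / 6 : ℝ)) 0 :=
        Real.continuousAt_rpow_const _ _ (Or.inr (by norm_num))
      fun_prop
    have h0 : 36 * kC * β * (Cs * ((0 : ℝ) + Cb * 0 ^ (1 - 3 * b) + 0 ^ (1 / 6 : ℝ))) < 1 / 2 := by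
      rw [Real.zero_rpow (by linarith), Real.zero_rpow (by norm_num)]; norm_num
    have h1 := (hcont.tendsto.eventually (gt_mem_nhds h0)).filter_mono
      (nhdsWithin_le_nhds (s := Ioi 0))
    have h2 : ∀ᶠ ε in 𝓝[>] (0 : ℝ), ε ∈ Ioo 0 c₁ := Ioo_mem_nhdsGT hc₁
    obtain ⟨ε, h3, h4⟩ := (h1.and h2).exists
    exact ⟨ε, h4.1, h4.2, h3.le⟩
  refine ⟨ε, hε, hεc, fun T U₀ u v hu hv hI δ hδ hδT hJ => ?_⟩
  set κ : ℝ := ε + Cb * ε ^ (1 - 3 * b) with hκ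
  have hκpos : 0 < κ := by positivity
  have hTt : ∀ t ∈ Ioo 0 δ, ENNReal.ofReal t < T := fun t ht =>
    ((ENNReal.ofReal_lt_ofReal_iff hδ).2 ht.2).trans_le hδT
  obtain ⟨f, hfm, hf, hduh⟩ := hu.isDuhamelFlow.exists_interaction hv.isDuhamelFlow
  -- The estimate closes on itself because `-3/4 - 1/4 - c + 1 = -c`: the Beta integral returns the
  -- rate `t^{-c}`, with half the constant.
  have step : ∀ D : ℝ, 0 < D →
      (∀ s ∈ Ioo 0 δ, eLpNorm ((u - v) s) p volume ≤ ENNReal.ofReal (D * s ^ (-c))) →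
      ∀ t ∈ Ioo 0 δ, eLpNorm ((u - v) t) p volume ≤ ENNReal.ofReal (D / 2 * t ^ (-c)) := by
    intro D hD hDb t ht
    have ht0 := ht.1
    have hpt := enorm_sub_le_duhamelPotential hc₁ hu hv hI hduh ht0 (hTt t ht)
    set E : ℝ := Cs * (κ + ε ^ (1 / 6 : ℝ)) * D with hE
    have hEpos : 0 < E := by positivity
    have hpot := eLpNorm_duhamelPotential_le hp1 hfm (t := 0) (τ := t)
      (b := fun s => E * ((t - s) ^ (-(3 / 4) : ℝ) * s ^ (-(1 / 4) - c))) (by fun_prop)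
      (fun s hs => by have : 0 < t - s := by linarith [hs.2]
                      have := hs.1
                      positivity) (by
      filter_upwards [hf] with s hs hm
      simp only [zero_add]
      have hsδ : s ∈ Ioo 0 δ := ⟨hm.1, hm.2.trans ht.2⟩
      have h0 := hm.1
      have hTs := hTt s hsδ
      have e : (fun x => ∫⁻ y, kmaj (t - s) (x - y) * f (s, y)) = fun x => ∫⁻ y,
          kmaj (t - s) (x - y) * ((‖u s y‖ₑ + ‖v s y‖ₑ) * ‖(u - v) s y‖ₑ) := by
        funext x
        refine lintegral_congr_ae ?_
        filter_upwards [hs h0 hTs] with y hy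
        rw [hy]
      have hfin : eLpNorm ((u - v) s) p volume ≠ ∞ :=
        ((hDb s hsδ).trans_lt ENNReal.ofReal_lt_top).ne
      have hbl := hball ε hε hεc T U₀ u v hu hv hI s h0 hTs hfin (hJ s hsδ)
      rw [e]
      refine (hslice ε hε hεc s (t - s) (D * s ^ (-c)) κ (u s) (v s) ((u - v) s) h0
        (by linarith [hm.2]) (by positivity) hκpos
        (hu.isDuhamelFlow.aestronglyMeasurable_sub hv.isDuhamelFlow h0 hTs) (hI s h0 hTs)
        (hDb s hsδ) (hbl.trans ?_)).trans (le_of_eq ?_)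
      · rw [ENNReal.ofReal_mul hκpos.le]
        exact mul_le_mul_right (hDb s hsδ) _
      · congr 1
        rw [sub_eq_add_neg (-(1 / 4)) c, Real.rpow_add h0, hE]; ring)
    have hint : ∫⁻ s in Ioo 0 t,
        ENNReal.ofReal (E * ((t - s) ^ (-(3 / 4) : ℝ) * s ^ (-(1 / 4) - c))) ≤
        ENNReal.ofReal E * ENNReal.ofReal (β * t ^ (-c)) := by
      simp_rw [ENNReal.ofReal_mul hEpos.le]
      rw [lintegral_const_mul _ (by fun_prop)]
      refine mul_le_mul_right ?_ _
      refine (lintegral_beta_le ht0 (by norm_num) (by norm_num) (by linarith) (by linarith)).trans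
        (le_of_eq ?_)
      rw [hβ]; congr 3; ring
    refine (eLpNorm_le_const_mul_of_ae_enorm_le hp1
      (measurable_duhamelPotential hfm 0 t).aemeasurable hpt).trans ?_
    refine (mul_le_mul_right (hpot.trans hint) _).trans ?_
    rw [← ENNReal.ofReal_mul hEpos.le, ← ENNReal.ofReal_mul (by positivity)]
    refine ENNReal.ofReal_le_ofReal ?_
    calc 36 * kC * (E * (β * t ^ (-c))) =
          36 * kC * β * (Cs * (κ + ε ^ (1 / 6 : ℝ))) * (D * t ^ (-c)) := by rw [hE]; ring
      _ ≤ 1 / 2 * (D * t ^ (-c)) := by gcongr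
      _ = _ := by ring
  -- The Type I bound supplies the finite constant `c₁ * B` from which the halving starts.
  have hall : ∀ n : ℕ, ∀ t ∈ Ioo 0 δ,
      eLpNorm ((u - v) t) p volume ≤ ENNReal.ofReal (c₁ * B / 2 ^ n * t ^ (-c)) := by
    intro n
    induction n with
    | zero =>
      intro t ht
      simpa using hI.eLpNorm_le hc₁ ht.1 (hTt t ht) (hBw t ht.1)
    | succ n ih =>
      intro t ht
      refine (step _ (by positivity) ih t ht).trans (le_of_eq ?_)
      congr 2
      rw [pow_succ]; field_simp
  intro t ht
  refine eLpNorm_eq_zero_of_le_div_two_pow (D := c₁ * B * t ^ (-c)) fun n => (hall n t ht).trans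
    (le_of_eq ?_)
  congr 1; ring

/-- Uniqueness of bounded flows. -/
theorem IsDuhamelFlow.eq_of_eq_at {T : ℝ≥0∞} {u v : ℝ → E3 → E3} (hu : IsDuhamelFlow T u)
    (hv : IsDuhamelFlow T v) {t₀ A : ℝ} (ht₀ : 0 < t₀) (hA : 0 < A)
    (hub : ∀ s, t₀ ≤ s → ENNReal.ofReal s < T → eLpNorm (u s) ∞ volume ≤ ENNReal.ofReal A)
    (hvb : ∀ s, t₀ ≤ s → ENNReal.ofReal s < T → eLpNorm (v s) ∞ volume ≤ ENNReal.ofReal A)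
    (h0 : (u - v) t₀ =ᵐ[volume] 0) :
    ∀ t, t₀ ≤ t → ENNReal.ofReal t < T → (u - v) t =ᵐ[volume] 0 := by
  obtain ⟨C, hC, hbil⟩ := exists_bilinear_estimate (q := ∞) (by simp)
  have hc : critExp ∞ = 1 / 2 := by simp [critExp]
  rw [hc] at hbil
  -- A step length on which the bilinear estimate halves any bound on the difference. It depends
  -- only on the uniform bound `A`, so finitely many steps reach any given time.
  obtain ⟨η, hη, hηs⟩ : ∃ η : ℝ, 0 < η ∧ C * η ^ (1 / 2 : ℝ) * (2 * A) ≤ 1 / 2 := by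
    refine ⟨(1 / (4 * A * C)) ^ (2 : ℝ), by positivity, ?_⟩
    rw [← Real.rpow_mul (by positivity)]
    norm_num
    apply le_of_eq; field_simp; norm_num
  have hwb : ∀ s, t₀ ≤ s → ENNReal.ofReal s < T →
      eLpNorm ((u - v) s) ∞ volume ≤ ENNReal.ofReal (2 * A) := by
    intro s hs hT
    refine (eLpNorm_sub_le (hu.slice s (by linarith) hT) (hv.slice s (by linarith) hT) le_top).trans
      ((add_le_add (hub s hs hT) (hvb s hs hT)).trans ?_)
    rw [← ENNReal.ofReal_add hA.le hA.le, two_mul]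
  have hstep : ∀ t₁, t₀ ≤ t₁ → (u - v) t₁ =ᵐ[volume] 0 → ∀ τ, 0 < τ → τ ≤ η →
      ENNReal.ofReal (t₁ + τ) < T → (u - v) (t₁ + τ) =ᵐ[volume] 0 := by
    intro t₁ ht₁ hz
    have hheat : ∀ τ x, heat τ ((u - v) t₁) x = 0 := by
      intro τ x
      rw [heat]
      refine integral_eq_zero_of_ae ?_
      filter_upwards [hz] with y hy
      rw [hy]; simp
    have hall : ∀ n : ℕ, ∀ τ, 0 < τ → τ ≤ η → ENNReal.ofReal (t₁ + τ) < T →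
        eLpNorm ((u - v) (t₁ + τ)) ∞ volume ≤ ENNReal.ofReal (2 * A / 2 ^ n) := by
      intro n
      induction n with
      | zero =>
        intro τ hτ _ hT
        simpa using hwb (t₁ + τ) (by linarith) hT
      | succ n ih =>
        intro τ hτ hτη hT
        have hlt : ∀ s ∈ Ioo t₁ (t₁ + τ), ENNReal.ofReal s < T := fun s hs =>
          (ENNReal.ofReal_le_ofReal hs.2.le).trans_lt hT
        have h := hbil ∞ le_top (by simp) T u v hu hv t₁ τ A (2 * A / 2 ^ n) (by linarith) hτ hT hA
          (by positivity) (fun s hs => hub s (by linarith [hs.1]) (hlt s hs))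
          (fun s hs => hvb s (by linarith [hs.1]) (hlt s hs))
          (fun s hs => by
            have := ih (s - t₁) (by linarith [hs.1]) (by linarith [hs.2])
              (by rw [add_sub_cancel]; exact hlt s hs)
            rwa [add_sub_cancel] at this)
        simp only [hheat, sub_zero] at h
        refine h.trans (ENNReal.ofReal_le_ofReal ?_)
        have : τ ^ (1 / 2 : ℝ) ≤ η ^ (1 / 2 : ℝ) := Real.rpow_le_rpow hτ.le hτη (by norm_num)
        calc C * τ ^ (1 / 2 : ℝ) * (2 * A * (2 * A / 2 ^ n)) =
              C * τ ^ (1 / 2 : ℝ) * (2 * A) * (2 * A / 2 ^ n) := by ring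
          _ ≤ C * η ^ (1 / 2 : ℝ) * (2 * A) * (2 * A / 2 ^ n) := by gcongr
          _ ≤ 1 / 2 * (2 * A / 2 ^ n) := by gcongr
          _ = _ := by rw [pow_succ]; field_simp
    intro τ hτ hτη hT
    have := eLpNorm_eq_zero_of_le_div_two_pow fun n => hall n τ hτ hτη hT
    rwa [eLpNorm_eq_zero_iff (hu.aestronglyMeasurable_sub hv (by linarith) hT) (by simp)] at this
  have main : ∀ k : ℕ, ∀ t, t₀ ≤ t → t ≤ t₀ + k * η → ENNReal.ofReal t < T →
      (u - v) t =ᵐ[volume] 0 := by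
    intro k
    induction k with
    | zero =>
      intro t h1 h2 _
      have : t = t₀ := le_antisymm (by simpa using h2) h1
      rw [this]; exact h0
    | succ k ih =>
      intro t h1 h2 hT
      rcases le_or_gt t (t₀ + k * η) with h | h
      · exact ih t h1 h hT
      have hk0 : 0 ≤ (k : ℝ) * η := by positivity
      have hz := ih (t₀ + k * η) (by linarith) le_rfl
        ((ENNReal.ofReal_le_ofReal h.le).trans_lt hT)
      have := hstep (t₀ + k * η) (by linarith) hz (t - (t₀ + k * η)) (by linarith)
        (by push_cast at h2; linarith) (by rwa [add_sub_cancel])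
      rwa [add_sub_cancel] at this
  intro t h1 hT
  obtain ⟨k, hk⟩ := exists_nat_ge ((t - t₀) / η)
  rw [div_le_iff₀ hη] at hk
  exact main k t h1 (by linarith) hT

theorem CenteredTypeI.eLpNorm_top_le {T : ℝ≥0∞} {c₁ : ℝ} (hc₁ : 0 < c₁) {u v : ℝ → E3 → E3}
    (h : CenteredTypeI T c₁ u v) {t₀ s : ℝ} (ht₀ : 0 < t₀) (hs : t₀ ≤ s)
    (hT : ENNReal.ofReal s < T) :
    eLpNorm (u s) ∞ volume ≤ ENNReal.ofReal (c₁ / √t₀) ∧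
      eLpNorm (v s) ∞ volume ≤ ENNReal.ofReal (c₁ / √t₀) := by
  have hst := Real.sqrt_pos.2 ht₀
  have hle : ∀ᵐ x, ‖u s x‖ + ‖v s x‖ ≤ c₁ / √t₀ := by
    filter_upwards [h s (ht₀.trans_le hs) hT] with x hx
    refine hx.trans ?_
    have := Real.sqrt_le_sqrt hs
    gcongr
    linarith [norm_nonneg x]
  rw [eLpNorm_exponent_top, eLpNorm_exponent_top]
  constructor
  · refine eLpNormEssSup_le_of_ae_bound ?_
    filter_upwards [hle] with x hx
    linarith [norm_nonneg (v s x)]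
  · refine eLpNormEssSup_le_of_ae_bound ?_
    filter_upwards [hle] with x hx
    linarith [norm_nonneg (u s x)]

/-- The closeness to the averages is needed only near the initial time: from time `δ/2` on, both
flows are bounded by `c₁/√(δ/2)`, and uniqueness of bounded flows carries the equality forward. -/
theorem exists_uniqueness_criterion {p : ℝ≥0∞} (hp : 3 < p) {c₁ : ℝ} (hc₁ : 0 < c₁) :
    ∃ ε : ℝ, 0 < ε ∧ ε < c₁ ∧ ∀ (T : ℝ≥0∞)
      (U₀ : 𝓓((⊤ : TopologicalSpace.Opens E3), ℝ) → E3) (u v : ℝ → E3 → E3),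
      IsMildSolution T U₀ u → IsMildSolution T U₀ v → CenteredTypeI T c₁ u v →
      ∀ δ : ℝ, 0 < δ → ENNReal.ofReal δ ≤ T →
      (∀ t ∈ Ioo 0 δ,
        eLpNorm ((u - v) t - cubeAverage (hBar c₁ ε p (u - v) t) ((u - v) t)) p volume
          ≤ ENNReal.ofReal ε * eLpNorm ((u - v) t) p volume) →
      ∀ t, 0 < t → ENNReal.ofReal t < T → (u - v) t =ᵐ[volume] 0 := by
  have hp0 : p ≠ 0 := (lt_trans (by norm_num) hp).ne'
  obtain ⟨ε, hε, hεc, h⟩ := exists_threshold hp hc₁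
  refine ⟨ε, hε, hεc, fun T U₀ u v hu hv hI δ hδ hδT hJ t ht hT => ?_⟩
  have hz : ∀ t ∈ Ioo 0 δ, (u - v) t =ᵐ[volume] 0 := fun t ht => by
    have hTt : ENNReal.ofReal t < T := ((ENNReal.ofReal_lt_ofReal_iff hδ).2 ht.2).trans_le hδT
    rw [← eLpNorm_eq_zero_iff
      (hu.isDuhamelFlow.aestronglyMeasurable_sub hv.isDuhamelFlow ht.1 hTt) hp0]
    exact h T U₀ u v hu hv hI δ hδ hδT hJ t ht
  -- The restart takes place at `δ/2`, since vanishing is known on the open interval `(0,δ)` only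
  -- and `δ` may equal `T`.
  rcases lt_or_ge t (δ / 2) with h1 | h1
  · exact hz t ⟨ht, by linarith⟩
  have hδ2 : 0 < δ / 2 := by positivity
  have hA : 0 < c₁ / √(δ / 2) := div_pos hc₁ (Real.sqrt_pos.2 hδ2)
  exact hu.isDuhamelFlow.eq_of_eq_at hv.isDuhamelFlow hδ2 hA
    (fun s hs hTs => (hI.eLpNorm_top_le hc₁ hδ2 hs hTs).1)
    (fun s hs hTs => (hI.eLpNorm_top_le hc₁ hδ2 hs hTs).2)
    (hz (δ / 2) ⟨hδ2, by linarith⟩) t h1 hT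

end

theorem theorem3 :
    -- Uniqueness criterion
    (∀ (p : ℝ≥0∞) (c₁ : ℝ) (A : ℝ≥0), 3 < p → 0 < c₁ →
      ∃ ε₃ : ℝ, 0 < ε₃ ∧ ε₃ < c₁ ∧
        ∀ (T : ℝ≥0∞) (u₀ : E3 → E3) (u v : ℝ → E3 → E3),
          weakL3Norm u₀ = A →
          IsMildSolution T (regularDist u₀) u → IsMildSolution T (regularDist u₀) v →
          IsWeakL3Solution T u₀ u → IsWeakL3Solution T u₀ v →
          CenteredTypeI T c₁ u v →
          (∃ δ : ℝ, 0 < δ ∧ ENNReal.ofReal δ ≤ T ∧ ∀ t ∈ Ioo 0 δ,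
            eLpNorm ((u - v) t - cubeAverage (hBar c₁ ε₃ p (u - v) t) ((u - v) t)) p volume
              ≤ ENNReal.ofReal ε₃ * eLpNorm ((u - v) t) p volume) →
          ∀ t, 0 < t → ENNReal.ofReal t < T → (u - v) t =ᵐ[volume] 0) ∧
    -- Large scales are active
    (∀ (p : ℝ≥0∞) (ct CB : ℝ), 3 < p → 0 < ct → 0 < CB →
      ∃ K : ℝ, 0 < K ∧
        ∀ (U₀ : 𝓓'((⊤ : TopologicalSpace.Opens E3), E3)) (u v : ℝ → E3 → E3) (c₂ : ℝ),
          IsMildSolution ∞ U₀ u → IsMildSolution ∞ U₀ v →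
          LocallyBoundedLp p u → LocallyBoundedLp p v →
          0 < c₂ → CriticalLowerBound p c₂ (u - v) →
          ∀ t, 0 < t → ∀ γ h : ℝ,
            γ = gammaFrac p ct c₂ (M0 p u v t) t →
            1 / h = K * invScale p ct CB c₂ (M0 p u v t) t →
            ENNReal.ofReal (γ / 2) * eLpNorm ((u - v) t) p volume
              ≤ eLpNorm (cubeAverage h ((u - v) t)) p volume) := by
  refine ⟨?_, fun p ct CB hp hct hCB => ?_⟩
  · intro p c₁ A hp hc₁
    obtain ⟨ε, hε, hεc, h⟩ := exists_uniqueness_criterion hp hc₁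
    exact ⟨ε, hε, hεc, fun T u₀ u v _ hu hv _ _ hI ⟨δ, hδ, hδT, hJ⟩ =>
      h T (regularDist u₀) u v hu hv hI δ hδ hδT hJ⟩
  · obtain ⟨K, hK, h⟩ := exists_large_scales_active hp hct hCB
    exact ⟨K, hK, fun U₀ u v c₂ hu hv hlu hlv hc₂ hlow t ht γ r hγ hr =>
      h u v c₂ hu.isDuhamelFlow hv.isDuhamelFlow hlu hlv hc₂ hlow t ht γ r hγ hr⟩
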